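/- Let $\Gamma$ be an abelian group and let $A=\bigoplus_{\gamma\in\Gamma}A_\gamma$ be a $\Gamma$-graded field, i.e. a nonzero commutative $\Gamma$-graded ring in which every nonzero homogeneous element is invertible. For $\overline\delta=(\delta_1,\dots,\delta_n)\in\Gamma^n$ let $\mathbb M_n(A)(\overline\delta)$ be the matrix ring $\mathbb M_n(A)$ with the $\Gamma$-grading whose homogeneous elements of degree $\lambda$ are the matrices with $(i,j)$ entry in $A_{\lambda+\delta_j-\delta_i}$. A $\Gamma$-graded matricial $A$-algebra is a graded $A$-algebra graded isomorphic to a finite product $\mathbb M_{n_1}(A)(\overline\delta_1)\times\dots\times\mathbb M_{n_l}(A)(\overline\delta_l)$. A $\Gamma$-graded ultramatricial $A$-algebra is a unital $\Gamma$-graded $A$-algebra $R$ with $R=\bigcup_{i\ge 1}R_i$, where $R_1\subseteq R_2\subseteq\cdots$ are unital graded $A$-subalgebras of $R$ each of which is graded matricial. For a $\Gamma$-graded ring $R$ let $\operatorname{Gr-}R$ be the category of $\Gamma$-graded right $R$-modules and degree-preserving homomorphisms, and for $\alpha\in\Gamma$ let $\mathcal T_\alpha:\operatorname{Gr-}R\to\operatorname{Gr-}R$,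 $M\mapsto M(\alpha)$, be the shift functor, $M(\alpha)_\gamma=M_{\alpha+\gamma}$. Two $\Gamma$-graded rings $R$ and $S$ are graded Morita equivalent if there are functors $\phi:\operatorname{Gr-}R\to\operatorname{Gr-}S$ and $\psi:\operatorname{Gr-}S\to\operatorname{Gr-}R$ with $\phi\mathcal T_\alpha=\mathcal T_\alpha\phi$ and $\psi\mathcal T_\alpha=\mathcal T_\alpha\psi$ for all $\alpha\in\Gamma$, and natural isomorphisms $\psi\phi\cong 1_{\operatorname{Gr-}R}$ and $\phi\psi\cong 1_{\operatorname{Gr-}S}$. The graded Grothendieck group $K_0^{\rm gr}(R)$ is the group completion of the monoid, under direct sum, of graded isomorphism classes $[P]$ of graded finitely generated projective right $R$-modules. It is a $\mathbb Z[\Gamma]$-module via $\alpha[P]=[P(\alpha)]$, and it is pre-ordered with positive cone $K_0^{\rm gr}(R)_+$ the set of the classes $[P]$. **Theorem.** Let $R$ and $S$ be $\Gamma$-graded ultramatricial algebras over the $\Gamma$-graded field $A$. Then $R$ and $S$ are graded Morita equivalent if and only if $K_0^{\rm gr}(R)\cong K_0^{\rm gr}(S)$ as ordered $\mathbb Z[\Gamma]$-modules,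 that is, there is a $\mathbb Z[\Gamma]$-module isomorphism $f:K_0^{\rm gr}(R)\to K_0^{\rm gr}(S)$ with $f(K_0^{\rm gr}(R)_+)=K_0^{\rm gr}(S)_+$. -/

import Mathlib

open CategoryTheory

universe u v w

/-! ### Direct sum decompositions of shifts and of binary products -/

theorem GrMod.isInternal_shift {Γ : Type w} [AddCommGroup Γ] [DecidableEq Γ] {M : Type u}
    [AddCommGroup M] {d : Γ → AddSubgroup M} (h : DirectSum.IsInternal d) (α : Γ) :
    DirectSum.IsInternal (fun γ => d (α + γ)) := by
  classical
  obtain ⟨e, h1⟩ : ∃ e : (DirectSum Γ fun γ => d γ) ≃+ (DirectSum Γ fun γ => d (α + γ)),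
      ∀ x γ, ((e x) γ : M) = (x (α + γ) : M) :=
    ⟨DirectSum.equivCongrLeft (β := fun γ => d γ) (Equiv.addLeft α).symm, fun _ _ => rfl⟩
  have key : ∀ x, DirectSum.coeAddMonoidHom (fun γ => d (α + γ)) (e x)
      = DirectSum.coeAddMonoidHom d x := by
    intro x
    rw [DirectSum.coeAddMonoidHom_eq_dfinsuppSum, DirectSum.coeAddMonoidHom_eq_dfinsuppSum,
      DFinsupp.sum, DFinsupp.sum]
    refine Finset.sum_bij' (fun γ _ => α + γ) (fun γ _ => -α + γ) ?_ ?_ ?_ ?_ ?_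
    · intro γ hγ
      simp only [DFinsupp.mem_support_toFun, ne_eq] at hγ ⊢
      exact fun hh => hγ (Subtype.ext (by rw [h1, hh]))
    · intro γ hγ
      simp only [DFinsupp.mem_support_toFun, ne_eq] at hγ ⊢
      intro hh
      have h2 : ∀ δ, δ = γ → (x δ : M) = 0 → (x γ : M) = 0 := by
        rintro _ rfl h; exact h
      exact hγ (Subtype.ext (h2 _ (add_neg_cancel_left α γ) (by rw [← h1, hh]; rfl)))
    · intros; simp
    · intros; simp
    · intro γ _; exact h1 x γ
  have : (DirectSum.coeAddMonoidHom (fun γ => d (α + γ)) : _ → M)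
      = DirectSum.coeAddMonoidHom d ∘ e.symm := by
    funext y
    rw [Function.comp_apply, ← key, AddEquiv.apply_symm_apply]
  rw [DirectSum.IsInternal, this]
  exact h.comp e.symm.bijective

theorem GrMod.isInternal_prod {Γ : Type w} [DecidableEq Γ] {M N : Type u}
    [AddCommGroup M] [AddCommGroup N] {c : Γ → AddSubgroup M} {d : Γ → AddSubgroup N}
    (hc : DirectSum.IsInternal c) (hd : DirectSum.IsInternal d) :
    DirectSum.IsInternal (fun γ => (c γ).prod (d γ)) := by
  classical
  let f : ∀ γ, (c γ).prod (d γ) →+ c γ := fun γ =>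
    { toFun := fun x => ⟨x.1.1, x.2.1⟩, map_zero' := rfl, map_add' := fun _ _ => rfl }
  let g : ∀ γ, (c γ).prod (d γ) →+ d γ := fun γ =>
    { toFun := fun x => ⟨x.1.2, x.2.2⟩, map_zero' := rfl, map_add' := fun _ _ => rfl }
  let i : ∀ γ, c γ →+ (c γ).prod (d γ) := fun γ =>
    { toFun := fun x => ⟨(x.1, 0), x.2, (d γ).zero_mem⟩, map_zero' := rfl,
      map_add' := fun _ _ => Subtype.ext (Prod.ext rfl (add_zero _).symm) }
  let j : ∀ γ, d γ →+ (c γ).prod (d γ) := fun γ =>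
    { toFun := fun x => ⟨(0, x.1), (c γ).zero_mem, x.2⟩, map_zero' := rfl,
      map_add' := fun _ _ => Subtype.ext (Prod.ext (add_zero _).symm rfl) }
  have hf : ∀ x, (DirectSum.coeAddMonoidHom (fun γ => (c γ).prod (d γ)) x).1
      = DirectSum.coeAddMonoidHom c (DirectSum.map f x) := by
    intro x
    induction x using DirectSum.induction_on with
    | zero => simp
    | of γ x => simp [f]
    | add x y hx hy => simp [hx, hy]
  have hg : ∀ x, (DirectSum.coeAddMonoidHom (fun γ => (c γ).prod (d γ)) x).2
      = DirectSum.coeAddMonoidHom d (DirectSum.map g x) := by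
    intro x
    induction x using DirectSum.induction_on with
    | zero => simp
    | of γ x => simp [g]
    | add x y hx hy => simp [hx, hy]
  have hi : ∀ x, DirectSum.coeAddMonoidHom (fun γ => (c γ).prod (d γ)) (DirectSum.map i x)
      = (DirectSum.coeAddMonoidHom c x, 0) := by
    intro x
    induction x using DirectSum.induction_on with
    | zero => simp; rfl
    | of γ x => simp [i]
    | add x y hx hy => simp [hx, hy]
  have hj : ∀ x, DirectSum.coeAddMonoidHom (fun γ => (c γ).prod (d γ)) (DirectSum.map j x)
      = (0, DirectSum.coeAddMonoidHom d x) := by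
    intro x
    induction x using DirectSum.induction_on with
    | zero => simp; rfl
    | of γ x => simp [j]
    | add x y hx hy => simp [hx, hy]
  constructor
  · rw [injective_iff_map_eq_zero]
    intro x hx
    have h1 := hf x
    have h2 := hg x
    rw [hx] at h1 h2
    have h1' := (injective_iff_map_eq_zero _).1 hc.injective _ h1.symm
    have h2' := (injective_iff_map_eq_zero _).1 hd.injective _ h2.symm
    ext γ : 2
    have e1 : (f γ (x γ)) = 0 := by
      rw [← DirectSum.map_apply, h1']; rfl
    have e2 : (g γ (x γ)) = 0 := by
      rw [← DirectSum.map_apply, h2']; rfl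
    exact Prod.ext (congrArg Subtype.val e1) (congrArg Subtype.val e2)
  · rintro ⟨m, n⟩
    obtain ⟨x, hx⟩ := hc.surjective m
    obtain ⟨y, hy⟩ := hd.surjective n
    exact ⟨DirectSum.map i x + DirectSum.map j y, by rw [map_add, hi, hj, hx, hy]; simp⟩

theorem GrMod.isInternal_zero {Γ : Type w} [DecidableEq Γ] {M : Type u} [AddCommGroup M] [Subsingleton M]
   : DirectSum.IsInternal (fun _ : Γ => (⊥ : AddSubgroup M)) := by
  constructor
  · rw [injective_iff_map_eq_zero]
    intro x _
    ext γ 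
    exact Subsingleton.elim _ _
  · intro m; exact ⟨0, Subsingleton.elim _ _⟩

section GradedModules

variable {Γ : Type w} [AddCommGroup Γ] [DecidableEq Γ] {R : Type u} [Ring R]

/-- A `Γ`-graded right module over the ring `R` graded by `ℛ`: a right `R`-module (that is, a
module over `Rᵐᵒᵖ`, with `m * r` written `MulOpposite.op r • m`) which is the internal direct sum
of additive subgroups `deg γ`, `γ ∈ Γ`, such that `(deg γ) (ℛ δ) ⊆ deg (γ + δ)`. -/
structure GrMod (ℛ : Γ → AddSubgroup R) : Type (max w (u + 1)) where
  carrier : Type u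
  [addCommGroup : AddCommGroup carrier]
  [module : Module Rᵐᵒᵖ carrier]
  deg : Γ → AddSubgroup carrier
  isInternal : DirectSum.IsInternal deg
  smul_mem : ∀ {γ δ : Γ} {m : carrier} {r : R}, m ∈ deg γ → r ∈ ℛ δ →
    MulOpposite.op r • m ∈ deg (γ + δ)

namespace GrMod

variable {ℛ : Γ → AddSubgroup R}

instance : CoeSort (GrMod ℛ) (Type u) := ⟨GrMod.carrier⟩

attribute [instance] GrMod.addCommGroup GrMod.module

/-- Graded homomorphisms (of degree zero). -/
@[ext]
structure Hom (M N : GrMod ℛ) where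
  toLinearMap : M →ₗ[Rᵐᵒᵖ] N
  map_mem : ∀ {γ : Γ} {m : M}, m ∈ M.deg γ → toLinearMap m ∈ N.deg γ

/-- The category `Gr-R` of `Γ`-graded right `R`-modules and graded homomorphisms. -/
instance : Category (GrMod ℛ) where
  Hom M N := Hom M N
  id _ := ⟨LinearMap.id, fun h => h⟩
  comp f g := ⟨g.toLinearMap ∘ₗ f.toLinearMap, fun h => g.map_mem (f.map_mem h)⟩

/-- A linear isomorphism which respects the gradings in both directions is a graded isomorphism. -/
def isoMk {M N : GrMod ℛ} (e : M ≃ₗ[Rᵐᵒᵖ] N)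
    (h : ∀ γ m, m ∈ M.deg γ → e m ∈ N.deg γ)
    (h' : ∀ γ n, n ∈ N.deg γ → e.symm n ∈ M.deg γ) : M ≅ N where
  hom := (⟨e.toLinearMap, fun {γ m} hm => h γ m hm⟩ : Hom M N)
  inv := (⟨e.symm.toLinearMap, fun {γ n} hn => h' γ n hn⟩ : Hom N M)
  hom_inv_id := Hom.ext (LinearMap.ext fun x => e.symm_apply_apply x)
  inv_hom_id := Hom.ext (LinearMap.ext fun x => e.apply_symm_apply x)

/-- The shifted module `M(α)`: the module `M` with the grading `M(α)_γ = M_{α + γ}`. -/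
def shiftObj (α : Γ) (M : GrMod ℛ) : GrMod ℛ where
  carrier := M
  deg γ := M.deg (α + γ)
  isInternal := isInternal_shift M.isInternal α
  smul_mem hm hr := by
    rw [← add_assoc]
    exact M.smul_mem hm hr

/-- The shift (suspension) functor `𝒯_α : Gr-R ⥤ Gr-R`, `M ↦ M(α)`. -/
def shift (ℛ : Γ → AddSubgroup R) (α : Γ) : GrMod ℛ ⥤ GrMod ℛ where
  obj M := shiftObj α M
  map {M N} f :=
    (⟨(show Hom M N from f).toLinearMap, fun h => (show Hom M N from f).map_mem h⟩ :
      Hom (shiftObj α M) (shiftObj α N))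

/-- The zero module. -/
def zero (ℛ : Γ → AddSubgroup R) : GrMod ℛ where
  carrier := PUnit.{u + 1}
  deg _ := ⊥
  isInternal := isInternal_zero
  smul_mem _ _ := Subsingleton.elim _ _

/-- The direct sum of two graded modules, graded by `(M ⊕ N)_γ = M_γ ⊕ N_γ`. -/
def prod (M N : GrMod ℛ) : GrMod ℛ where
  carrier := M × N
  deg γ := (M.deg γ).prod (N.deg γ)
  isInternal := isInternal_prod M.isInternal N.isInternal
  smul_mem hm hr := ⟨M.smul_mem hm.1 hr, N.smul_mem hm.2 hr⟩

/-- A graded projective module: graded homomorphisms `P → N` lift through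
surjective graded homomorphisms `M → N`. -/
def IsGradedProjective (P : GrMod ℛ) : Prop :=
  ∀ (M N : GrMod ℛ) (g : Hom M N) (j : Hom P N), Function.Surjective g.toLinearMap →
    ∃ h : Hom P M, g.toLinearMap ∘ₗ h.toLinearMap = j.toLinearMap

theorem IsGradedProjective.zero : IsGradedProjective (zero ℛ) := fun M N g j _ =>
  ⟨⟨0, fun _ => (M.deg _).zero_mem⟩, LinearMap.ext fun x => by
    have hx : x = 0 := Subsingleton.elim (α := PUnit.{u + 1}) _ _
    rw [hx, map_zero, map_zero]⟩

theorem IsGradedProjective.prod {P Q : GrMod ℛ} (hP : IsGradedProjective P)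
    (hQ : IsGradedProjective Q) : IsGradedProjective (prod P Q) := by
  intro M N g j hg
  obtain ⟨h₁, e₁⟩ := hP M N g ⟨j.toLinearMap ∘ₗ LinearMap.inl Rᵐᵒᵖ P Q,
    fun hm => j.map_mem (m := (_, 0)) ⟨hm, (Q.deg _).zero_mem⟩⟩ hg
  obtain ⟨h₂, e₂⟩ := hQ M N g ⟨j.toLinearMap ∘ₗ LinearMap.inr Rᵐᵒᵖ P Q,
    fun hm => j.map_mem (m := (0, _)) ⟨(P.deg _).zero_mem, hm⟩⟩ hg
  refine ⟨⟨LinearMap.coprod h₁.toLinearMap h₂.toLinearMap, fun hm =>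
    (M.deg _).add_mem (h₁.map_mem hm.1) (h₂.map_mem hm.2)⟩, ?_⟩
  change _ ∘ₗ LinearMap.coprod h₁.toLinearMap h₂.toLinearMap = _
  rw [LinearMap.comp_coprod, e₁, e₂]
  exact (LinearMap.coprod_comp_inl_inr j.toLinearMap)

theorem IsGradedProjective.shift {P : GrMod ℛ} (hP : IsGradedProjective P) (α : Γ) :
    IsGradedProjective (shiftObj α P) := by
  intro M N g j hg
  obtain ⟨h, e⟩ := hP (shiftObj (-α) M) (shiftObj (-α) N)
    ⟨g.toLinearMap, fun hm => g.map_mem hm⟩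
    ⟨j.toLinearMap, fun {γ m} hm => j.map_mem (γ := -α + γ) (m := m)
      (by change m ∈ P.deg (α + (-α + γ)); rwa [add_neg_cancel_left])⟩ hg
  refine ⟨⟨h.toLinearMap, fun {γ m} hm => ?_⟩, e⟩
  have := h.map_mem (γ := α + γ) (m := m) hm
  change _ ∈ M.deg (-α + (α + γ)) at this
  rwa [neg_add_cancel_left] at this

end GrMod

/-! ### The graded Grothendieck group -/

/-- Graded finitely generated projective right `R`-modules. -/
def Pgr (ℛ : Γ → AddSubgroup R) : Type (max w (u + 1)) :=
  {P : GrMod ℛ // Module.Finite Rᵐᵒᵖ P ∧ P.IsGradedProjective}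

/-- Graded isomorphism of graded finitely generated projective modules. -/
instance Pgr.setoid (ℛ : Γ → AddSubgroup R) : Setoid (Pgr ℛ) where
  r P Q := Nonempty (P.1 ≅ Q.1)
  iseqv := ⟨fun _ => ⟨Iso.refl _⟩, fun ⟨e⟩ => ⟨e.symm⟩, fun ⟨e⟩ ⟨f⟩ => ⟨e ≪≫ f⟩⟩

namespace Pgr

variable {ℛ : Γ → AddSubgroup R}

def zero (ℛ : Γ → AddSubgroup R) : Pgr ℛ :=
  ⟨GrMod.zero ℛ, inferInstanceAs (Module.Finite Rᵐᵒᵖ PUnit.{u + 1}), .zero⟩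

def prod (P Q : Pgr ℛ) : Pgr ℛ :=
  ⟨GrMod.prod P.1 Q.1,
    have := P.2.1
    have := Q.2.1
    inferInstanceAs (Module.Finite Rᵐᵒᵖ (P.1 × Q.1)), P.2.2.prod Q.2.2⟩

def shift (α : Γ) (P : Pgr ℛ) : Pgr ℛ :=
  ⟨GrMod.shiftObj α P.1, P.2.1, P.2.2.shift α⟩

end Pgr

/-- The monoid `𝒱^gr(R)` of graded isomorphism classes of graded finitely generated projective
right `R`-modules. -/
def Vgr (ℛ : Γ → AddSubgroup R) : Type (max w (u + 1)) := Quotient (Pgr.setoid ℛ)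

namespace Vgr

variable {ℛ : Γ → AddSubgroup R}

/-- The class `[P]`. -/
def mk (P : Pgr ℛ) : Vgr ℛ := Quotient.mk _ P

theorem sound {P Q : Pgr ℛ} (e : P.1 ≅ Q.1) : mk P = mk Q := Quotient.sound ⟨e⟩

/-- `[P] + [Q] = [P ⊕ Q]`. -/
instance : Add (Vgr ℛ) where
  add := Quotient.map₂ Pgr.prod (by
    rintro P P' ⟨e⟩ Q Q' ⟨f⟩
    exact ⟨{
      hom := (⟨LinearMap.prodMap e.hom.toLinearMap f.hom.toLinearMap,
        fun h => ⟨e.hom.map_mem h.1, f.hom.map_mem h.2⟩⟩ :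
          GrMod.Hom (GrMod.prod P.1 Q.1) (GrMod.prod P'.1 Q'.1))
      inv := (⟨LinearMap.prodMap e.inv.toLinearMap f.inv.toLinearMap,
        fun h => ⟨e.inv.map_mem h.1, f.inv.map_mem h.2⟩⟩ :
          GrMod.Hom (GrMod.prod P'.1 Q'.1) (GrMod.prod P.1 Q.1))
      hom_inv_id := GrMod.Hom.ext (LinearMap.ext fun x => Prod.ext
        (LinearMap.congr_fun (congrArg GrMod.Hom.toLinearMap e.hom_inv_id) x.1)
        (LinearMap.congr_fun (congrArg GrMod.Hom.toLinearMap f.hom_inv_id) x.2))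
      inv_hom_id := GrMod.Hom.ext (LinearMap.ext fun x => Prod.ext
        (LinearMap.congr_fun (congrArg GrMod.Hom.toLinearMap e.inv_hom_id) x.1)
        (LinearMap.congr_fun (congrArg GrMod.Hom.toLinearMap f.inv_hom_id) x.2)) }⟩)

instance : Zero (Vgr ℛ) := ⟨mk (Pgr.zero ℛ)⟩

theorem mk_add_mk (P Q : Pgr ℛ) : mk P + mk Q = mk (P.prod Q) := rfl

theorem add_comm' (x y : Vgr ℛ) : x + y = y + x := by
  induction x using Quotient.inductionOn with | _ P
  induction y using Quotient.inductionOn with | _ Q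
  exact sound (GrMod.isoMk (M := GrMod.prod P.1 Q.1) (N := GrMod.prod Q.1 P.1)
    (LinearEquiv.prodComm Rᵐᵒᵖ P.1 Q.1) (fun _ _ h => ⟨h.2, h.1⟩) (fun _ _ h => ⟨h.2, h.1⟩))

theorem zero_add' (x : Vgr ℛ) : 0 + x = x := by
  induction x using Quotient.inductionOn with | _ P
  exact sound (GrMod.isoMk (M := GrMod.prod (GrMod.zero ℛ) P.1) (N := P.1)
    { toFun := fun x => x.2
      invFun := fun x => (PUnit.unit, x)
      map_add' := fun _ _ => rfl
      map_smul' := fun _ _ => rfl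
      left_inv := fun _ => rfl
      right_inv := fun _ => rfl }
    (fun _ _ h => h.2) (fun _ _ h => ⟨rfl, h⟩))

theorem add_assoc' (x y z : Vgr ℛ) : x + y + z = x + (y + z) := by
  induction x using Quotient.inductionOn with | _ P
  induction y using Quotient.inductionOn with | _ Q
  induction z using Quotient.inductionOn with | _ T
  exact sound (GrMod.isoMk (M := GrMod.prod (GrMod.prod P.1 Q.1) T.1)
    (N := GrMod.prod P.1 (GrMod.prod Q.1 T.1))
    (LinearEquiv.prodAssoc Rᵐᵒᵖ P.1 Q.1 T.1) (fun _ _ h => ⟨h.1.1, h.1.2, h.2⟩)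
    (fun _ _ h => ⟨⟨h.1, h.2.1⟩, h.2.2⟩))

instance : AddCommMonoid (Vgr ℛ) where
  add_assoc := add_assoc'
  zero_add := zero_add'
  add_zero x := (add_comm' x 0).trans (zero_add' x)
  add_comm := add_comm'
  nsmul := nsmulRec

/-- The action of `α ∈ Γ` on `𝒱^gr(R)`: `α [P] = [P(α)]`. -/
def shift (α : Γ) : Vgr ℛ →+ Vgr ℛ where
  toFun := Quotient.map (Pgr.shift α) (by
    rintro P Q ⟨e⟩
    exact ⟨(GrMod.shift ℛ α).mapIso e⟩)
  map_zero' := sound (GrMod.isoMk (M := GrMod.shiftObj α (GrMod.zero ℛ)) (N := GrMod.zero ℛ)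
    (LinearEquiv.refl Rᵐᵒᵖ PUnit.{u + 1}) (fun _ _ h => h) (fun _ _ h => h))
  map_add' x y := by
    induction x using Quotient.inductionOn with | _ P
    induction y using Quotient.inductionOn with | _ Q
    rfl

theorem shift_zero (x : Vgr ℛ) : shift 0 x = x := by
  induction x using Quotient.inductionOn with | _ P
  refine sound (GrMod.isoMk (M := GrMod.shiftObj 0 P.1) (N := P.1) (LinearEquiv.refl Rᵐᵒᵖ P.1)
    (fun γ m h => ?_) (fun γ m h => ?_))
  · change m ∈ P.1.deg (0 + γ) at h
    rwa [zero_add] at h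
  · change m ∈ P.1.deg (0 + γ)
    rwa [zero_add]

theorem shift_add (α β : Γ) (x : Vgr ℛ) : shift (α + β) x = shift α (shift β x) := by
  induction x using Quotient.inductionOn with | _ P
  refine sound (GrMod.isoMk (M := GrMod.shiftObj (α + β) P.1)
    (N := GrMod.shiftObj α (GrMod.shiftObj β P.1)) (LinearEquiv.refl Rᵐᵒᵖ P.1)
    (fun γ m h => ?_) (fun γ m h => ?_))
  · change m ∈ P.1.deg (α + β + γ) at h
    change m ∈ P.1.deg (β + (α + γ))
    rwa [add_left_comm, ← add_assoc]
  · change m ∈ P.1.deg (α + β + γ)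
    change m ∈ P.1.deg (β + (α + γ)) at h
    rwa [add_left_comm, ← add_assoc] at h

end Vgr

/-- The graded Grothendieck group `K₀^gr(R)`: the group completion of `𝒱^gr(R)`. -/
def K0gr (ℛ : Γ → AddSubgroup R) : Type (max w (u + 1)) :=
  Algebra.GrothendieckAddGroup (Vgr ℛ)

namespace K0gr

noncomputable instance (ℛ : Γ → AddSubgroup R) : AddCommGroup (K0gr ℛ) :=
  inferInstanceAs (AddCommGroup (Algebra.GrothendieckAddGroup (Vgr ℛ)))

/-- The canonical homomorphism `𝒱^gr(R) → K₀^gr(R)`. -/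
def of (ℛ : Γ → AddSubgroup R) : Vgr ℛ →+ K0gr ℛ := Algebra.GrothendieckAddGroup.of

variable {ℛ : Γ → AddSubgroup R}

/-- The universal property of the group completion. -/
noncomputable def lift {G : Type*} [AddCommGroup G] : (Vgr ℛ →+ G) ≃ (K0gr ℛ →+ G) :=
  Algebra.GrothendieckAddGroup.lift

theorem lift_of {G : Type*} [AddCommGroup G] (f : Vgr ℛ →+ G) (x : Vgr ℛ) :
    lift f (of ℛ x) = f x :=
  DFunLike.congr_fun (lift.symm_apply_apply f) x

theorem hom_ext {G : Type*} [AddCommGroup G] {f g : K0gr ℛ →+ G}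
    (h : ∀ x, f (of ℛ x) = g (of ℛ x)) : f = g :=
  lift.symm.injective (AddMonoidHom.ext h)

/-- The action of `Γ` on `K₀^gr(R)`, induced by `α [P] = [P(α)]`. -/
noncomputable def shift (ℛ : Γ → AddSubgroup R) :
    Multiplicative Γ →* AddMonoid.End (K0gr ℛ) where
  toFun α := lift ((of ℛ).comp (Vgr.shift α.toAdd))
  map_one' := hom_ext fun x => by
    rw [lift_of]
    exact congrArg (of ℛ) (Vgr.shift_zero x)
  map_mul' α β := hom_ext fun x => by
    change lift _ _ = lift _ (lift _ _)
    rw [lift_of, lift_of]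
    change _ = lift _ (of ℛ (Vgr.shift β.toAdd x))
    rw [lift_of]
    exact congrArg (of ℛ) (Vgr.shift_add _ _ x)

/-- The `ℤ[Γ]`-module structure of `K₀^gr(R)`. -/
noncomputable instance (ℛ : Γ → AddSubgroup R) : Module (AddMonoidAlgebra ℤ Γ) (K0gr ℛ) :=
  Module.compHom (K0gr ℛ)
    (AddMonoidAlgebra.lift ℤ (AddMonoid.End (K0gr ℛ)) Γ (shift ℛ)).toRingHom

/-- The positive cone `K₀^gr(R)₊` of the pre-ordering of `K₀^gr(R)` (`x ≥ y` if and only if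
`x - y` lies in the cone): the classes of graded finitely generated projective modules. -/
noncomputable def positiveCone (ℛ : Γ → AddSubgroup R) : AddSubmonoid (K0gr ℛ) := AddMonoidHom.mrange (of ℛ)

theorem single_smul_mk (α : Γ) (P : Pgr ℛ) :
    (AddMonoidAlgebra.single α (1 : ℤ)) • of ℛ (Vgr.mk P) = of ℛ (Vgr.mk (P.shift α)) := by
  change (AddMonoidAlgebra.lift ℤ (AddMonoid.End (K0gr ℛ)) Γ (shift ℛ)
    (AddMonoidAlgebra.single α (1 : ℤ))) (of ℛ (Vgr.mk P)) = _
  rw [AddMonoidAlgebra.lift_single, one_smul]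
  exact lift_of _ _

end K0gr

/-! ### Graded Morita equivalence -/

section Morita

variable {S : Type u} [Ring S] {ℛ : Γ → AddSubgroup R} {𝒮 : Γ → AddSubgroup S}

/-- A graded functor `φ : Gr-R ⥤ Gr-S`: one that commutes with the shifts, `φ 𝒯_α = 𝒯_α φ`. -/
def IsGradedFunctor (φ : GrMod ℛ ⥤ GrMod 𝒮) : Prop :=
  ∀ α : Γ, GrMod.shift ℛ α ⋙ φ = φ ⋙ GrMod.shift 𝒮 α

variable (ℛ 𝒮) in
/-- Graded Morita equivalence: there are graded functors between `Gr-R` and `Gr-S` in both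
directions which are inverse to each other up to natural isomorphism. -/
def GradedMoritaEquivalent : Prop :=
  ∃ (φ : GrMod ℛ ⥤ GrMod 𝒮) (ψ : GrMod 𝒮 ⥤ GrMod ℛ), IsGradedFunctor φ ∧ IsGradedFunctor ψ ∧
    Nonempty (φ ⋙ ψ ≅ 𝟭 (GrMod ℛ)) ∧ Nonempty (ψ ⋙ φ ≅ 𝟭 (GrMod 𝒮))

end Morita

end GradedModules

/-! ### Graded ultramatricial algebras -/

section Ultramatricial

variable {Γ : Type w} [AddCommGroup Γ] {A : Type v} [CommRing A]

/-- A graded field: a nonzero commutative graded ring in which every nonzero homogeneous element is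
invertible. -/
def IsGradedField (𝒜 : Γ → AddSubgroup A) : Prop :=
  Nontrivial A ∧ ∀ (γ : Γ) (a : A), a ∈ 𝒜 γ → a ≠ 0 → IsUnit a

/-- The grading of the graded matrix ring `𝕄_n(A)(δ₁, …, δ_n)`: the homogeneous elements of degree
`γ` are the matrices whose `(i, j)` entry lies in `A_{γ + δ_j - δ_i}`. -/
def matrixGrading (𝒜 : Γ → AddSubgroup A) {n : ℕ} (δ : Fin n → Γ) (γ : Γ) :
    AddSubgroup (Matrix (Fin n) (Fin n) A) where
  carrier := {x | ∀ i j, x i j ∈ 𝒜 (γ + δ j - δ i)}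
  add_mem' hx hy i j := add_mem (hx i j) (hy i j)
  zero_mem' _ _ := zero_mem _
  neg_mem' hx i j := neg_mem (hx i j)

/-- A graded matricial `A`-algebra: one that is isomorphic, as a graded `A`-algebra, to a finite
product `𝕄_{n₁}(A)(δ₁) × ⋯ × 𝕄_{n_l}(A)(δ_l)`. -/
def IsGradedMatricial (𝒜 : Γ → AddSubgroup A) {B : Type u} [Ring B] [Algebra A B]
    (ℬ : Γ → AddSubgroup B) : Prop :=
  ∃ (l : ℕ) (n : Fin l → ℕ) (δ : ∀ i, Fin (n i) → Γ)
    (e : (∀ i, Matrix (Fin (n i)) (Fin (n i)) A) ≃ₐ[A] B),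
    ∀ γ x, e x ∈ ℬ γ ↔ ∀ i, x i ∈ matrixGrading 𝒜 (δ i) γ

/-- A graded ultramatricial `A`-algebra: a graded `A`-algebra `R` which is the union of an
increasing sequence of (unital) graded matricial `A`-subalgebras, with the gradings
`(R_i)_γ = R_i ∩ R_γ`. -/
def IsGradedUltramatricial (𝒜 : Γ → AddSubgroup A) {R : Type u} [Ring R] [Algebra A R]
    (ℛ : Γ → AddSubgroup R) : Prop :=
  (∀ γ, ∀ a ∈ 𝒜 γ, algebraMap A R a ∈ ℛ γ) ∧
  ∃ C : ℕ → Subalgebra A R, Monotone C ∧ (∀ r : R, ∃ i, r ∈ C i) ∧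
    ∀ i, IsGradedMatricial 𝒜 (B := C i)
      fun γ => (ℛ γ).comap ((C i).val : C i →+* R).toAddMonoidHom

end Ultramatricial

/-! ### Homogeneous block matrices over a graded field -/

section Coefficients

variable {Γ : Type w} [AddCommGroup Γ] {A : Type v} [CommRing A]

/-! From left to right: an equivalence commuting with shifts preserves projectivity (epimorphisms
are the surjections, `GrMod.epi_iff_surjective`), finite generation (a compactness property that the
category sees, `GrMod.finite_functor_obj`) and direct sums (they are products). It therefore induces
a shift-equivariant isomorphism of the monoids `Vgr`, and group completion, cone and `ℤ[Γ]`-action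
are all built from that monoid.

From right to left: `Vgr` is cancellative (`IsLabelled.label_cancel`), so it embeds in `K0gr` as the
positive cone, and the given isomorphism restricts to an equivariant isomorphism `F` of the monoids.
Choose an `S`-module `Q` with `[Q] = F [R]`. Then `R ≅ End_S(Q)` as graded rings, and `Q` is a
generator because `[S]` is a summand of a finite sum of shifts of `[Q]`. For such a progenerator the
functors `Hom_S(Q, -)` and `Hom_R(Q*, -)` are mutually inverse; being Hom functors, they commute
with the shifts as an equality of functors and not just up to isomorphism.

The isomorphism `R ≅ End_S(Q)` comes from Elliott's back-and-forth argument. The endomorphism ring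
of a finitely generated graded projective module over an ultramatricial algebra is a corner of a
matrix ring over that algebra. Hence its finite subsets lie in spans of homogeneous matrix units,
and it is countably generated over `A`. Its idempotents of degree zero are labelled by the classes
of their images, and `IsLabelled` records what the argument needs of these labels. Labels split, so
a system of matrix units can be copied into another algebra whose unit has the same label
(`IsLabelled.exists_copy`); labels classify, so two copies with equal labels are conjugate in degree
zero (`IsLabelled.exists_conj`). Together these extend a partial isomorphism to any further element
(`MatUnitsPair.exists_extend`), and countability allows the union to exhaust both algebras.

The linear algebra underneath is that of a graded field: homogeneous idempotents of degree zero
split into rank-one pieces (`IsGrBlock.exists_split`), and the multiplicities of these pieces, up to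
shifts by degrees of nonzero scalars, are invariants (`IsGrBlock.map_link_eq`). Splitting makes
labels computable from coefficient matrices; invariance gives cancellation. -/

theorem IsGradedField.exists_inv [DecidableEq Γ] {𝒜 : Γ → AddSubgroup A} [GradedRing 𝒜]
    (hA : IsGradedField 𝒜) {γ : Γ} {a : A} (ha : a ∈ 𝒜 γ) (h0 : a ≠ 0) :
    ∃ b ∈ 𝒜 (-γ), b * a = 1 := by
  obtain ⟨b, hb⟩ := (hA.2 γ a ha h0).exists_left_inv
  refine ⟨DirectSum.decompose 𝒜 b (-γ), SetLike.coe_mem _, ?_⟩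
  have h := DirectSum.coe_decompose_mul_add_of_right_mem (a := b) (b := a) 𝒜 (i := -γ) ha
  rw [← h, hb, neg_add_cancel]
  exact DirectSum.decompose_of_mem_same 𝒜 SetLike.GradedOne.one_mem

/-- Block matrices `x`, homogeneous of degree `γ`: rows and columns carry a block and a degree,
the entries outside the blocks are zero and `x a b` has degree `γ + d' b - d a`. -/
def IsGrBlock (𝒜 : Γ → AddSubgroup A) {κ κ' : Type} (β : κ → ℕ) (d : κ → Γ) (β' : κ' → ℕ)
    (d' : κ' → Γ) (γ : Γ) (x : Matrix κ κ' A) : Prop :=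
  ∀ a b, (β a ≠ β' b → x a b = 0) ∧ x a b ∈ 𝒜 (γ + d' b - d a)

namespace IsGrBlock

variable {𝒜 : Γ → AddSubgroup A} {κ κ' κ'' : Type} {β : κ → ℕ} {d : κ → Γ} {β' : κ' → ℕ}
  {d' : κ' → Γ} {β'' : κ'' → ℕ} {d'' : κ'' → Γ} {γ δ : Γ}

theorem sub {x y : Matrix κ κ' A} (hx : IsGrBlock 𝒜 β d β' d' γ x)
    (hy : IsGrBlock 𝒜 β d β' d' γ y) : IsGrBlock 𝒜 β d β' d' γ (x - y) := fun a b =>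
  ⟨fun h => by rw [Matrix.sub_apply, (hx a b).1 h, (hy a b).1 h, sub_zero],
    sub_mem (hx a b).2 (hy a b).2⟩

theorem mul [SetLike.GradedMonoid 𝒜] [Fintype κ'] {x : Matrix κ κ' A} {y : Matrix κ' κ'' A}
    (hx : IsGrBlock 𝒜 β d β' d' γ x) (hy : IsGrBlock 𝒜 β' d' β'' d'' δ y) :
    IsGrBlock 𝒜 β d β'' d'' (γ + δ) (x * y) := by
  intro a c
  rw [Matrix.mul_apply]
  refine ⟨fun h => Finset.sum_eq_zero fun b _ => ?_, sum_mem fun b _ => ?_⟩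
  · by_cases hab : β a = β' b
    · rw [(hy b c).1 (by rwa [← hab]), mul_zero]
    · rw [(hx a b).1 hab, zero_mul]
  · have := SetLike.mul_mem_graded (hx a b).2 (hy b c).2
    convert this using 2
    abel

theorem mul_zero_zero [SetLike.GradedMonoid 𝒜] [Fintype κ'] {x : Matrix κ κ' A}
    {y : Matrix κ' κ'' A} (hx : IsGrBlock 𝒜 β d β' d' 0 x) (hy : IsGrBlock 𝒜 β' d' β'' d'' 0 y) :
    IsGrBlock 𝒜 β d β'' d'' 0 (x * y) := by
  simpa using hx.mul hy

theorem single [DecidableEq κ] [DecidableEq κ'] [SetLike.GradedMonoid 𝒜] {a : κ} {b : κ'}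
    (h : β a = β' b) :
    IsGrBlock 𝒜 β d β' d' (d a - d' b) (Matrix.single a b (1 : A)) := by
  intro i j
  by_cases hij : a = i ∧ b = j
  · obtain ⟨rfl, rfl⟩ := hij
    refine ⟨fun hh => (hh h).elim, ?_⟩
    rw [Matrix.single_apply_same]
    have h1 : d a - d' b + d' b - d a = 0 := by abel
    rw [h1]
    exact SetLike.GradedOne.one_mem
  · rw [Matrix.single_apply_of_ne _ _ _ _ _ hij]
    exact ⟨fun _ => rfl, zero_mem _⟩

end IsGrBlock

variable [DecidableEq Γ] {𝒜 : Γ → AddSubgroup A} [GradedRing 𝒜]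

/-- Homogeneous idempotent block matrices of degree zero split. -/
theorem IsGrBlock.exists_split (hA : IsGradedField 𝒜) {κ : Type} [Fintype κ] [DecidableEq κ]
    {β : κ → ℕ} {d : κ → Γ} {c : Matrix κ κ A} (hc : IsGrBlock 𝒜 β d β d 0 c) (hcc : c * c = c) :
    ∃ (J : Type) (_ : Fintype J) (_ : DecidableEq J) (t : J → κ) (U : Matrix κ J A)
      (V : Matrix J κ A), IsGrBlock 𝒜 β d (β ∘ t) (d ∘ t) 0 U ∧
        IsGrBlock 𝒜 (β ∘ t) (d ∘ t) β d 0 V ∧ V * U = 1 ∧ U * V = c := by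
  classical
  induction hn : (Finset.univ.filter fun a => c a ≠ 0).card using Nat.strong_induction_on
    generalizing c with
  | _ n ih =>
  by_cases h0 : c = 0
  · refine ⟨Empty, inferInstance, inferInstance, Empty.elim, 0, 0, fun _ b => b.elim,
      fun b _ => b.elim, Subsingleton.elim _ _, ?_⟩
    rw [h0, Matrix.zero_mul]
  obtain ⟨k, t, hkt⟩ : ∃ k t, c k t ≠ 0 := by
    by_contra! h
    exact h0 (Matrix.ext h)
  obtain ⟨w, hw, hw1⟩ := hA.exists_inv (hc k t).2 hkt
  have hβ : β k = β t := by
    by_contra h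
    exact hkt ((hc k t).1 h)
  -- Rank-one piece of `c`: its column `t`, and its row `k` divided by the entry `c k t`.
  -- Idempotency of `c` gives `v * u = 1`. Subtracting `u * v` clears row `k` and creates no new
  -- nonzero row, so the number of nonzero rows drops.
  let u : Matrix κ Unit A := Matrix.of fun a _ => c a t
  let v : Matrix Unit κ A := Matrix.of fun _ b => w * c k b
  have hu : IsGrBlock 𝒜 β d (fun _ : Unit => β t) (fun _ => d t) 0 u := fun a _ => hc a t
  have hv : IsGrBlock 𝒜 (fun _ : Unit => β t) (fun _ => d t) β d 0 v := fun _ b => by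
    refine ⟨fun h => ?_, ?_⟩
    · change w * c k b = 0
      rw [(hc k b).1 (by rwa [hβ]), mul_zero]
    · refine Eq.subst (motive := fun γ => w * c k b ∈ 𝒜 γ) ?_
        (SetLike.mul_mem_graded hw (hc k b).2)
      abel
  have hcu : c * u = u := by
    ext a i
    exact congrFun (congrFun hcc a) t
  have hvc : v * c = v := by
    ext i b
    have := congrFun (congrFun hcc k) b
    rw [Matrix.mul_apply] at this
    simp only [Matrix.mul_apply, v, Matrix.of_apply, mul_assoc, ← Finset.mul_sum, this]
  have hvu : v * u = 1 := by
    ext i j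
    have := congrFun (congrFun hcc k) t
    rw [Matrix.mul_apply] at this
    simp only [Matrix.mul_apply, v, u, Matrix.of_apply, mul_assoc, ← Finset.mul_sum, this, hw1]
    rfl
  have hc' : IsGrBlock 𝒜 β d β d 0 (c - u * v) := hc.sub (hu.mul_zero_zero hv)
  have hcc' : (c - u * v) * (c - u * v) = c - u * v := by
    have h1 : u * v * (u * v) = u * v := by
      rw [Matrix.mul_assoc, ← Matrix.mul_assoc v, hvu, Matrix.one_mul]
    have h2 : c * (u * v) = u * v := by rw [← Matrix.mul_assoc, hcu]
    have h3 : u * v * c = u * v := by rw [Matrix.mul_assoc, hvc]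
    rw [Matrix.sub_mul, Matrix.mul_sub, Matrix.mul_sub, hcc, h1, h2, h3, sub_self, sub_zero]
  have hlt : (Finset.univ.filter fun a => (c - u * v) a ≠ 0).card < n := by
    rw [← hn]
    apply Finset.card_lt_card
    rw [Finset.ssubset_iff_of_subset]
    · refine ⟨k, ?_, ?_⟩
      · simp only [ne_eq, Finset.mem_filter, Finset.mem_univ, true_and]
        intro h
        exact hkt (congrFun h t)
      · simp only [ne_eq, Finset.mem_filter, Finset.mem_univ, true_and, not_not]
        ext b
        simp only [Matrix.sub_apply, Matrix.mul_apply, u, v, Matrix.of_apply, Finset.univ_unique,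
          Finset.sum_singleton, Pi.zero_apply]
        rw [← mul_assoc, mul_comm (c k t), hw1, one_mul, sub_self]
    · intro a
      simp only [ne_eq, Finset.mem_filter, Finset.mem_univ, true_and]
      intro h h'
      apply h
      ext b
      have h1 : ∀ b, c a b = 0 := fun b => congrFun h' b
      simp [Matrix.sub_apply, Matrix.mul_apply, u, v, h1]
  obtain ⟨J, _, _, s, U, V, hU, hV, hVU, hUV⟩ := ih _ hlt hc' hcc' rfl
  have hU' : (c - u * v) * U = U := by rw [← hUV, Matrix.mul_assoc, hVU, Matrix.mul_one]
  have hV' : V * (c - u * v) = V := by rw [← hUV, ← Matrix.mul_assoc, hVU, Matrix.one_mul]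
  have hvU : v * U = 0 := by
    rw [← hU', ← Matrix.mul_assoc, Matrix.mul_sub, hvc, ← Matrix.mul_assoc, hvu, Matrix.one_mul,
      sub_self, Matrix.zero_mul]
  have hVu : V * u = 0 := by
    rw [← hV', Matrix.mul_assoc, Matrix.sub_mul, hcu, Matrix.mul_assoc, hvu, Matrix.mul_one,
      sub_self, Matrix.mul_zero]
  refine ⟨Unit ⊕ J, inferInstance, inferInstance, Sum.elim (fun _ => t) s, Matrix.fromCols u U,
    Matrix.fromRows v V, ?_, ?_, ?_, ?_⟩
  · rintro a (b | b)
    exacts [hu a b, hU a b]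
  · rintro (b | b) a
    exacts [hv b a, hV b a]
  · rw [Matrix.fromRows_mul_fromCols, hvu, hvU, hVu, hVU, Matrix.fromBlocks_one]
  · rw [Matrix.fromCols_mul_fromRows, hUV, add_sub_cancel]

/-- Two indices are linked if they lie in the same block and their degrees differ by the degree of
a nonzero homogeneous scalar. -/
def linkSetoid (hA : IsGradedField 𝒜) {κ : Type} (β : κ → ℕ) (d : κ → Γ) : Setoid κ where
  r a b := β a = β b ∧ ∃ c ∈ 𝒜 (d b - d a), c ≠ 0
  iseqv := by
    refine ⟨fun a => ⟨rfl, 1, ?_, ?_⟩, ?_, ?_⟩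
    · rw [sub_self]
      exact SetLike.GradedOne.one_mem
    · have := hA.1
      exact one_ne_zero
    · rintro a b ⟨h, c, hc, hc0⟩
      obtain ⟨c', hc', h1⟩ := hA.exists_inv hc hc0
      refine ⟨h.symm, c', by rwa [neg_sub] at hc', ?_⟩
      rintro rfl
      have := hA.1
      simp at h1
    · rintro a b e ⟨h, c, hc, hc0⟩ ⟨h', c', hc', hc0'⟩
      refine ⟨h.trans h', c * c', ?_, ?_⟩
      · convert SetLike.mul_mem_graded hc hc' using 2
        abel
      · intro h0
        exact hc0 (((hA.2 _ c' hc' hc0').mul_left_eq_zero).1 h0)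

/-- The multiplicities of the link classes are invariants of homogeneous isomorphisms. -/
theorem IsGrBlock.map_link_eq (hA : IsGradedField 𝒜) {κ J J' : Type} [Fintype J] [Fintype J']
    [DecidableEq J] [DecidableEq J'] {β : κ → ℕ} {d : κ → Γ} {t : J → κ} {t' : J' → κ}
    {x : Matrix J J' A} {y : Matrix J' J A}
    (hx : IsGrBlock 𝒜 (β ∘ t) (d ∘ t) (β ∘ t') (d ∘ t') 0 x)
    (hy : IsGrBlock 𝒜 (β ∘ t') (d ∘ t') (β ∘ t) (d ∘ t) 0 y) (hxy : x * y = 1) (hyx : y * x = 1) :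
    (Finset.univ.val.map fun j => Quotient.mk (linkSetoid hA β d) (t j)) =
      Finset.univ.val.map fun j => Quotient.mk (linkSetoid hA β d) (t' j) := by
  classical
  have := hA.1
  ext C
  rw [Multiset.count_map, Multiset.count_map]
  -- A nonzero entry `x i k` is a scalar of degree `d (t' k) - d (t i)` within one block, so it
  -- links the two indices. Hence `x` does not mix link classes, and `x * y = 1` survives
  -- restriction to the class `C`.
  have key : ∀ {J J' : Type} [Fintype J] [Fintype J'] [DecidableEq J] [DecidableEq J']
      {t : J → κ} {t' : J' → κ} {x : Matrix J J' A} {y : Matrix J' J A}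
      (_ : IsGrBlock 𝒜 (β ∘ t) (d ∘ t) (β ∘ t') (d ∘ t') 0 x) (_ : x * y = 1),
      (x.submatrix (fun j : {j // C = Quotient.mk (linkSetoid hA β d) (t j)} => j.1)
          (fun j : {j // C = Quotient.mk (linkSetoid hA β d) (t' j)} => j.1)) *
        (y.submatrix (fun j : {j // C = Quotient.mk (linkSetoid hA β d) (t' j)} => j.1)
          (fun j : {j // C = Quotient.mk (linkSetoid hA β d) (t j)} => j.1)) = 1 := by
    intro J J' _ _ _ _ t t' x y hx hxy
    ext i j
    have h := congrFun (congrFun hxy i.1) j.1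
    rw [Matrix.mul_apply] at h ⊢
    rw [Matrix.one_apply] at h ⊢
    simp only [Subtype.ext_iff]
    rw [← h]
    simp only [Matrix.submatrix_apply]
    rw [← Finset.sum_filter_of_ne (s := Finset.univ)
        (p := fun j => C = Quotient.mk (linkSetoid hA β d) (t' j))
        (f := fun k => x i.1 k * y k j.1)]
    · exact (Finset.sum_subtype _ (by simp) (fun k => x i.1 k * y k j.1)).symm
    · intro k _ hk
      rw [i.2]
      apply Quotient.sound
      have h0 : x i.1 k ≠ 0 := fun h => hk (by rw [h, zero_mul])
      refine ⟨?_, x i.1 k, ?_, h0⟩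
      · by_contra h
        exact h0 ((hx i.1 k).1 h)
      · simpa using (hx i.1 k).2
  -- A nontrivial commutative ring has invariant basis number, so `C` occurs equally often on both
  -- sides.
  have := Matrix.square_of_invertible _ _ (key hx hxy) (key hy hyx)
  rw [Fintype.card_subtype, Fintype.card_subtype] at this
  simpa [Finset.card_def] using this

end Coefficients

/-! ### Systems of homogeneous matrix units -/

section MatrixUnits

variable {Γ : Type w} [AddCommGroup Γ] {A : Type v} [CommRing A]

/-- Block matrices: the entries outside the diagonal blocks are zero. -/
def blockAlg (A : Type v) [CommRing A] {κ : Type} [Fintype κ] [DecidableEq κ] (β : κ → ℕ) :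
    Subalgebra A (Matrix κ κ A) where
  carrier := {x | ∀ a b, β a ≠ β b → x a b = 0}
  mul_mem' {x y} hx hy a b h := by
    rw [Matrix.mul_apply]
    refine Finset.sum_eq_zero fun c _ => ?_
    by_cases hac : β a = β c
    · rw [hy c b (by rwa [← hac]), mul_zero]
    · rw [hx a c hac, zero_mul]
  add_mem' hx hy a b h := by rw [Matrix.add_apply, hx a b h, hy a b h, add_zero]
  algebraMap_mem' r a b h := by
    rw [Matrix.algebraMap_matrix_apply, if_neg fun hab => h (congrArg β hab)]

theorem IsGrBlock.mem_blockAlg {𝒜 : Γ → AddSubgroup A} {κ : Type} [Fintype κ] [DecidableEq κ]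
    {β : κ → ℕ} {d : κ → Γ} {γ : Γ} {x : Matrix κ κ A} (hx : IsGrBlock 𝒜 β d β d γ x) :
    x ∈ blockAlg A β := fun a b => (hx a b).1

/-- Graded algebras over `𝒜` on whose homogeneous elements scalars act faithfully, also with
respect to degrees. -/
structure IsGrAlg (𝒜 : Γ → AddSubgroup A) {E : Type u} [Ring E] [Algebra A E]
    (ℰ : Γ → AddSubgroup E) : Prop where
  one_mem : (1 : E) ∈ ℰ 0
  mul_mem : ∀ {γ δ x y}, x ∈ ℰ γ → y ∈ ℰ δ → x * y ∈ ℰ (γ + δ)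
  smul_mem : ∀ {γ δ} {c : A} {x : E}, c ∈ 𝒜 γ → x ∈ ℰ δ → c • x ∈ ℰ (γ + δ)
  eq_zero_of_smul : ∀ {ε} {c : A} {x : E}, x ∈ ℰ ε → x ≠ 0 → c • x = 0 → c = 0
  mem_of_smul_mem : ∀ {γ ε} {c : A} {x : E}, x ∈ ℰ ε → x ≠ 0 → c • x ∈ ℰ (γ + ε) → c ∈ 𝒜 γ

variable {E : Type u} [Ring E] [Algebra A E]

/-- Homogeneous matrix units with sum `1`, in a product of matrix algebras with blocks `β`. -/
structure MatUnits (ℰ : Γ → AddSubgroup E) {κ : Type} [Fintype κ] (β : κ → ℕ) (d : κ → Γ) where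
  e : κ → κ → E
  mem : ∀ {a b}, β a = β b → e a b ∈ ℰ (d a - d b)
  mul : ∀ {a b c}, β a = β b → β b = β c → e a b * e b c = e a c
  mul_of_ne : ∀ {a b c c'}, b ≠ c → e a b * e c c' = 0
  eq_zero : ∀ {a b}, β a ≠ β b → e a b = 0
  sum : ∑ a, e a a = 1
  ne_zero : ∀ a, e a a ≠ 0

namespace MatUnits

variable {𝒜 : Γ → AddSubgroup A} {ℰ : Γ → AddSubgroup E} {κ : Type} [Fintype κ] {β : κ → ℕ}
  {d : κ → Γ}

theorem mem_zero (g : MatUnits ℰ β d) (a : κ) : g.e a a ∈ ℰ 0 := by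
  simpa using g.mem (a := a) (b := a) rfl

/-- The element with coefficient matrix `x`. -/
def lin (g : MatUnits ℰ β d) : Matrix κ κ A →ₗ[A] E where
  toFun x := ∑ a, ∑ b, x a b • g.e a b
  map_add' x y := by simp [add_smul, Finset.sum_add_distrib]
  map_smul' c x := by simp [mul_smul, Finset.smul_sum]

theorem lin_apply (g : MatUnits ℰ β d) (x : Matrix κ κ A) :
    g.lin x = ∑ a, ∑ b, x a b • g.e a b := rfl

theorem lin_single [DecidableEq κ] (g : MatUnits ℰ β d) (a b : κ) (c : A) :
    g.lin (Matrix.single a b c) = c • g.e a b := by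
  rw [lin_apply, Finset.sum_eq_single a, Finset.sum_eq_single b]
  · rw [Matrix.single_apply_same]
  · intro b' _ h
    rw [Matrix.single_apply_of_ne _ _ _ _ _ (fun hh => h hh.2.symm), zero_smul]
  · simp
  · intro a' _ h
    refine Finset.sum_eq_zero fun b' _ => ?_
    rw [Matrix.single_apply_of_ne _ _ _ _ _ (fun hh => h hh.1.symm), zero_smul]
  · simp

theorem lin_one [DecidableEq κ] (g : MatUnits ℰ β d) : g.lin (1 : Matrix κ κ A) = 1 := by
  rw [lin_apply, ← g.sum]
  refine Finset.sum_congr rfl fun a _ => ?_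
  simp [Matrix.one_apply]

theorem e_mul_lin (g : MatUnits ℰ β d) {a b : κ} (h : β a = β b) (x : Matrix κ κ A) :
    g.e a b * g.lin x = ∑ c, x b c • g.e a c := by
  rw [lin_apply, Finset.mul_sum, Finset.sum_eq_single b]
  · rw [Finset.mul_sum]
    refine Finset.sum_congr rfl fun c _ => ?_
    rw [mul_smul_comm]
    by_cases hbc : β b = β c
    · rw [g.mul h hbc]
    · rw [g.eq_zero hbc, g.eq_zero (a := a) (b := c) (by rwa [h]), mul_zero, smul_zero]
  · intro c _ hc
    rw [Finset.mul_sum]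
    refine Finset.sum_eq_zero fun c' _ => ?_
    rw [mul_smul_comm, g.mul_of_ne hc.symm, smul_zero]
  · simp

/-- Two-sided multiplication by matrix units isolates one coefficient, so coefficients, and with
them their degrees, can be read off from the element of `E`. -/
theorem e_mul_lin_mul_e (g : MatUnits ℰ β d) {a b a' b' : κ} (h : β a = β b) (h' : β a' = β b')
    (hb : β b = β a') (x : Matrix κ κ A) :
    g.e a b * g.lin x * g.e a' b' = x b a' • g.e a b' := by
  rw [g.e_mul_lin h, Finset.sum_mul, Finset.sum_eq_single a']
  · rw [smul_mul_assoc, g.mul (h.trans hb) h']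
  · intro c _ hc
    rw [smul_mul_assoc, g.mul_of_ne hc, smul_zero]
  · simp

theorem lin_mul [DecidableEq κ] (g : MatUnits ℰ β d) {x : Matrix κ κ A} (hx : x ∈ blockAlg A β)
    (y : Matrix κ κ A) : g.lin (x * y) = g.lin x * g.lin y := by
  have : ∀ a, ∑ b, x a b • g.e a b * g.lin y = ∑ c, (x * y) a c • g.e a c := by
    intro a
    have : ∀ b, x a b • g.e a b * g.lin y = ∑ c, (x a b * y b c) • g.e a c := by
      intro b
      by_cases h : β a = β b
      · rw [smul_mul_assoc, g.e_mul_lin h, Finset.smul_sum]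
        simp only [mul_smul]
      · rw [hx a b h]
        simp
    simp only [this]
    rw [Finset.sum_comm]
    simp only [Matrix.mul_apply, Finset.sum_smul]
  rw [lin_apply, lin_apply, Finset.sum_mul]
  refine Finset.sum_congr rfl fun a _ => ?_
  rw [← this, Finset.sum_mul]

theorem eq_zero_of_lin [DecidableEq κ] (hE : IsGrAlg 𝒜 ℰ) (g : MatUnits ℰ β d) {x : Matrix κ κ A}
    (hx : x ∈ blockAlg A β) (h : g.lin x = 0) : x = 0 := by
  ext a b
  by_cases hab : β a = β b
  · have := g.e_mul_lin_mul_e (rfl : β a = β a) hab.symm hab x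
    rw [h, mul_zero, zero_mul] at this
    exact hE.eq_zero_of_smul (g.mem_zero a) (g.ne_zero a) this.symm
  · exact hx a b hab

theorem lin_injOn [DecidableEq κ] (hE : IsGrAlg 𝒜 ℰ) (g : MatUnits ℰ β d) {x y : Matrix κ κ A}
    (hx : x ∈ blockAlg A β) (hy : y ∈ blockAlg A β) (h : g.lin x = g.lin y) : x = y :=
  sub_eq_zero.1 (g.eq_zero_of_lin hE (sub_mem hx hy) (by rw [map_sub, h, sub_self]))

theorem lin_mem (hE : IsGrAlg 𝒜 ℰ) (g : MatUnits ℰ β d) {γ : Γ} {x : Matrix κ κ A}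
    (hx : IsGrBlock 𝒜 β d β d γ x) : g.lin x ∈ ℰ γ := by
  refine sum_mem fun a _ => sum_mem fun b _ => ?_
  by_cases hab : β a = β b
  · have := hE.smul_mem (hx a b).2 (g.mem hab)
    convert this using 2
    abel
  · rw [g.eq_zero hab, smul_zero]
    exact zero_mem _

/-- The element `x a b • e a a = e a a * lin x * e b a` is homogeneous, and scalars acting on the
nonzero `e a a` have their degree determined. With `lin_mem`, the grading of `E` on the span is
exactly the block matrix grading. -/
theorem isGrBlock_of_lin_mem [DecidableEq κ] (hE : IsGrAlg 𝒜 ℰ) (g : MatUnits ℰ β d) {γ : Γ}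
    {x : Matrix κ κ A} (hx : x ∈ blockAlg A β) (h : g.lin x ∈ ℰ γ) :
    IsGrBlock 𝒜 β d β d γ x := by
  intro a b
  refine ⟨hx a b, ?_⟩
  by_cases hab : β a = β b
  · have := g.e_mul_lin_mul_e (rfl : β a = β a) hab.symm hab x
    have h1 := hE.mul_mem (hE.mul_mem (g.mem_zero a) h) (g.mem hab.symm)
    rw [this] at h1
    refine hE.mem_of_smul_mem (g.mem_zero a) (g.ne_zero a) ?_
    convert h1 using 2
    abel
  · rw [hx a b hab]
    exact zero_mem _

/-- The algebra homomorphism determined by a system of matrix units. -/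
def hom [DecidableEq κ] (g : MatUnits ℰ β d) : blockAlg A β →ₐ[A] E :=
  AlgHom.ofLinearMap (g.lin ∘ₗ (blockAlg A β).val.toLinearMap) g.lin_one
    fun x y => g.lin_mul x.2 y.1

/-- Conjugation of a system of matrix units by a unit of degree zero. -/
def conj (hE : IsGrAlg 𝒜 ℰ) (g : MatUnits ℰ β d) (u : Eˣ) (hu : u.1 ∈ ℰ 0)
    (hu' : u.inv ∈ ℰ 0) : MatUnits ℰ β d where
  e a b := u.1 * g.e a b * u.inv
  mem h := by
    have := hE.mul_mem (hE.mul_mem hu (g.mem h)) hu'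
    rwa [zero_add, add_zero] at this
  mul {a b c} h h' := by
    have : u.1 * g.e a b * u.inv * (u.1 * g.e b c * u.inv)
        = u.1 * (g.e a b * ((u.inv * u.1) * g.e b c)) * u.inv := by simp only [mul_assoc]
    rw [this, u.inv_val, one_mul, g.mul h h']
  mul_of_ne {a b c c'} h := by
    have : u.1 * g.e a b * u.inv * (u.1 * g.e c c' * u.inv)
        = u.1 * (g.e a b * ((u.inv * u.1) * g.e c c')) * u.inv := by simp only [mul_assoc]
    rw [this, u.inv_val, one_mul, g.mul_of_ne h, mul_zero, zero_mul]
  eq_zero h := by rw [g.eq_zero h, mul_zero, zero_mul]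
  sum := by rw [← Finset.sum_mul, ← Finset.mul_sum, g.sum, mul_one, u.val_inv]
  ne_zero a h := g.ne_zero a (by
    have : g.e a a = (u.inv * u.1) * g.e a a * (u.inv * u.1) := by
      rw [u.inv_val, one_mul, mul_one]
    rw [this]
    have h2 : u.inv * u.1 * g.e a a * (u.inv * u.1) = u.inv * (u.1 * g.e a a * u.inv) * u.1 := by
      simp only [mul_assoc]
    rw [h2, h, mul_zero, zero_mul])

theorem conj_lin (hE : IsGrAlg 𝒜 ℰ) (g : MatUnits ℰ β d) (u : Eˣ) (hu : u.1 ∈ ℰ 0)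
    (hu' : u.inv ∈ ℰ 0) (x : Matrix κ κ A) :
    (g.conj hE u hu hu').lin x = u.1 * g.lin x * u.inv := by
  simp only [lin_apply, Finset.mul_sum, Finset.sum_mul, conj, mul_smul_comm, smul_mul_assoc]

/-- A system of matrix units in the linear span of `g` is transported along `g.e a b ↦ g'.e a b`. -/
def transfer (hE : IsGrAlg 𝒜 ℰ) {E' : Type*} [Ring E'] [Algebra A E'] {ℰ' : Γ → AddSubgroup E'}
    (hE' : IsGrAlg 𝒜 ℰ') {κ' : Type} [Fintype κ'] [DecidableEq κ'] {β' : κ' → ℕ} {d' : κ' → Γ}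
    (f : MatUnits ℰ β d) (g : MatUnits ℰ β' d') (g' : MatUnits ℰ' β' d')
    (c : κ → κ → Matrix κ' κ' A) (hc : ∀ a b, c a b ∈ blockAlg A β')
    (h : ∀ a b, g.lin (c a b) = f.e a b) : MatUnits ℰ' β d where
  e a b := g'.lin (c a b)
  mem {a b} hab := g'.lin_mem hE' (g.isGrBlock_of_lin_mem hE (hc a b) (by
    rw [h]
    exact f.mem hab))
  mul {a b b'} hab hb := by
    rw [← g'.lin_mul (hc _ _)]
    congr 1
    refine g.lin_injOn hE (mul_mem (hc _ _) (hc _ _)) (hc _ _) ?_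
    rw [g.lin_mul (hc _ _), h, h, h, f.mul hab hb]
  mul_of_ne {a b b' a'} hb := by
    rw [← g'.lin_mul (hc _ _)]
    have : c a b * c b' a' = 0 := g.eq_zero_of_lin hE (mul_mem (hc _ _) (hc _ _)) (by
      rw [g.lin_mul (hc _ _), h, h, f.mul_of_ne hb])
    rw [this, map_zero]
  eq_zero {a b} hab := by
    rw [g.eq_zero_of_lin hE (hc a b) (by rw [h, f.eq_zero hab]), map_zero]
  sum := by
    rw [← map_sum, ← g'.lin_one (A := A)]
    congr 1
    refine g.lin_injOn hE (sum_mem fun _ _ => hc _ _) (one_mem _) ?_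
    rw [map_sum, g.lin_one, ← f.sum]
    simp only [h]
  ne_zero a h0 := f.ne_zero a (by
    rw [← h, g'.eq_zero_of_lin hE' (hc a a) h0, map_zero])

end MatUnits

end MatrixUnits

/-! ### Graded algebras with labelled idempotents and intertwining -/

section Labelled

variable {Γ : Type w} [AddCommGroup Γ] {A : Type v} [CommRing A]

/-- A graded algebra, countably generated as a module over the scalars, in which finite subsets
lie in spans of systems of matrix units. -/
structure IsLocMat (𝒜 : Γ → AddSubgroup A) {E : Type u} [Ring E] [Algebra A E]
    (ℰ : Γ → AddSubgroup E) : Prop extends IsGrAlg 𝒜 ℰ where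
  exists_matUnits : ∀ t : Finset E, ∃ (κ : Type) (_ : Fintype κ) (_ : DecidableEq κ) (β : κ → ℕ)
    (d : κ → Γ) (g : MatUnits ℰ β d), ∀ x ∈ t, ∃ c ∈ blockAlg A β, g.lin c = x
  countable : ∃ T : Set E, T.Countable ∧ Submodule.span A T = ⊤

/-- A locally matricial graded algebra whose idempotents of degree zero have labels in a monoid
which classify them up to homogeneous equivalence. -/
structure IsLabelled (𝒜 : Γ → AddSubgroup A) {E : Type u} [Ring E] [Algebra A E]
    (ℰ : Γ → AddSubgroup E) {V : Type*} [AddCommMonoid V] (τ : Γ → V →+ V)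
    (Lab : E → V → Prop) : Prop extends IsLocMat 𝒜 ℰ where
  shift_zero : ∀ v, τ 0 v = v
  lab_mem : ∀ {p v}, Lab p v → p ∈ ℰ 0
  lab_idem : ∀ {p v}, Lab p v → p * p = p
  exists_lab : ∀ {p}, p ∈ ℰ 0 → p * p = p → ∃ v, Lab p v
  lab_unique : ∀ {p v w}, Lab p v → Lab p w → v = w
  lab_of_equiv : ∀ {p p' v γ x y}, Lab p v → x ∈ ℰ γ → y ∈ ℰ (-γ) → x * y = p' → y * x = p →
    x * p = x → Lab p' (τ γ v)
  lab_lift : ∀ {p p' v γ}, Lab p v → Lab p' (τ γ v) →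
    ∃ x ∈ ℰ γ, ∃ y ∈ ℰ (-γ), x * y = p' ∧ y * x = p ∧ x * p = x ∧ p * y = y
  lab_zero : Lab 0 0
  lab_add : ∀ {p q v w}, Lab p v → Lab q w → p * q = 0 → q * p = 0 → Lab (p + q) (v + w)
  lab_split : ∀ {p v w}, Lab p (v + w) →
    ∃ q r, Lab q v ∧ Lab r w ∧ q * r = 0 ∧ r * q = 0 ∧ q + r = p

namespace IsLabelled

variable {𝒜 : Γ → AddSubgroup A} {E : Type u} [Ring E] [Algebra A E] {ℰ : Γ → AddSubgroup E}
  {V : Type*} [AddCommMonoid V] {τ : Γ → V →+ V} {Lab : E → V → Prop}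

/-- Relabelling allows algebras over different base rings to share one label monoid, as the
comparison of two labelled algebras requires. -/
theorem map (hE : IsLabelled 𝒜 ℰ τ Lab) {V' : Type*} [AddCommMonoid V'] {τ' : Γ → V' →+ V'}
    (F : V ≃+ V') (hF : ∀ γ v, F (τ γ v) = τ' γ (F v)) :
    IsLabelled 𝒜 ℰ τ' fun p v => Lab p (F.symm v) :=
  have hF' : ∀ γ v, F.symm (τ' γ v) = τ γ (F.symm v) := fun γ v => by
    rw [AddEquiv.symm_apply_eq, hF, F.apply_symm_apply]
  { hE.toIsLocMat with
    shift_zero := fun v => by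
      rw [← F.apply_symm_apply v, ← hF, hE.shift_zero]
    lab_mem := hE.lab_mem
    lab_idem := hE.lab_idem
    exists_lab := fun h h' => by
      obtain ⟨v, hv⟩ := hE.exists_lab h h'
      exact ⟨F v, by rwa [F.symm_apply_apply]⟩
    lab_unique := fun h h' => F.symm.injective (hE.lab_unique h h')
    lab_of_equiv := fun h hx hy h1 h2 h3 => by
      rw [hF']
      exact hE.lab_of_equiv h hx hy h1 h2 h3
    lab_lift := fun h h' => by
      rw [hF'] at h'
      exact hE.lab_lift h h'
    lab_zero := by
      rw [map_zero]
      exact hE.lab_zero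
    lab_add := fun h h' h1 h2 => by
      rw [map_add]
      exact hE.lab_add h h' h1 h2
    lab_split := fun h => hE.lab_split (by rwa [map_add] at h) }

theorem lab_congr (hE : IsLabelled 𝒜 ℰ τ Lab) {p p' : E} {v : V} {x y : E} (h : Lab p v)
    (hx : x ∈ ℰ 0) (hy : y ∈ ℰ 0) (hxy : x * y = p') (hyx : y * x = p) (hxp : x * p = x) :
    Lab p' v := by
  rw [← hE.shift_zero v]
  exact hE.lab_of_equiv h hx (by rwa [neg_zero]) hxy hyx hxp

theorem lab_lift_zero (hE : IsLabelled 𝒜 ℰ τ Lab) {p p' : E} {v : V} (h : Lab p v)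
    (h' : Lab p' v) :
    ∃ x ∈ ℰ 0, ∃ y ∈ ℰ 0, x * y = p' ∧ y * x = p ∧ x * p = x ∧ p * y = y := by
  rw [← hE.shift_zero v] at h'
  have := hE.lab_lift h h'
  rwa [neg_zero] at this

theorem eq_zero_of_lab_zero (hE : IsLabelled 𝒜 ℰ τ Lab) {p : E} (h : Lab p 0) : p = 0 := by
  obtain ⟨x, -, y, -, h1, -, h2, -⟩ := hE.lab_lift_zero hE.lab_zero h
  rw [← h1, ← h2, mul_zero, zero_mul]

theorem sum_mul_of_orthogonal {κ : Type*} {s : Finset κ} {q : κ → E}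
    (hid : ∀ a ∈ s, q a * q a = q a) (ho : ∀ a ∈ s, ∀ b ∈ s, a ≠ b → q a * q b = 0)
    {a : κ} (ha : a ∈ s) : (∑ b ∈ s, q b) * q a = q a := by
  rw [Finset.sum_mul, Finset.sum_eq_single_of_mem a ha, hid a ha]
  exact fun b hb hne => ho b hb a ha hne

theorem mul_sum_of_orthogonal {κ : Type*} {s : Finset κ} {q : κ → E}
    (hid : ∀ a ∈ s, q a * q a = q a) (ho : ∀ a ∈ s, ∀ b ∈ s, a ≠ b → q a * q b = 0)
    {a : κ} (ha : a ∈ s) : q a * (∑ b ∈ s, q b) = q a := by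
  rw [Finset.mul_sum, Finset.sum_eq_single_of_mem a ha, hid a ha]
  exact fun b hb hne => ho a ha b hb hne.symm

theorem lab_sum (hE : IsLabelled 𝒜 ℰ τ Lab) {κ : Type*} (s : Finset κ) {q : κ → E} {v : κ → V}
    (h : ∀ a ∈ s, Lab (q a) (v a)) (ho : ∀ a ∈ s, ∀ b ∈ s, a ≠ b → q a * q b = 0) :
    Lab (∑ a ∈ s, q a) (∑ a ∈ s, v a) := by
  classical
  induction s using Finset.induction_on with
  | empty => simpa using hE.lab_zero
  | insert a s ha ih =>
    rw [Finset.sum_insert ha, Finset.sum_insert ha]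
    refine hE.lab_add (h a (Finset.mem_insert_self a s))
      (ih (fun b hb => h b (Finset.mem_insert_of_mem hb)) fun b hb c hc =>
        ho b (Finset.mem_insert_of_mem hb) c (Finset.mem_insert_of_mem hc)) ?_ ?_
    · rw [Finset.mul_sum]
      refine Finset.sum_eq_zero fun b hb => ho a (Finset.mem_insert_self a s) b
        (Finset.mem_insert_of_mem hb) ?_
      rintro rfl
      exact ha hb
    · rw [Finset.sum_mul]
      refine Finset.sum_eq_zero fun b hb => ho b (Finset.mem_insert_of_mem hb) a
        (Finset.mem_insert_self a s) ?_
      rintro rfl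
      exact ha hb

theorem lab_split_sum (hE : IsLabelled 𝒜 ℰ τ Lab) {κ : Type*} (s : Finset κ) {v : κ → V} {p : E}
    (h : Lab p (∑ a ∈ s, v a)) : ∃ q : κ → E, (∀ a ∈ s, Lab (q a) (v a)) ∧
      (∀ a ∈ s, ∀ b ∈ s, a ≠ b → q a * q b = 0) ∧ ∑ a ∈ s, q a = p := by
  classical
  induction s using Finset.induction_on generalizing p with
  | empty =>
    rw [Finset.sum_empty] at h
    exact ⟨fun _ => 0, by simp, by simp, by simp [hE.eq_zero_of_lab_zero h]⟩
  | insert a s ha ih =>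
    rw [Finset.sum_insert ha] at h
    obtain ⟨q, r, hq, hr, hqr, hrq, hp⟩ := hE.lab_split h
    obtain ⟨q', hq', ho, hsum⟩ := ih hr
    have hne : ∀ b ∈ s, b ≠ a := by
      rintro b hb rfl
      exact ha hb
    have hid : ∀ b ∈ s, q' b * q' b = q' b := fun b hb => hE.lab_idem (hq' b hb)
    -- `r` absorbs each of its summands `q' b`, and `q` is orthogonal to `r`.
    have h1 : ∀ b ∈ s, q * q' b = 0 := fun b hb => by
      rw [← sum_mul_of_orthogonal hid ho hb, hsum, ← mul_assoc, hqr, zero_mul]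
    have h2 : ∀ b ∈ s, q' b * q = 0 := fun b hb => by
      rw [← mul_sum_of_orthogonal hid ho hb, hsum, mul_assoc, hrq, mul_zero]
    refine ⟨fun b => if b = a then q else q' b, ?_, ?_, ?_⟩
    · intro b hb
      rcases Finset.mem_insert.1 hb with rfl | hb
      · simpa using hq
      · simpa [hne b hb] using hq' b hb
    · intro b hb c hc hbc
      rcases Finset.mem_insert.1 hb with rfl | hb'
      · rcases Finset.mem_insert.1 hc with rfl | hc'
        · exact (hbc rfl).elim
        · simpa [hne c hc'] using h1 c hc'
      · rcases Finset.mem_insert.1 hc with rfl | hc'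
        · simpa [hne b hb'] using h2 b hb'
        · simpa [hne b hb', hne c hc'] using ho b hb' c hc' hbc
    · rw [Finset.sum_insert ha, if_pos rfl, ← hp, ← hsum]
      congr 1
      exact Finset.sum_congr rfl fun b hb => if_neg (hne b hb)

/-- `U * W` is the sum of the orthogonal idempotents `U e_jj W`, each equivalent in degree zero to
the diagonal unit at `t j`. The label thus depends only on `t` and the labels of the diagonal units,
so one coefficient matrix gets corresponding labels in two algebras carrying systems of the same
shape. -/
theorem lab_lin [SetLike.GradedMonoid 𝒜] (hE : IsLabelled 𝒜 ℰ τ Lab) {κ J : Type} [Fintype κ]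
    [DecidableEq κ] [Fintype J] [DecidableEq J] {β : κ → ℕ} {d : κ → Γ} (g : MatUnits ℰ β d)
    {t : J → κ} {U : Matrix κ J A} {W : Matrix J κ A}
    (hU : IsGrBlock 𝒜 β d (β ∘ t) (d ∘ t) 0 U) (hW : IsGrBlock 𝒜 (β ∘ t) (d ∘ t) β d 0 W)
    (hWU : W * U = 1) {v : J → V} (hv : ∀ j, Lab (g.e (t j) (t j)) (v j)) :
    Lab (g.lin (U * W)) (∑ j, v j) := by
  have hs : ∀ j, IsGrBlock 𝒜 (β ∘ t) (d ∘ t) β d 0 (Matrix.single j (t j) (1 : A)) := fun j => by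
    simpa using IsGrBlock.single (𝒜 := 𝒜) (β := β ∘ t) (d := d ∘ t) (β' := β) (d' := d) (a := j)
      (b := t j) rfl
  have hs' : ∀ j, IsGrBlock 𝒜 β d (β ∘ t) (d ∘ t) 0 (Matrix.single (t j) j (1 : A)) := fun j => by
    simpa using IsGrBlock.single (𝒜 := 𝒜) (β := β) (d := d) (β' := β ∘ t) (d' := d ∘ t) (a := t j)
      (b := j) rfl
  have hX := fun j => hU.mul_zero_zero (hs j)
  have hY := fun j => (hs' j).mul_zero_zero hW
  let P : J → Matrix κ κ A := fun j => U * Matrix.single j j (1 : A) * W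
  have hXY : ∀ j, U * Matrix.single j (t j) (1 : A) * (Matrix.single (t j) j (1 : A) * W) =
      P j := fun j => by
    simp only [P]
    rw [← Matrix.mul_assoc, Matrix.mul_assoc U, Matrix.single_mul_single_same, mul_one]
  have hYX : ∀ j, Matrix.single (t j) j (1 : A) * W * (U * Matrix.single j (t j) (1 : A)) =
      Matrix.single (t j) (t j) 1 := fun j => by
    rw [Matrix.mul_assoc, ← Matrix.mul_assoc W, hWU, Matrix.one_mul,
      Matrix.single_mul_single_same, mul_one]
  have hZ : ∀ j, IsGrBlock 𝒜 β d β d 0 (P j) := fun j => by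
    rw [← hXY]
    exact (hX j).mul_zero_zero (hY j)
  have hsum : g.lin (U * W) = ∑ j, g.lin (P j) := by
    simp only [P]
    have h1 : ∑ j : J, Matrix.single j j (1 : A) = 1 := by
      ext i j
      simp [Matrix.sum_apply, Matrix.single_apply, Matrix.one_apply, ite_and, eq_comm]
    rw [← map_sum, ← Matrix.sum_mul, ← Matrix.mul_sum, h1, Matrix.mul_one]
  rw [hsum]
  refine hE.lab_sum _ (fun j _ => ?_) fun i _ j _ hij => ?_
  · refine hE.lab_congr (hv j) (g.lin_mem hE.toIsGrAlg (hX j)) (g.lin_mem hE.toIsGrAlg (hY j))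
      ?_ ?_ ?_
    · rw [← g.lin_mul (hX j).mem_blockAlg, hXY]
    · rw [← g.lin_mul (hY j).mem_blockAlg, hYX, g.lin_single, one_smul]
    · rw [← one_smul A (g.e _ _), ← g.lin_single, ← g.lin_mul (hX j).mem_blockAlg,
        Matrix.mul_assoc, Matrix.single_mul_single_same, mul_one]
  · rw [← g.lin_mul (hZ i).mem_blockAlg]
    have : P i * P j =
        U * (Matrix.single i i (1 : A) * (W * U) * Matrix.single j j (1 : A)) * W := by
      simp only [P, Matrix.mul_assoc]
    rw [this, hWU, Matrix.mul_one, Matrix.single_mul_single_of_ne _ _ _ _ hij, Matrix.mul_zero,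
      Matrix.zero_mul, map_zero]

/-- Picks a base index in every block. Equivalences are then used only at, or relative to, base
indices, which makes them compatible throughout the block. -/
theorem exists_section {κ : Type} (β : κ → ℕ) :
    ∃ r : κ → κ, (∀ a, β (r a) = β a) ∧ ∀ a b, β a = β b → r a = r b :=
  ⟨fun a => Classical.choose (⟨a, rfl⟩ : ∃ b, β b = β a),
    fun a => Classical.choose_spec (⟨a, rfl⟩ : ∃ b, β b = β a), fun a b h => by simp only [h]⟩

/-- Two systems of matrix units of the same shape whose idempotents have the same labels are
conjugate by a unit of degree zero. -/
theorem exists_conj (hE : IsLabelled 𝒜 ℰ τ Lab) {κ : Type} [Fintype κ] {β : κ → ℕ} {d : κ → Γ}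
    (f f' : MatUnits ℰ β d) (h : ∀ a, ∃ v, Lab (f.e a a) v ∧ Lab (f'.e a a) v) :
    ∃ u : Eˣ, u.1 ∈ ℰ 0 ∧ u.inv ∈ ℰ 0 ∧ ∀ a b, u.1 * f'.e a b * u.inv = f.e a b := by
  classical
  obtain ⟨r, hr, hr'⟩ := exists_section β
  have : ∀ a, ∃ x ∈ ℰ 0, ∃ y ∈ ℰ 0, x * y = f.e a a ∧ y * x = f'.e a a ∧ x * f'.e a a = x ∧
      f'.e a a * y = y := fun a => by
    obtain ⟨v, h1, h2⟩ := h a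
    exact hE.lab_lift_zero h2 h1
  choose x hx y hy hxy hyx hxp hpy using this
  -- The conjugating unit moves index `a` to the base index `r a` by `f'`, crosses over by `x (r
  -- a)`, and returns by `f`. The inverse has the same shape with the roles exchanged, so one
  -- computation covers both products.
  have key : ∀ (f f' : MatUnits ℰ β d) (x y : κ → E), (∀ a, x a * f'.e a a = x a) →
      (∀ a, x a * y a = f.e a a) →
      (∑ a, f.e a (r a) * x (r a) * f'.e (r a) a) * (∑ a, f'.e a (r a) * y (r a) * f.e (r a) a)
        = 1 := by
    intro f f' x y hxp hxy
    rw [Finset.sum_mul, ← f.sum]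
    refine Finset.sum_congr rfl fun a _ => ?_
    rw [Finset.mul_sum, Finset.sum_eq_single a]
    · calc _ = f.e a (r a) * (x (r a) * (f'.e (r a) a * f'.e a (r a)) * y (r a)) * f.e (r a) a := by
            simp only [mul_assoc]
        _ = _ := by
            rw [f'.mul (hr a) (hr a).symm, hxp, hxy, f.mul (hr a).symm rfl,
              f.mul (hr a).symm (hr a)]
    · intro b _ hb
      calc _ = f.e a (r a) * x (r a) * (f'.e (r a) a * f'.e b (r b)) * y (r b) * f.e (r b) b := by
            simp only [mul_assoc]
        _ = _ := by
            rw [f'.mul_of_ne hb.symm, mul_zero, zero_mul, zero_mul]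
    · simp
  have hyf : ∀ a, y a * f.e a a = y a := fun a => by
    rw [← hxy, ← mul_assoc, hyx, hpy]
  have hmem : ∀ (f f' : MatUnits ℰ β d) (x : κ → E), (∀ a, x a ∈ ℰ 0) →
      ∑ a, f.e a (r a) * x (r a) * f'.e (r a) a ∈ ℰ 0 := by
    intro f f' x hx
    refine sum_mem fun a _ => ?_
    have := hE.mul_mem (hE.mul_mem (f.mem (hr a).symm) (hx (r a))) (f'.mem (hr a))
    convert this using 2
    abel
  let u : Eˣ := ⟨∑ a, f.e a (r a) * x (r a) * f'.e (r a) a,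
    ∑ a, f'.e a (r a) * y (r a) * f.e (r a) a, key f f' x y hxp hxy, key f' f y x hyf hyx⟩
  refine ⟨u, hmem f f' x hx, hmem f' f y hy, fun a b => ?_⟩
  by_cases hab : β a = β b
  swap
  · rw [f.eq_zero hab, f'.eq_zero hab, mul_zero, zero_mul]
  have h1 : u.1 * f'.e a b = f.e a (r a) * x (r a) * f'.e (r a) b := by
    change (∑ a, f.e a (r a) * x (r a) * f'.e (r a) a) * f'.e a b = _
    rw [Finset.sum_mul, Finset.sum_eq_single a]
    · rw [mul_assoc, f'.mul (hr a) hab]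
    · intro c _ hc
      rw [mul_assoc, f'.mul_of_ne hc, mul_zero]
    · simp
  have h2 : f.e a b * u.1 = f.e a (r a) * x (r a) * f'.e (r a) b := by
    change f.e a b * (∑ a, f.e a (r a) * x (r a) * f'.e (r a) a) = _
    rw [Finset.mul_sum, Finset.sum_eq_single b]
    · rw [← mul_assoc, ← mul_assoc, f.mul hab (hr b).symm, hr' a b hab]
    · intro c _ hc
      rw [← mul_assoc, ← mul_assoc, f.mul_of_ne hc.symm, zero_mul, zero_mul]
    · simp
  rw [h1, ← h2, mul_assoc, u.val_inv, mul_one]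

variable {E' : Type u} [Ring E'] [Algebra A E'] {ℰ' : Γ → AddSubgroup E'} {Lab' : E' → V → Prop}

/-- A system of matrix units can be copied to any algebra whose unit has the same label. -/
theorem exists_copy (hE : IsLabelled 𝒜 ℰ τ Lab) (hE' : IsLabelled 𝒜 ℰ' τ Lab') {v : V}
    (h : Lab 1 v) (h' : Lab' 1 v) {κ : Type} [Fintype κ] {β : κ → ℕ} {d : κ → Γ}
    (g : MatUnits ℰ β d) :
    ∃ g' : MatUnits ℰ' β d, ∀ a, ∃ w, Lab (g.e a a) w ∧ Lab' (g'.e a a) w := by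
  classical
  have : ∀ a, ∃ w, Lab (g.e a a) w := fun a => hE.exists_lab (g.mem_zero a) (g.mul rfl rfl)
  choose v' hv' using this
  -- The label of `1` is the sum of the labels of the diagonal units; splitting it in `E'` produces
  -- the candidates `q a` for the diagonal of the copy.
  have hsum : v = ∑ a, v' a := by
    refine hE.lab_unique h ?_
    rw [← g.sum]
    exact hE.lab_sum _ (fun a _ => hv' a) fun a _ b _ hab => g.mul_of_ne hab
  rw [hsum] at h'
  obtain ⟨q, hq, ho, hq1⟩ := hE'.lab_split_sum _ h'
  obtain ⟨r, hr, hr'⟩ := exists_section β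
  -- `g.e a (r a)` has degree `d a - d (r a)`, so the labels of `q a` and `q (r a)` differ by `τ` at
  -- that degree. The lifts `x a` and `y a` play the units at `(a, r a)` and `(r a, a)`; the unit at
  -- `(a, b)` is then `x a * y b`.
  have : ∀ a, ∃ x ∈ ℰ' (d a - d (r a)), ∃ y ∈ ℰ' (-(d a - d (r a))), x * y = q a ∧
      y * x = q (r a) ∧ x * q (r a) = x ∧ q (r a) * y = y := fun a => by
    refine hE'.lab_lift (hq (r a) (Finset.mem_univ _)) ?_
    have : v' a = τ (d a - d (r a)) (v' (r a)) := by
      refine hE.lab_unique (hv' a) (hE.lab_of_equiv (hv' (r a)) (g.mem (hr a).symm) ?_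
        (g.mul (hr a).symm (hr a)) (g.mul (hr a) (hr a).symm) (g.mul (hr a).symm rfl))
      rw [neg_sub]
      exact g.mem (hr a)
    rw [← this]
    exact hq a (Finset.mem_univ _)
  choose x hx y hy hxy hyx hxp hpy using this
  have hqx : ∀ a, q a * x a = x a := fun a => by rw [← hxy, mul_assoc, hyx, hxp]
  have hyq : ∀ a, y a * q a = y a := fun a => by rw [← hxy, ← mul_assoc, hyx, hpy]
  refine ⟨{
    e := fun a b => if β a = β b then x a * y b else 0
    mem := ?_
    mul := ?_
    mul_of_ne := ?_
    eq_zero := fun h => if_neg h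
    sum := ?_
    ne_zero := ?_ }, ?_⟩
  · intro a b hab
    rw [if_pos hab]
    have := hE'.mul_mem (hx a) (hy b)
    rw [hr' a b hab] at this
    convert this using 2
    abel
  · intro a b c hab hbc
    rw [if_pos hab, if_pos hbc, if_pos (hab.trans hbc)]
    rw [mul_assoc, ← mul_assoc (y b), hyx, hr' b c hbc, hpy]
  · intro a b c c' hbc
    split_ifs
    · rw [mul_assoc, ← mul_assoc (y b), ← hyq, ← hqx c, mul_assoc (y b), ← mul_assoc (q b),
        ho b (Finset.mem_univ _) c (Finset.mem_univ _) hbc, zero_mul, mul_zero, zero_mul, mul_zero]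
    all_goals simp
  · simpa [hxy] using hq1
  -- If `q a` were zero its label would be zero, and then `g.e a a`, carrying the same label, would
  -- vanish too.
  · intro a h0
    rw [if_pos rfl, hxy] at h0
    have h1 := hq a (Finset.mem_univ _)
    rw [h0] at h1
    have h2 := hv' a
    rw [hE'.lab_unique h1 hE'.lab_zero] at h2
    exact g.ne_zero a (hE.eq_zero_of_lab_zero h2)
  · intro a
    refine ⟨v' a, hv' a, ?_⟩
    simp only [if_true, hxy]
    exact hq a (Finset.mem_univ _)

end IsLabelled

end Labelled

/-! ### Elliott's back-and-forth argument -/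

section Intertwining

variable {Γ : Type w} [AddCommGroup Γ] {A : Type v} [CommRing A] {𝒜 : Γ → AddSubgroup A}
  {E : Type u} [Ring E] [Algebra A E] {ℰ : Γ → AddSubgroup E} {E' : Type u} [Ring E'] [Algebra A E']
  {ℰ' : Γ → AddSubgroup E'} {V : Type*} {Lab : E → V → Prop} {Lab' : E' → V → Prop}

/-- Systems of matrix units of the same shape, with the same labels, in two algebras. -/
structure MatUnitsPair (ℰ : Γ → AddSubgroup E) (ℰ' : Γ → AddSubgroup E') (Lab : E → V → Prop)
    (Lab' : E' → V → Prop) where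
  κ : Type
  [fintype : Fintype κ]
  [decidableEq : DecidableEq κ]
  β : κ → ℕ
  d : κ → Γ
  f : MatUnits ℰ β d
  f' : MatUnits ℰ' β d
  lab : ∀ a, ∃ v, Lab (f.e a a) v ∧ Lab' (f'.e a a) v

namespace MatUnitsPair

attribute [instance] MatUnitsPair.fintype MatUnitsPair.decidableEq

/-- The graph of the partial isomorphism given by a pair of systems of matrix units. -/
def graph (A : Type v) [CommRing A] [Algebra A E] [Algebra A E']
    (P : MatUnitsPair ℰ ℰ' Lab Lab') : Subalgebra A (E × E') :=
  (AlgHom.prod (P.f.hom (A := A)) (P.f'.hom (A := A))).range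

theorem mem_graph (P : MatUnitsPair ℰ ℰ' Lab Lab') (z : E × E') :
    z ∈ P.graph A ↔ ∃ c ∈ blockAlg A P.β, P.f.lin c = z.1 ∧ P.f'.lin c = z.2 := by
  constructor
  · rintro ⟨c, rfl⟩
    exact ⟨c.1, c.2, rfl, rfl⟩
  · rintro ⟨c, hc, h1, h2⟩
    exact ⟨⟨c, hc⟩, Prod.ext h1 h2⟩

/-- The pair with the two algebras exchanged. -/
def symm (P : MatUnitsPair ℰ ℰ' Lab Lab') : MatUnitsPair ℰ' ℰ Lab' Lab where
  κ := P.κ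
  β := P.β
  d := P.d
  f := P.f'
  f' := P.f
  lab a := by
    obtain ⟨v, h, h'⟩ := P.lab a
    exact ⟨v, h', h⟩

theorem mem_graph_symm (P : MatUnitsPair ℰ ℰ' Lab Lab') (z : E' × E) :
    z ∈ P.symm.graph A ↔ z.swap ∈ P.graph A := by
  rw [mem_graph, mem_graph]
  exact exists_congr fun c => and_congr_right fun _ => and_comm

variable [AddCommMonoid V] {τ : Γ → V →+ V}

/-- Both coordinates have the same coefficient matrix with respect to systems of the same shape, and
that matrix alone decides the degree. -/
theorem mem_iff_mem (hE : IsLabelled 𝒜 ℰ τ Lab) (hE' : IsLabelled 𝒜 ℰ' τ Lab')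
    (P : MatUnitsPair ℰ ℰ' Lab Lab') {z : E × E'} (hz : z ∈ P.graph A) (γ : Γ) :
    z.1 ∈ ℰ γ ↔ z.2 ∈ ℰ' γ := by
  obtain ⟨c, hc, h1, h2⟩ := (P.mem_graph z).1 hz
  rw [← h1, ← h2]
  exact ⟨fun h => P.f'.lin_mem hE'.toIsGrAlg (P.f.isGrBlock_of_lin_mem hE.toIsGrAlg hc h),
    fun h => P.f.lin_mem hE.toIsGrAlg (P.f'.isGrBlock_of_lin_mem hE'.toIsGrAlg hc h)⟩

theorem eq_zero_iff (hE : IsLabelled 𝒜 ℰ τ Lab) (hE' : IsLabelled 𝒜 ℰ' τ Lab')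
    (P : MatUnitsPair ℰ ℰ' Lab Lab') {z : E × E'} (hz : z ∈ P.graph A) :
    z.1 = 0 ↔ z.2 = 0 := by
  obtain ⟨c, hc, h1, h2⟩ := (P.mem_graph z).1 hz
  rw [← h1, ← h2]
  constructor
  · intro h
    rw [P.f.eq_zero_of_lin hE.toIsGrAlg hc h, map_zero]
  · intro h
    rw [P.f'.eq_zero_of_lin hE'.toIsGrAlg hc h, map_zero]

variable [DecidableEq Γ] [GradedRing 𝒜]

/-- A larger system `g` in `E` has `t` and all old units in its span, and it has a copy `g'` in
`E'`. Writing the old units in terms of `g` and reading the coefficients in `g'` gives a system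
`f''`, which need not be the old `P.f'`. Both have the same shape and labels, so a unit of degree
zero conjugates `f''` into `P.f'`; conjugating all of `g'` by it makes the new partial isomorphism
extend the old one. -/
theorem exists_extend (hA : IsGradedField 𝒜) (hE : IsLabelled 𝒜 ℰ τ Lab)
    (hE' : IsLabelled 𝒜 ℰ' τ Lab') {v : V} (h1 : Lab 1 v) (h1' : Lab' 1 v)
    (P : MatUnitsPair ℰ ℰ' Lab Lab') (t : E) :
    ∃ P' : MatUnitsPair ℰ ℰ' Lab Lab', P.graph A ≤ P'.graph A ∧ ∃ t', (t, t') ∈ P'.graph A := by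
  classical
  obtain ⟨κ, _, _, β, d, g, hg⟩ := hE.exists_matUnits
    (insert t (Finset.univ.image fun ab : P.κ × P.κ => P.f.e ab.1 ab.2))
  obtain ⟨ct, hct, ht⟩ := hg t (Finset.mem_insert_self _ _)
  have : ∀ a b, ∃ c ∈ blockAlg A β, g.lin c = P.f.e a b := fun a b =>
    hg _ (Finset.mem_insert_of_mem (Finset.mem_image.2 ⟨(a, b), Finset.mem_univ _, rfl⟩))
  choose c hc hgc using this
  obtain ⟨g', hlab⟩ := hE.exists_copy hE' h1 h1' g
  let f'' := P.f.transfer hE.toIsGrAlg hE'.toIsGrAlg g g' c hc hgc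
  -- The idempotents `P.f.e a a` and `f''.e a a` have the same coefficient matrix `c a a`; splitting
  -- it expresses both labels as the same sum of labels of diagonal units of `g` and `g'`.
  have hf'' : ∀ a, ∃ w, Lab (P.f.e a a) w ∧ Lab' (f''.e a a) w := by
    intro a
    choose w hw hw' using hlab
    have hdeg := g.isGrBlock_of_lin_mem hE.toIsGrAlg (hc a a) (γ := 0) (by
      rw [hgc]
      exact P.f.mem_zero a)
    have hid : c a a * c a a = c a a := by
      refine g.lin_injOn hE.toIsGrAlg (mul_mem (hc a a) (hc a a)) (hc a a) ?_
      rw [g.lin_mul (hc a a), hgc, P.f.mul rfl rfl]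
    obtain ⟨J, _, _, t, U, W, hU, hW, hWU, hUW⟩ := hdeg.exists_split hA hid
    refine ⟨∑ j, w (t j), ?_, ?_⟩
    · rw [← hgc, ← hUW]
      exact hE.lab_lin g hU hW hWU fun j => hw (t j)
    · change Lab' (g'.lin (c a a)) _
      rw [← hUW]
      exact hE'.lab_lin g' hU hW hWU fun j => hw' (t j)
  obtain ⟨u, hu, hu', huf⟩ := hE'.exists_conj P.f' f'' fun a => by
    obtain ⟨w, h, h'⟩ := P.lab a
    obtain ⟨w', k, k'⟩ := hf'' a
    rw [hE.lab_unique k h] at k'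
    exact ⟨w, h', k'⟩
  refine ⟨{ κ := κ, β := β, d := d, f := g, f' := g'.conj hE'.toIsGrAlg u hu hu', lab := ?_ }, ?_, ?_⟩
  · intro a
    obtain ⟨w, h, h'⟩ := hlab a
    refine ⟨w, h, hE'.lab_congr (x := u.1 * g'.e a a) (y := g'.e a a * u.inv) h' ?_ ?_ ?_ ?_ ?_⟩
    · simpa using hE'.mul_mem hu (g'.mem_zero a)
    · simpa using hE'.mul_mem (g'.mem_zero a) hu'
    · change _ = u.1 * g'.e a a * u.inv
      rw [mul_assoc, ← mul_assoc (g'.e a a), g'.mul rfl rfl, mul_assoc]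
    · rw [mul_assoc, ← mul_assoc u.inv, u.inv_val, one_mul, g'.mul rfl rfl]
    · rw [mul_assoc, g'.mul rfl rfl]
  · intro z hz
    rw [mem_graph] at hz ⊢
    obtain ⟨x, hx, hx1, hx2⟩ := hz
    refine ⟨∑ a, ∑ b, x a b • c a b,
      sum_mem fun a _ => sum_mem fun b _ => Subalgebra.smul_mem _ (hc a b) _, ?_, ?_⟩
    · rw [← hx1, MatUnits.lin_apply P.f x]
      simp only [map_sum, map_smul, hgc]
    · rw [← hx2, MatUnits.lin_apply P.f' x]
      simp only [map_sum, map_smul, MatUnits.conj_lin]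
      simp only [← huf]
      rfl
  · exact ⟨_, (mem_graph _ _).2 ⟨ct, hct, ht, rfl⟩⟩

end MatUnitsPair

variable [AddCommMonoid V] {τ : Γ → V →+ V} [DecidableEq Γ] [GradedRing 𝒜]

/-- Two labelled algebras whose units have the same label are isomorphic as graded rings. -/
theorem IsLabelled.exists_ringEquiv (hA : IsGradedField 𝒜) (hE : IsLabelled 𝒜 ℰ τ Lab)
    (hE' : IsLabelled 𝒜 ℰ' τ Lab') {v : V} (h1 : Lab 1 v) (h1' : Lab' 1 v) :
    ∃ Θ : E ≃+* E', ∀ γ x, x ∈ ℰ γ ↔ Θ x ∈ ℰ' γ := by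
  classical
  obtain ⟨T, hT, hTtop⟩ := hE.countable
  -- Adjoining `0` makes the countable spanning set nonempty, so that a sequence can enumerate it.
  obtain ⟨s, hs⟩ := (hT.insert 0).exists_eq_range ⟨0, Set.mem_insert _ _⟩
  obtain ⟨T', hT', hTtop'⟩ := hE'.countable
  obtain ⟨s', hs'⟩ := (hT'.insert 0).exists_eq_range ⟨0, Set.mem_insert _ _⟩
  -- Forth and back: bring `s n` into the domain, then `s' n` into the range by extending the
  -- reversed pair.
  have step : ∀ (n : ℕ) (P : MatUnitsPair ℰ ℰ' Lab Lab'), ∃ P' : MatUnitsPair ℰ ℰ' Lab Lab',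
      P.graph A ≤ P'.graph A ∧ (∃ t', (s n, t') ∈ P'.graph A) ∧
        ∃ t, (t, s' n) ∈ P'.graph A := by
    intro n P
    obtain ⟨P₁, h, t', ht'⟩ := P.exists_extend hA hE hE' h1 h1' (s n)
    obtain ⟨P₂, k, t, ht⟩ := P₁.symm.exists_extend hA hE' hE h1' h1 (s' n)
    have k' : P₁.graph A ≤ P₂.symm.graph A := fun z hz => by
      rw [MatUnitsPair.mem_graph_symm]
      exact k ((P₁.mem_graph_symm _).2 hz)
    refine ⟨P₂.symm, h.trans k', ⟨t', k' ht'⟩, t, ?_⟩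
    rw [MatUnitsPair.mem_graph_symm]
    exact ht
  choose next hnext hs1 hs2 using step
  obtain ⟨κ, _, _, β, d, g, -⟩ := hE.exists_matUnits ∅
  obtain ⟨g', hlab⟩ := hE.exists_copy hE' h1 h1' g
  let P : ℕ → MatUnitsPair ℰ ℰ' Lab Lab' := fun n =>
    Nat.rec { κ := κ, β := β, d := d, f := g, f' := g', lab := hlab } next n
  have hP : Monotone fun n => (P n).graph A := monotone_nat_of_le_succ fun n => hnext n (P n)
  let G : Subalgebra A (E × E') := ⨆ n, (P n).graph A
  have hG : ∀ z, z ∈ G ↔ ∃ n, z ∈ (P n).graph A := fun z => by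
    rw [← SetLike.mem_coe, Subalgebra.coe_iSup_of_directed (directed_of_isDirected_le hP)]
    simp
  -- The union `G` of the graphs is the graph of an isomorphism. Injectivity of a projection holds
  -- at each stage; surjectivity follows since the image of `G` is an `A`-submodule containing a
  -- spanning set.
  have hfst : Function.Bijective ((RingHom.fst E E').comp G.val.toRingHom) := by
    constructor
    · rw [injective_iff_map_eq_zero]
      rintro ⟨z, hz⟩ h0
      obtain ⟨n, hn⟩ := (hG z).1 hz
      exact Subtype.ext (Prod.ext h0 (((P n).eq_zero_iff hE hE' hn).1 h0))
    · intro x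
      have : Submodule.span A T ≤ (Subalgebra.toSubmodule G).map (LinearMap.fst A E E') := by
        refine Submodule.span_le.2 fun x hx => ?_
        have : x ∈ Set.range s := hs ▸ Set.mem_insert_of_mem _ hx
        obtain ⟨n, rfl⟩ := this
        obtain ⟨t', ht'⟩ := hs1 n (P n)
        exact ⟨_, (hG _).2 ⟨n + 1, ht'⟩, rfl⟩
      rw [hTtop] at this
      obtain ⟨z, hz, hzx⟩ := this (Submodule.mem_top (x := x))
      exact ⟨⟨z, hz⟩, hzx⟩
  have hsnd : Function.Bijective ((RingHom.snd E E').comp G.val.toRingHom) := by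
    constructor
    · rw [injective_iff_map_eq_zero]
      rintro ⟨z, hz⟩ h0
      obtain ⟨n, hn⟩ := (hG z).1 hz
      exact Subtype.ext (Prod.ext (((P n).eq_zero_iff hE hE' hn).2 h0) h0)
    · intro x
      have : Submodule.span A T' ≤ (Subalgebra.toSubmodule G).map (LinearMap.snd A E E') := by
        refine Submodule.span_le.2 fun x hx => ?_
        have : x ∈ Set.range s' := hs' ▸ Set.mem_insert_of_mem _ hx
        obtain ⟨n, rfl⟩ := this
        obtain ⟨t', ht'⟩ := hs2 n (P n)
        exact ⟨_, (hG _).2 ⟨n + 1, ht'⟩, rfl⟩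
      rw [hTtop'] at this
      obtain ⟨z, hz, hzx⟩ := this (Submodule.mem_top (x := x))
      exact ⟨⟨z, hz⟩, hzx⟩
  refine ⟨(RingEquiv.ofBijective _ hfst).symm.trans (RingEquiv.ofBijective _ hsnd), ?_⟩
  intro γ x
  obtain ⟨⟨z, hz⟩, rfl⟩ := (RingEquiv.ofBijective _ hfst).surjective x
  obtain ⟨n, hn⟩ := (hG z).1 hz
  rw [RingEquiv.trans_apply, RingEquiv.symm_apply_apply]
  exact (P n).mem_iff_mem hE hE' hn γ

/-- Cancellation: complements of equally labelled idempotents are equally labelled. -/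
theorem IsLabelled.label_cancel (hA : IsGradedField 𝒜) (hE : IsLabelled 𝒜 ℰ τ Lab)
    {p q p' q' : E} {v v' w : V} (hp : Lab p v) (hq : Lab q w) (hp' : Lab p' v') (hq' : Lab q' w)
    (h : p + q = 1) (h' : p' + q' = 1) : v = v' := by
  classical
  obtain ⟨x, hx, y, hy, hxy, hyx, hxq, hqy⟩ := hE.lab_lift_zero hq hq'
  -- Everything in sight, including the equivalence of `q` with `q'`, is moved into one block matrix
  -- algebra over the graded field.
  obtain ⟨κ, _, _, β, d, g, hg⟩ := hE.exists_matUnits {p, q, p', q', x, y}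
  have gp := hg p (by simp)
  have gq := hg q (by simp)
  have gp' := hg p' (by simp)
  have gq' := hg q' (by simp)
  have gx := hg x (by simp)
  have gy := hg y (by simp)
  clear hg
  have lift : ∀ z, (∃ c ∈ blockAlg A β, g.lin c = z) → z ∈ ℰ 0 →
      ∃ c, IsGrBlock 𝒜 β d β d 0 c ∧ g.lin c = z := fun z hz hz0 => by
    obtain ⟨c, hc, rfl⟩ := hz
    exact ⟨c, g.isGrBlock_of_lin_mem hE.toIsGrAlg hc hz0, rfl⟩
  obtain ⟨cx, hcx, rfl⟩ := lift x gx hx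
  obtain ⟨cy, hcy, rfl⟩ := lift y gy hy
  have inj : ∀ {c c' : Matrix κ κ A}, IsGrBlock 𝒜 β d β d 0 c → IsGrBlock 𝒜 β d β d 0 c' →
      g.lin c = g.lin c' → c = c' := fun hc hc' h =>
    g.lin_injOn hE.toIsGrAlg hc.mem_blockAlg hc'.mem_blockAlg h
  have split : ∀ z, (∃ c ∈ blockAlg A β, g.lin c = z) → ∀ v, Lab z v →
      ∃ (J : Type) (_ : Fintype J) (_ : DecidableEq J) (t : J → κ) (U : Matrix κ J A)
      (V : Matrix J κ A), IsGrBlock 𝒜 β d (β ∘ t) (d ∘ t) 0 U ∧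
        IsGrBlock 𝒜 (β ∘ t) (d ∘ t) β d 0 V ∧ V * U = 1 ∧ g.lin (U * V) = z := fun z hz v hv => by
    obtain ⟨c, hc, rfl⟩ := lift z hz (hE.lab_mem hv)
    obtain ⟨J, i, i', t, U, V, hU, hV, hVU, rfl⟩ := hc.exists_split hA (inj (hc.mul_zero_zero hc) hc
      (by rw [g.lin_mul hc.mem_blockAlg, hE.lab_idem hv]))
    exact ⟨J, i, i', t, U, V, hU, hV, hVU, rfl⟩
  obtain ⟨J₁, _, _, t₁, U₁, V₁, hU₁, hV₁, hVU₁, rfl⟩ := split p gp _ hp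
  obtain ⟨J₂, _, _, t₂, U₂, V₂, hU₂, hV₂, hVU₂, rfl⟩ := split q gq _ hq
  obtain ⟨J₃, _, _, t₃, U₃, V₃, hU₃, hV₃, hVU₃, rfl⟩ := split p' gp' _ hp'
  obtain ⟨J₄, _, _, t₄, U₄, V₄, hU₄, hV₄, hVU₄, rfl⟩ := split q' gq' _ hq'
  clear split lift
  have m : ∀ {J : Type} [Fintype J] {t : J → κ} {U : Matrix κ J A} {V : Matrix J κ A},
      IsGrBlock 𝒜 β d (β ∘ t) (d ∘ t) 0 U → IsGrBlock 𝒜 (β ∘ t) (d ∘ t) β d 0 V →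
      IsGrBlock 𝒜 β d β d 0 (U * V) := fun hU hV => hU.mul_zero_zero hV
  have e1 : U₁ * V₁ + U₂ * V₂ = 1 := by
    refine g.lin_injOn hE.toIsGrAlg (add_mem (m hU₁ hV₁).mem_blockAlg (m hU₂ hV₂).mem_blockAlg)
      (one_mem _) ?_
    rw [map_add, h, g.lin_one]
  have e2 : U₃ * V₃ + U₄ * V₄ = 1 := by
    refine g.lin_injOn hE.toIsGrAlg (add_mem (m hU₃ hV₃).mem_blockAlg (m hU₄ hV₄).mem_blockAlg)
      (one_mem _) ?_
    rw [map_add, h', g.lin_one]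
  have e3 : cx * cy = U₄ * V₄ := inj (hcx.mul_zero_zero hcy) (m hU₄ hV₄) (by
    rw [g.lin_mul hcx.mem_blockAlg, hxy])
  have e4 : cy * cx = U₂ * V₂ := inj (hcy.mul_zero_zero hcx) (m hU₂ hV₂) (by
    rw [g.lin_mul hcy.mem_blockAlg, hyx])
  have e5 : cx * (U₂ * V₂) = cx := inj (hcx.mul_zero_zero (m hU₂ hV₂)) hcx (by
    rw [g.lin_mul hcx.mem_blockAlg, hxq])
  have e6 : U₂ * V₂ * cy = cy := inj ((m hU₂ hV₂).mul_zero_zero hcy) hcy (by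
    rw [g.lin_mul (m hU₂ hV₂).mem_blockAlg, hqy])
  -- orthogonality of complementary split idempotents
  have orth : ∀ {J J' : Type} [Fintype J] [Fintype J'] [DecidableEq J] [DecidableEq J']
      {U : Matrix κ J A} {V : Matrix J κ A} {U' : Matrix κ J' A} {V' : Matrix J' κ A},
      V * U = 1 → V' * U' = 1 → U * V + U' * V' = 1 → V * U' = 0 := by
    intro J J' _ _ _ _ U V U' V' h1 h2 h3
    have h4 : V * (U * V + U' * V') * U' = V * U' + V * U' := by
      rw [Matrix.mul_add, Matrix.add_mul, ← Matrix.mul_assoc, h1, Matrix.one_mul,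
        ← Matrix.mul_assoc, Matrix.mul_assoc, h2, Matrix.mul_one]
    rw [h3, Matrix.mul_one] at h4
    exact left_eq_add.1 h4
  have o12 := orth hVU₁ hVU₂ e1
  have o21 := orth hVU₂ hVU₁ (by rwa [add_comm])
  have o34 := orth hVU₃ hVU₄ e2
  have o43 := orth hVU₄ hVU₃ (by rwa [add_comm])
  have fc : ∀ {J J' : Type} [Fintype J] [Fintype J'] {t : J → κ} {t' : J' → κ} {U : Matrix κ J A}
      {U' : Matrix κ J' A}, IsGrBlock 𝒜 β d (β ∘ t) (d ∘ t) 0 U →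
      IsGrBlock 𝒜 β d (β ∘ t') (d ∘ t') 0 U' →
      IsGrBlock 𝒜 β d (β ∘ Sum.elim t t') (d ∘ Sum.elim t t') 0 (Matrix.fromCols U U') := by
    intro J J' _ _ t t' U U' hU hU' a b
    rcases b with b | b
    exacts [hU a b, hU' a b]
  have fr : ∀ {J J' : Type} [Fintype J] [Fintype J'] {t : J → κ} {t' : J' → κ} {V : Matrix J κ A}
      {V' : Matrix J' κ A}, IsGrBlock 𝒜 (β ∘ t) (d ∘ t) β d 0 V →
      IsGrBlock 𝒜 (β ∘ t') (d ∘ t') β d 0 V' →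
      IsGrBlock 𝒜 (β ∘ Sum.elim t t') (d ∘ Sum.elim t t') β d 0 (Matrix.fromRows V V') := by
    intro J J' _ _ t t' U U' hU hU' b a
    rcases b with b | b
    exacts [hU b a, hU' b a]
  have all : ∀ {J J' : Type} [Fintype J] [Fintype J'] [DecidableEq J] [DecidableEq J']
      {U : Matrix κ J A} {V : Matrix J κ A} {U' : Matrix κ J' A} {V' : Matrix J' κ A},
      V * U = 1 → V' * U' = 1 → V * U' = 0 → V' * U = 0 →
      Matrix.fromRows V V' * Matrix.fromCols U U' = 1 := by
    intro J J' _ _ _ _ U V U' V' h1 h2 h3 h4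
    rw [Matrix.fromRows_mul_fromCols, h1, h2, h3, h4, Matrix.fromBlocks_one]
  have a1 := all hVU₁ hVU₂ o12 o21
  have a2 := all hVU₃ hVU₄ o34 o43
  have b1 := Matrix.fromCols_mul_fromRows U₁ U₂ V₁ V₂
  rw [e1] at b1
  have b2 := Matrix.fromCols_mul_fromRows U₃ U₄ V₃ V₄
  rw [e2] at b2
  -- Since `p + q = 1 = p' + q'`, the split pieces of `p, q` and those of `p', q'` are two
  -- homogeneous bases of one space, so their link classes agree with multiplicity. Below, `c2` does
  -- the same for `q` and `q'`; cancelling multisets leaves `p` against `p'`.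
  have c1 := IsGrBlock.map_link_eq hA (β := β) (d := d)
    ((fr hV₁ hV₂).mul_zero_zero (fc hU₃ hU₄)) ((fr hV₃ hV₄).mul_zero_zero (fc hU₁ hU₂))
    (by rw [Matrix.mul_assoc, ← Matrix.mul_assoc (Matrix.fromCols _ _), b2, Matrix.one_mul, a1])
    (by rw [Matrix.mul_assoc, ← Matrix.mul_assoc (Matrix.fromCols _ _), b1, Matrix.one_mul, a2])
  have c2 := IsGrBlock.map_link_eq hA (β := β) (d := d)
    (x := V₂ * (cy * U₄)) (y := V₄ * (cx * U₂))
    (hV₂.mul_zero_zero (hcy.mul_zero_zero hU₄)) (hV₄.mul_zero_zero (hcx.mul_zero_zero hU₂))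
    (by
      calc _ = V₂ * (cy * (U₄ * V₄) * cx) * U₂ := by simp only [Matrix.mul_assoc]
        _ = V₂ * (cy * cx * (cy * cx)) * U₂ := by rw [← e3]; simp only [Matrix.mul_assoc]
        _ = (V₂ * U₂) * (V₂ * U₂) * (V₂ * U₂) := by rw [e4]; simp only [Matrix.mul_assoc]
        _ = 1 := by simp [hVU₂])
    (by
      calc _ = V₄ * (cx * (U₂ * V₂) * cy) * U₄ := by simp only [Matrix.mul_assoc]
        _ = (V₄ * U₄) * (V₄ * U₄) := by rw [e5, e3]; simp only [Matrix.mul_assoc]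
        _ = 1 := by simp [hVU₄])
  have c3 : (Finset.univ.val.map fun j => Quotient.mk (linkSetoid hA β d) (t₁ j)) =
      Finset.univ.val.map fun j => Quotient.mk (linkSetoid hA β d) (t₃ j) := by
    have s : ∀ {J J' : Type} [Fintype J] [Fintype J'] (t : J → κ) (t' : J' → κ),
        (Finset.univ.val.map fun j => Quotient.mk (linkSetoid hA β d) (Sum.elim t t' j)) =
        (Finset.univ.val.map fun j => Quotient.mk (linkSetoid hA β d) (t j)) +
        Finset.univ.val.map fun j => Quotient.mk (linkSetoid hA β d) (t' j) := by
      intro J J' _ _ t t'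
      rw [← Finset.univ_disjSum_univ, Finset.val_disjSum, Multiset.disjSum, Multiset.map_add,
        Multiset.map_map, Multiset.map_map]
      rfl
    rw [s, s, c2] at c1
    exact add_right_cancel c1
  have : ∀ a, ∃ w, Lab (g.e a a) w := fun a => hE.exists_lab (g.mem_zero a) (g.mul rfl rfl)
  choose ℓ hℓ using this
  -- A nonzero homogeneous scalar times a matrix unit is an equivalence of degree zero between
  -- diagonal units at linked indices. Labels therefore factor through link classes, and the
  -- multiset of classes determines the label of a split idempotent.
  have hℓ' : ∀ a b, (linkSetoid hA β d) a b → ℓ a = ℓ b := by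
    rintro a b ⟨hab, c, hc, hc0⟩
    obtain ⟨c', hc', hcc'⟩ := hA.exists_inv hc hc0
    refine hE.lab_unique (hℓ a) (hE.lab_congr (hℓ b) (x := c • g.e a b) (y := c' • g.e b a) ?_ ?_
      ?_ ?_ ?_)
    · simpa using hE.smul_mem hc (g.mem hab)
    · simpa using hE.smul_mem hc' (g.mem hab.symm)
    · rw [smul_mul_smul_comm, mul_comm c, hcc', g.mul hab hab.symm, one_smul]
    · rw [smul_mul_smul_comm, hcc', g.mul hab.symm hab, one_smul]
    · rw [smul_mul_assoc, g.mul hab rfl]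
  have final : ∀ {J : Type} [Fintype J] (t : J → κ), ∑ j, ℓ (t j) =
      ((Finset.univ.val.map fun j => Quotient.mk (linkSetoid hA β d) (t j)).map
        (Quotient.lift ℓ hℓ')).sum := by
    intro J _ t
    rw [Multiset.map_map]
    rfl
  rw [hE.lab_unique hp (hE.lab_lin g hU₁ hV₁ hVU₁ fun j => hℓ (t₁ j)),
    hE.lab_unique hp' (hE.lab_lin g hU₃ hV₃ hVU₃ fun j => hℓ (t₃ j)), final, final, c3]

end Intertwining

/-! ### Graded modules: components, submodules, quotients, finite direct sums -/

section GradedModuleTheory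

/-- A family of subgroups with projections is a direct sum decomposition. -/
theorem isInternal_of_projections {Γ : Type w} [DecidableEq Γ] {M : Type u} [AddCommGroup M] {d : Γ → AddSubgroup M}
    (π : Γ → M →+ M) (hmem : ∀ γ m, π γ m ∈ d γ) (hself : ∀ γ, ∀ m ∈ d γ, π γ m = m)
    (hne : ∀ γ δ, γ ≠ δ → ∀ m ∈ d δ, π γ m = 0)
    (hsum : ∀ m, ∃ s : Finset Γ, ∑ γ ∈ s, π γ m = m) : DirectSum.IsInternal d := by
  have key : ∀ γ (x : DirectSum Γ fun γ => d γ),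
      π γ (DirectSum.coeAddMonoidHom d x) = (x γ : M) := by
    intro γ x
    induction x using DirectSum.induction_on with
    | zero => simp
    | of δ x =>
      rw [DirectSum.coeAddMonoidHom_of]
      by_cases h : γ = δ
      · subst h
        rw [hself _ _ x.2, DirectSum.of_eq_same]
      · rw [hne _ _ h _ x.2, DirectSum.of_eq_of_ne _ _ _ h]
        rfl
    | add x y hx hy => rw [map_add, map_add, hx, hy]; rfl
  constructor
  · rw [injective_iff_map_eq_zero]
    intro x hx
    ext γ
    rw [← key, hx, map_zero]
    rfl
  · intro m
    obtain ⟨s, hs⟩ := hsum m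
    refine ⟨∑ γ ∈ s, DirectSum.of (fun γ => d γ) γ ⟨π γ m, hmem γ m⟩, ?_⟩
    rw [map_sum]
    simpa using hs

namespace GrMod

variable {Γ : Type w} [AddCommGroup Γ] [DecidableEq Γ] {R : Type u} [Ring R]
  {ℛ : Γ → AddSubgroup R}

/-- The homogeneous component of degree `γ`. -/
noncomputable def proj (M : GrMod ℛ) (γ : Γ) : M →+ M :=
  letI := M.isInternal.chooseDecomposition
  { toFun := fun m => (DirectSum.decompose M.deg m γ : M)
    map_zero' := by simp
    map_add' := by simp }

theorem proj_mem (M : GrMod ℛ) (γ : Γ) (m : M) : M.proj γ m ∈ M.deg γ :=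
  letI := M.isInternal.chooseDecomposition
  (DirectSum.decompose M.deg m γ).2

theorem proj_of_mem (M : GrMod ℛ) {γ : Γ} {m : M} (h : m ∈ M.deg γ) : M.proj γ m = m :=
  letI := M.isInternal.chooseDecomposition
  DirectSum.decompose_of_mem_same M.deg h

theorem proj_of_mem_ne (M : GrMod ℛ) {γ δ : Γ} (hne : γ ≠ δ) {m : M} (h : m ∈ M.deg δ) :
    M.proj γ m = 0 :=
  letI := M.isInternal.chooseDecomposition
  DirectSum.decompose_of_mem_ne M.deg h hne.symm

theorem exists_sum_proj (M : GrMod ℛ) (m : M) :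
    ∃ s : Finset Γ, ∀ t, s ⊆ t → ∑ γ ∈ t, M.proj γ m = m := by
  classical
  let := M.isInternal.chooseDecomposition
  refine ⟨(DirectSum.decompose M.deg m).support, fun t ht => ?_⟩
  conv_rhs => rw [← DirectSum.sum_support_decompose M.deg m]
  refine (Finset.sum_subset ht fun γ _ hγ => ?_).symm
  rw [DFinsupp.notMem_support_iff] at hγ
  change ((DirectSum.decompose M.deg m γ : M.deg γ) : M) = 0
  rw [hγ]
  rfl

theorem hom_induction (M : GrMod ℛ) {P : M → Prop} (h0 : P 0)
    (hadd : ∀ a b, P a → P b → P (a + b)) (hhom : ∀ γ, ∀ m ∈ M.deg γ, P m) (m : M) : P m := by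
  obtain ⟨s, hs⟩ := M.exists_sum_proj m
  rw [← hs s subset_rfl]
  exact Finset.sum_induction _ P hadd h0 fun γ _ => hhom γ _ (M.proj_mem γ m)

/-- Additive maps of degree `ε` commute with taking components. -/
theorem map_proj {R' : Type u} [Ring R'] {ℛ' : Γ → AddSubgroup R'} {M : GrMod ℛ} {N : GrMod ℛ'}
    (f : M →+ N) (ε : Γ)
    (hf : ∀ γ, ∀ m ∈ M.deg γ, f m ∈ N.deg (γ + ε)) (γ : Γ) (m : M) :
    N.proj (γ + ε) (f m) = f (M.proj γ m) := by
  induction m using M.hom_induction with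
  | h0 => simp
  | hadd a b ha hb => simp [ha, hb]
  | hhom δ m hm =>
    by_cases h : γ = δ
    · subst h
      rw [M.proj_of_mem hm, N.proj_of_mem (hf _ _ hm)]
    · rw [M.proj_of_mem_ne h hm, map_zero, N.proj_of_mem_ne _ (hf _ _ hm)]
      exact fun h' => h (add_right_cancel h')

theorem Hom.map_proj {M N : GrMod ℛ} (f : Hom M N) (γ : Γ) (m : M) :
    N.proj γ (f.toLinearMap m) = f.toLinearMap (M.proj γ m) := by
  have := GrMod.map_proj f.toLinearMap.toAddMonoidHom 0
    (fun γ m hm => by rw [add_zero]; exact f.map_mem hm) γ m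
  rwa [add_zero] at this

theorem proj_smul (M : GrMod ℛ) {δ : Γ} {r : R} (hr : r ∈ ℛ δ) (γ : Γ) (m : M) :
    M.proj (γ + δ) (MulOpposite.op r • m) = MulOpposite.op r • M.proj γ m :=
  GrMod.map_proj (DistribSMul.toAddMonoidHom M (MulOpposite.op r)) δ
    (fun _ _ hm => M.smul_mem hm hr) γ m

/-- A submodule generated by homogeneous components. -/
def sub (M : GrMod ℛ) (N : Submodule Rᵐᵒᵖ M) (h : ∀ γ, ∀ m ∈ N, M.proj γ m ∈ N) : GrMod ℛ where
  carrier := N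
  deg γ := (M.deg γ).comap N.subtype.toAddMonoidHom
  isInternal := by
    refine isInternal_of_projections
      (fun γ => ((M.proj γ).comp N.subtype.toAddMonoidHom).codRestrict N fun m => h γ m m.2)
      (fun γ m => M.proj_mem γ m) (fun γ m hm => Subtype.ext (M.proj_of_mem hm))
      (fun γ δ hne m hm => Subtype.ext (M.proj_of_mem_ne hne hm)) fun m => ?_
    obtain ⟨s, hs⟩ := M.exists_sum_proj m
    refine ⟨s, Subtype.ext ?_⟩
    rw [AddSubmonoidClass.coe_finsetSum]
    exact hs s subset_rfl
  smul_mem hm hr := M.smul_mem hm hr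

/-- The inclusion of a graded submodule. -/
def subHom (M : GrMod ℛ) (N : Submodule Rᵐᵒᵖ M) (h : ∀ γ, ∀ m ∈ N, M.proj γ m ∈ N) :
    Hom (M.sub N h) M := ⟨N.subtype, fun hm => hm⟩

/-- The quotient by a graded submodule. -/
def quot (M : GrMod ℛ) (N : Submodule Rᵐᵒᵖ M) (h : ∀ γ, ∀ m ∈ N, M.proj γ m ∈ N) : GrMod ℛ where
  carrier := M ⧸ N
  deg γ := (M.deg γ).map N.mkQ.toAddMonoidHom
  isInternal := by
    refine isInternal_of_projections
      (fun γ => QuotientAddGroup.map N.toAddSubgroup N.toAddSubgroup (M.proj γ)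
        fun m hm => h γ m hm) ?_ ?_ ?_ ?_
    · intro γ m
      obtain ⟨m, rfl⟩ := N.mkQ_surjective m
      exact ⟨M.proj γ m, M.proj_mem γ m, rfl⟩
    · rintro γ _ ⟨m, hm, rfl⟩
      change N.mkQ (M.proj γ m) = N.mkQ m
      rw [M.proj_of_mem hm]
    · rintro γ δ hne _ ⟨m, hm, rfl⟩
      change N.mkQ (M.proj γ m) = 0
      rw [M.proj_of_mem_ne hne hm, map_zero]
    · intro m
      obtain ⟨m, rfl⟩ := N.mkQ_surjective m
      obtain ⟨s, hs⟩ := M.exists_sum_proj m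
      refine ⟨s, ?_⟩
      change ∑ γ ∈ s, N.mkQ (M.proj γ m) = _
      rw [← map_sum, hs s subset_rfl]
  smul_mem := by
    rintro γ δ _ r ⟨m, hm, rfl⟩ hr
    exact ⟨MulOpposite.op r • m, M.smul_mem hm hr, rfl⟩

/-- The projection to a graded quotient. -/
def quotHom (M : GrMod ℛ) (N : Submodule Rᵐᵒᵖ M) (h : ∀ γ, ∀ m ∈ N, M.proj γ m ∈ N) :
    Hom M (M.quot N h) := ⟨N.mkQ, fun {_ m} hm => ⟨m, hm, rfl⟩⟩

/-- Finite direct sums. -/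
def pi {ι : Type} [Fintype ι] (M : ι → GrMod ℛ) : GrMod ℛ where
  carrier := ∀ i, M i
  deg γ := AddSubgroup.pi Set.univ fun i => (M i).deg γ
  isInternal := by
    classical
    refine isInternal_of_projections
      (fun γ => AddMonoidHom.mk' (fun m i => (M i).proj γ (m i)) fun a b => by ext i; simp)
      (fun γ m i _ => (M i).proj_mem γ _) (fun γ m hm => funext fun i =>
        (M i).proj_of_mem (hm i trivial)) (fun γ δ hne m hm => funext fun i =>
        (M i).proj_of_mem_ne hne (hm i trivial)) fun m => ?_
    choose s hs using fun i => (M i).exists_sum_proj (m i)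
    refine ⟨Finset.univ.biUnion s, funext fun i => ?_⟩
    rw [Finset.sum_apply]
    exact hs i _ (Finset.subset_biUnion_of_mem s (Finset.mem_univ i))
  smul_mem hm hr i _ := (M i).smul_mem (hm i trivial) hr

theorem mem_pi_deg {ι : Type} [Fintype ι] {M : ι → GrMod ℛ} {γ : Γ} {m : pi M} :
    m ∈ (pi M).deg γ ↔ ∀ i, m i ∈ (M i).deg γ :=
  ⟨fun h i => h i trivial, fun h i _ => h i⟩

theorem Hom.ext' {M N : GrMod ℛ} {f g : M ⟶ N} (h : ∀ x : M, f.toLinearMap x = g.toLinearMap x) :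
    f = g := Hom.ext (LinearMap.ext h)

theorem IsGradedProjective.of_retract {P Q : GrMod ℛ} (hP : IsGradedProjective P) (i : Hom Q P)
    (p : Hom P Q) (h : ∀ x, p.toLinearMap (i.toLinearMap x) = x) : IsGradedProjective Q := by
  intro M N g j hg
  obtain ⟨k, hk⟩ := hP M N g ⟨j.toLinearMap ∘ₗ p.toLinearMap, fun hm => j.map_mem (p.map_mem hm)⟩ hg
  refine ⟨⟨k.toLinearMap ∘ₗ i.toLinearMap, fun hm => k.map_mem (i.map_mem hm)⟩, ?_⟩
  rw [← LinearMap.comp_assoc, hk]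
  ext x
  exact congrArg j.toLinearMap (h x)

theorem finite_of_retract {P Q : GrMod ℛ} (hP : Module.Finite Rᵐᵒᵖ P)
    (p : Hom P Q) (h : Function.Surjective p.toLinearMap) : Module.Finite Rᵐᵒᵖ Q :=
  Module.Finite.of_surjective p.toLinearMap h

/-- The inclusion of a summand. -/
def piSingle {ι : Type} [Fintype ι] [DecidableEq ι] (M : ι → GrMod ℛ) (i : ι) : Hom (M i) (pi M) :=
  ⟨LinearMap.single Rᵐᵒᵖ (fun i => (M i).carrier) i, fun {γ m} hm => mem_pi_deg.2 fun k => by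
    change (Pi.single i m : ∀ k, M k) k ∈ _
    by_cases hk : k = i
    · subst hk
      rwa [Pi.single_eq_same]
    · rw [Pi.single_eq_of_ne hk]
      exact zero_mem _⟩

/-- The projection to a summand. -/
def piProj {ι : Type} [Fintype ι] (M : ι → GrMod ℛ) (i : ι) : Hom (pi M) (M i) :=
  ⟨(LinearMap.proj i : (∀ i, (M i).carrier) →ₗ[Rᵐᵒᵖ] M i), fun hm => mem_pi_deg.1 hm i⟩

theorem piProj_piSingle_same {ι : Type} [Fintype ι] [DecidableEq ι] (M : ι → GrMod ℛ) (i : ι)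
    (m : M i) : (piProj M i).toLinearMap ((piSingle M i).toLinearMap m) = m :=
  Pi.single_eq_same (M := fun i => (M i).carrier) i m

theorem piProj_piSingle_ne {ι : Type} [Fintype ι] [DecidableEq ι] (M : ι → GrMod ℛ) {i k : ι}
    (h : k ≠ i) (m : M i) : (piProj M k).toLinearMap ((piSingle M i).toLinearMap m) = 0 :=
  Pi.single_eq_of_ne (M := fun i => (M i).carrier) h m

theorem sum_piSingle_piProj {ι : Type} [Fintype ι] [DecidableEq ι] (M : ι → GrMod ℛ) (m : pi M) :
    ∑ i, (piSingle M i).toLinearMap ((piProj M i).toLinearMap m) = m :=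
  Finset.univ_sum_single (M := fun i => (M i).carrier) m

theorem IsGradedProjective.pi {ι : Type} [Fintype ι] {P : ι → GrMod ℛ}
    (hP : ∀ i, IsGradedProjective (P i)) : IsGradedProjective (pi P) := by
  classical
  intro M N g j hg
  choose h hh using fun i => hP i M N g ⟨j.toLinearMap ∘ₗ (piSingle P i).toLinearMap,
    fun hm => j.map_mem ((piSingle P i).map_mem hm)⟩ hg
  refine ⟨⟨∑ i, (h i).toLinearMap ∘ₗ (piProj P i).toLinearMap, fun {γ m} hm => ?_⟩, ?_⟩
  · rw [LinearMap.sum_apply]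
    exact sum_mem fun i _ => (h i).map_mem (mem_pi_deg.1 hm i)
  · refine LinearMap.ext fun x => ?_
    conv_rhs => rw [← sum_piSingle_piProj P x, map_sum]
    rw [LinearMap.comp_apply, LinearMap.sum_apply, map_sum]
    exact Finset.sum_congr rfl fun i _ => LinearMap.congr_fun (hh i) _

/-- The homogeneous components of a finite generating set are again finite in number and generate.
-/
theorem exists_homogeneous_generators {P : GrMod ℛ} (hP : Module.Finite Rᵐᵒᵖ P) :
    ∃ (n : ℕ) (δ : Fin n → Γ) (q : Fin n → P), (∀ i, q i ∈ P.deg (δ i)) ∧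
      Submodule.span Rᵐᵒᵖ (Set.range q) = ⊤ := by
  classical
  obtain ⟨S, hS⟩ := hP.fg_top
  choose s hs using P.exists_sum_proj
  let T : Finset P := S.biUnion fun m => (s m).image fun γ => P.proj γ m
  have hT : ∀ t ∈ T, ∃ γ, t ∈ P.deg γ := by
    intro t ht
    simp only [T, Finset.mem_biUnion, Finset.mem_image] at ht
    obtain ⟨m, -, γ, -, rfl⟩ := ht
    exact ⟨γ, P.proj_mem γ m⟩
  refine ⟨T.card, fun i => (hT _ (T.equivFin.symm i).2).choose, fun i => (T.equivFin.symm i).1,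
    fun i => (hT _ (T.equivFin.symm i).2).choose_spec, ?_⟩
  rw [eq_top_iff, ← hS, Submodule.span_le]
  intro m hm
  rw [SetLike.mem_coe, ← hs m (s m) subset_rfl]
  refine sum_mem fun γ hγ => Submodule.subset_span ?_
  have : P.proj γ m ∈ T :=
    Finset.mem_biUnion.2 ⟨m, hm, Finset.mem_image.2 ⟨γ, hγ, rfl⟩⟩
  exact ⟨T.equivFin ⟨_, this⟩, by simp⟩

/-! ### The regular module, free modules and dual bases -/

section Regular

variable [GradedRing ℛ]

/-- The ring as a graded right module over itself. -/
def regular (ℛ : Γ → AddSubgroup R) [GradedRing ℛ] : GrMod ℛ where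
  carrier := R
  deg := ℛ
  isInternal := DirectSum.Decomposition.isInternal ℛ
  smul_mem hm hr := SetLike.mul_mem_graded hm hr

/-- The linear map `r ↦ m * r`. -/
def mulRight {M : Type*} [AddCommGroup M] [Module Rᵐᵒᵖ M] (m : M) : R →ₗ[Rᵐᵒᵖ] M where
  toFun r := MulOpposite.op r • m
  map_add' r s := by rw [MulOpposite.op_add, add_smul]
  map_smul' s r := by
    rw [RingHom.id_apply, ← mul_smul]
    rfl

theorem mulRight_apply {M : Type*} [AddCommGroup M] [Module Rᵐᵒᵖ M] (m : M) (r : R) :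
    mulRight m r = MulOpposite.op r • m := rfl

/-- The graded homomorphism `r ↦ m * r`, for `m` of degree zero. -/
def mulRightHom {M : GrMod ℛ} (m : M) (hm : m ∈ M.deg 0) : Hom (regular ℛ) M :=
  ⟨(mulRight m : R →ₗ[Rᵐᵒᵖ] M), fun {γ r} hr => by
    have := M.smul_mem hm hr
    rwa [zero_add] at this⟩

theorem map_regular {M : Type*} [AddCommGroup M] [Module Rᵐᵒᵖ M] (f : R →ₗ[Rᵐᵒᵖ] M) (r : R) :
    f r = MulOpposite.op r • f 1 := by
  rw [← map_smul]
  exact congrArg f (one_mul r).symm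

/-- Any preimage of `j 1` may be replaced by its component of degree zero, since `j 1` itself has
degree zero. -/
theorem IsGradedProjective.regular : IsGradedProjective (regular ℛ) := by
  intro M N g j hg
  let j' : R →ₗ[Rᵐᵒᵖ] N := j.toLinearMap
  have h0 : (1 : R) ∈ ℛ 0 := SetLike.GradedOne.one_mem
  have h1 : j' 1 ∈ N.deg 0 := j.map_mem h0
  obtain ⟨m, hm⟩ := hg (j' 1)
  refine ⟨mulRightHom (M.proj 0 m) (M.proj_mem 0 m), ?_⟩
  suffices ∀ r : R, g.toLinearMap (MulOpposite.op r • M.proj 0 m) = j' r from LinearMap.ext this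
  intro r
  rw [map_smul, ← g.map_proj, hm, N.proj_of_mem h1]
  exact (map_regular j' r).symm

theorem finite_regular : Module.Finite Rᵐᵒᵖ (regular ℛ) := by
  let f : Rᵐᵒᵖ →ₗ[Rᵐᵒᵖ] R :=
    { toFun := MulOpposite.unop, map_add' := fun _ _ => rfl, map_smul' := fun _ _ => rfl }
  have : Module.Finite Rᵐᵒᵖ R := Module.Finite.of_surjective f MulOpposite.unop_surjective
  exact this

/-- The free graded module with basis elements of degrees `δ i`. -/
def free (ℛ : Γ → AddSubgroup R) [GradedRing ℛ] {ι : Type} [Fintype ι] (δ : ι → Γ) : GrMod ℛ :=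
  pi fun i => shiftObj (-δ i) (regular ℛ)

/-- The linear map from a free module given by the images of the basis. -/
def freeLin {P : Type*} [AddCommGroup P] [Module Rᵐᵒᵖ P] {ι : Type} [Fintype ι] (q : ι → P) :
    (ι → R) →ₗ[Rᵐᵒᵖ] P := ∑ i, mulRight (q i) ∘ₗ LinearMap.proj i

theorem freeLin_apply {P : Type*} [AddCommGroup P] [Module Rᵐᵒᵖ P] {ι : Type} [Fintype ι]
    (q : ι → P) (v : ι → R) : freeLin q v = ∑ i, MulOpposite.op (v i) • q i := by
  rw [freeLin, LinearMap.sum_apply]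
  rfl

/-- The homomorphism from a free graded module given by the images of the basis. -/
def freeHom {P : GrMod ℛ} {ι : Type} [Fintype ι] {δ : ι → Γ} {q : ι → P}
    (hq : ∀ i, q i ∈ P.deg (δ i)) : Hom (free ℛ δ) P :=
  ⟨(freeLin q : (ι → R) →ₗ[Rᵐᵒᵖ] P), fun {γ v} hv => by
    refine Eq.subst (motive := fun x => x ∈ P.deg γ) (freeLin_apply q v).symm ?_
    refine sum_mem fun i _ => ?_
    have := P.smul_mem (hq i) (mem_pi_deg.1 hv i)
    rwa [add_neg_cancel_left] at this⟩

theorem freeHom_apply {P : GrMod ℛ} {ι : Type} [Fintype ι] {δ : ι → Γ} {q : ι → P}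
    (hq : ∀ i, q i ∈ P.deg (δ i)) (v : ι → R) :
    (freeHom (ℛ := ℛ) hq).toLinearMap v = ∑ i, MulOpposite.op (v i) • q i :=
  freeLin_apply q v

/-- A homogeneous dual basis of a graded module. -/
structure DualBasis (P : GrMod ℛ) where
  n : ℕ
  δ : Fin n → Γ
  q : Fin n → P
  σ : Fin n → P →ₗ[Rᵐᵒᵖ] R
  q_mem : ∀ i, q i ∈ P.deg (δ i)
  σ_mem : ∀ i {γ x}, x ∈ P.deg γ → σ i x ∈ ℛ (γ - δ i)
  sum : ∀ x, ∑ i, MulOpposite.op (σ i x) • q i = x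

/-- Homogeneous generators define a surjection from a graded free module. Projectivity splits it,
and the coordinates of the splitting are the dual functionals. -/
theorem exists_dualBasis {P : GrMod ℛ} (hP : Module.Finite Rᵐᵒᵖ P) (hP' : IsGradedProjective P) :
    Nonempty (DualBasis P) := by
  obtain ⟨n, δ, q, hq, hspan⟩ := exists_homogeneous_generators hP
  have hπ : Function.Surjective (freeHom hq).toLinearMap := by
    classical
    rw [← LinearMap.range_eq_top, eq_top_iff, ← hspan, Submodule.span_le]
    rintro _ ⟨i, rfl⟩
    refine ⟨(Pi.single i 1 : Fin n → R), (freeHom_apply hq _).trans ?_⟩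
    rw [Finset.sum_eq_single i]
    · rw [Pi.single_eq_same, MulOpposite.op_one, one_smul]
    · intro k _ hk
      rw [Pi.single_eq_of_ne hk, MulOpposite.op_zero, zero_smul]
    · simp
  obtain ⟨h, hh⟩ := hP' _ P (freeHom hq) ⟨LinearMap.id, fun hm => hm⟩ hπ
  let h' : P →ₗ[Rᵐᵒᵖ] (Fin n → R) := h.toLinearMap
  refine ⟨⟨n, δ, q, fun i => LinearMap.proj i ∘ₗ h', hq, fun i γ x hx => ?_, fun x => ?_⟩⟩
  · have := mem_pi_deg.1 (h.map_mem hx) i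
    rw [sub_eq_neg_add]
    exact this
  · exact (freeHom_apply hq (h' x)).symm.trans (LinearMap.congr_fun hh x)

end Regular

end GrMod

end GradedModuleTheory

/-! ### Endomorphism rings of graded modules -/

section EndRing

variable {Γ : Type w} [AddCommGroup Γ] [DecidableEq Γ] {A : Type v} [CommRing A]
  {𝒜 : Γ → AddSubgroup A} {R : Type u} [Ring R] [Algebra A R] {ℛ : Γ → AddSubgroup R}

namespace GrMod

section Scalars

variable [GradedRing 𝒜] (hℛ : ∀ γ, ∀ a ∈ 𝒜 γ, algebraMap A R a ∈ ℛ γ)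

include hℛ

/-- Acting on a homogeneous element separates the components of an arbitrary scalar by degree. In a
graded field each nonzero component is invertible, so one that kills a nonzero element must be zero;
the next two lemmas rest on this. -/
theorem proj_algebraMap_smul (M : GrMod ℛ) {ε : Γ} {m : M} (hm : m ∈ M.deg ε) (c : A) (γ : Γ) :
    M.proj (ε + γ) (MulOpposite.op (algebraMap A R c) • m) =
      MulOpposite.op (algebraMap A R (DirectSum.decompose 𝒜 c γ)) • m := by
  induction c using DirectSum.Decomposition.inductionOn 𝒜 with
  | zero => simp
  | homogeneous c =>
    rename_i δ
    have h := M.smul_mem hm (hℛ δ _ c.2)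
    by_cases hγ : γ = δ
    · subst hγ
      rw [M.proj_of_mem h, DirectSum.decompose_of_mem_same 𝒜 c.2]
    · rw [M.proj_of_mem_ne (fun h' => hγ (add_left_cancel h')) h,
        DirectSum.decompose_of_mem_ne 𝒜 c.2 (Ne.symm hγ)]
      simp
  | add c c' h h' =>
    simp only [map_add, MulOpposite.op_add, add_smul, h, h', DirectSum.decompose_add,
      DirectSum.add_apply, AddSubgroup.coe_add]

theorem mem_of_smul_mem (hA : IsGradedField 𝒜) (M : GrMod ℛ) {ε γ : Γ} {m : M}
    (hm : m ∈ M.deg ε) (h0 : m ≠ 0) {c : A}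
    (h : MulOpposite.op (algebraMap A R c) • m ∈ M.deg (ε + γ)) : c ∈ 𝒜 γ := by
  classical
  rw [← DirectSum.sum_support_decompose 𝒜 c]
  refine sum_mem fun δ _ => ?_
  by_cases hγ : δ = γ
  · subst hγ
    exact SetLike.coe_mem _
  · suffices (DirectSum.decompose 𝒜 c δ : A) = 0 by rw [this]; exact zero_mem _
    by_contra hne
    have h1 := M.proj_algebraMap_smul hℛ hm c δ
    rw [M.proj_of_mem_ne (fun h' => hγ (add_left_cancel h')) h] at h1
    obtain ⟨b, -, hb⟩ := hA.exists_inv (SetLike.coe_mem (DirectSum.decompose 𝒜 c δ)) hne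
    apply h0
    rw [← one_smul Rᵐᵒᵖ m, ← MulOpposite.op_one, ← map_one (algebraMap A R), ← hb, mul_comm,
      map_mul, MulOpposite.op_mul, mul_smul, ← h1, smul_zero]

theorem eq_zero_of_smul_eq_zero (hA : IsGradedField 𝒜) (M : GrMod ℛ) {ε : Γ} {m : M}
    (hm : m ∈ M.deg ε) (h0 : m ≠ 0) {c : A}
    (h : MulOpposite.op (algebraMap A R c) • m = 0) : c = 0 := by
  classical
  rw [← DirectSum.sum_support_decompose 𝒜 c]
  refine Finset.sum_eq_zero fun δ _ => ?_
  by_contra hne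
  have h1 := M.proj_algebraMap_smul hℛ hm c δ
  rw [h, map_zero] at h1
  obtain ⟨b, -, hb⟩ := hA.exists_inv (SetLike.coe_mem (DirectSum.decompose 𝒜 c δ)) hne
  apply h0
  rw [← one_smul Rᵐᵒᵖ m, ← MulOpposite.op_one, ← map_one (algebraMap A R), ← hb, mul_comm,
    map_mul, MulOpposite.op_mul, mul_smul, ← h1, smul_zero]

theorem isGrAlg_self [GradedRing ℛ] (hA : IsGradedField 𝒜) : IsGrAlg 𝒜 ℛ where
  one_mem := SetLike.GradedOne.one_mem
  mul_mem hx hy := SetLike.mul_mem_graded hx hy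
  smul_mem hc hx := by
    rw [Algebra.smul_def]
    exact SetLike.mul_mem_graded (hℛ _ _ hc) hx
  eq_zero_of_smul {ε c x} hx h0 h := by
    refine (regular ℛ).eq_zero_of_smul_eq_zero hℛ hA hx h0 ?_
    rw [Algebra.smul_def, Algebra.commutes] at h
    exact h
  mem_of_smul_mem {γ ε c x} hx h0 h := by
    refine (regular ℛ).mem_of_smul_mem hℛ hA (γ := γ) hx h0 ?_
    rw [Algebra.smul_def, Algebra.commutes, add_comm] at h
    exact h

end Scalars

/-- The ring of all (not necessarily graded) endomorphisms of a graded module. -/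
def EndRing (Q : GrMod ℛ) : Type u := Module.End Rᵐᵒᵖ Q

noncomputable instance (Q : GrMod ℛ) : Ring (EndRing Q) := inferInstanceAs (Ring (Module.End Rᵐᵒᵖ Q))

instance (Q : GrMod ℛ) : FunLike (EndRing Q) Q Q := inferInstanceAs (FunLike (Module.End Rᵐᵒᵖ Q) Q Q)

instance (Q : GrMod ℛ) : LinearMapClass (EndRing Q) Rᵐᵒᵖ Q Q :=
  inferInstanceAs (LinearMapClass (Module.End Rᵐᵒᵖ Q) Rᵐᵒᵖ Q Q)

namespace EndRing

variable {Q : GrMod ℛ}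

theorem ext {f g : EndRing Q} (h : ∀ q, f q = g q) : f = g := LinearMap.ext h

theorem mul_apply (f g : EndRing Q) (q : Q) : (f * g) q = f (g q) := rfl

theorem one_apply (q : Q) : (1 : EndRing Q) q = q := rfl

theorem add_apply (f g : EndRing Q) (q : Q) : (f + g) q = f q + g q := rfl

theorem zero_apply (q : Q) : (0 : EndRing Q) q = 0 := rfl

/-- Scalars act on a module through the centre of the ring. -/
noncomputable def scalar (A : Type v) [CommRing A] [Algebra A R] (Q : GrMod ℛ) :
    A →+* EndRing Q where
  toFun c :=
    ({ toFun := fun q => MulOpposite.op (algebraMap A R c) • q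
       map_add' := smul_add _
       map_smul' := fun s q => by
        rw [RingHom.id_apply, ← mul_smul, ← mul_smul]
        congr 1
        exact Algebra.commutes (A := Rᵐᵒᵖ) c s } : Q →ₗ[Rᵐᵒᵖ] Q)
  map_one' := ext fun q => by
    change MulOpposite.op (algebraMap A R 1) • q = q
    rw [map_one, MulOpposite.op_one, one_smul]
  map_mul' c c' := ext fun q => by
    change MulOpposite.op (algebraMap A R (c * c')) • q =
      MulOpposite.op (algebraMap A R c) • MulOpposite.op (algebraMap A R c') • q
    rw [mul_comm, map_mul, MulOpposite.op_mul, mul_smul]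
  map_zero' := ext fun q => by
    change MulOpposite.op (algebraMap A R 0) • q = 0
    rw [map_zero, MulOpposite.op_zero, zero_smul]
  map_add' c c' := ext fun q => by
    change MulOpposite.op (algebraMap A R (c + c')) • q =
      MulOpposite.op (algebraMap A R c) • q + MulOpposite.op (algebraMap A R c') • q
    rw [map_add, MulOpposite.op_add, add_smul]

noncomputable instance : Algebra A (EndRing Q) :=
  RingHom.toAlgebra' (scalar A Q) fun _ f => ext fun q => (map_smul f _ q).symm

theorem smul_apply (c : A) (f : EndRing Q) (q : Q) :
    (c • f) q = MulOpposite.op (algebraMap A R c) • f q := rfl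

/-- Endomorphisms of degree `γ`. -/
def deg (Q : GrMod ℛ) (γ : Γ) : AddSubgroup (EndRing Q) where
  carrier := {f | ∀ δ, ∀ q ∈ Q.deg δ, f q ∈ Q.deg (γ + δ)}
  add_mem' hf hg δ q hq := add_mem (hf δ q hq) (hg δ q hq)
  zero_mem' _ _ _ := zero_mem _
  neg_mem' hf δ q hq := neg_mem (hf δ q hq)

theorem exists_ne_zero {f : EndRing Q} (hf : f ≠ 0) : ∃ δ, ∃ q ∈ Q.deg δ, f q ≠ 0 := by
  by_contra! h
  refine hf (ext fun q => ?_)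
  induction q using Q.hom_induction with
  | h0 => simp [zero_apply]
  | hadd a b ha hb => rw [map_add, map_add, ha, hb]
  | hhom γ m hm => exact h γ m hm

theorem isGrAlg [GradedRing 𝒜] (hℛ : ∀ γ, ∀ a ∈ 𝒜 γ, algebraMap A R a ∈ ℛ γ)
    (hA : IsGradedField 𝒜) (Q : GrMod ℛ) : IsGrAlg 𝒜 (deg Q) where
  one_mem δ q hq := by rwa [zero_add, one_apply]
  mul_mem {γ δ x y} hx hy ε q hq := by
    rw [add_assoc]
    exact hx _ _ (hy _ _ hq)
  smul_mem {γ δ c x} hc hx ε q hq := by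
    have := Q.smul_mem (hx _ _ hq) (hℛ _ _ hc)
    rw [smul_apply]
    convert this using 2
    abel
  eq_zero_of_smul {ε c x} hx h0 h := by
    obtain ⟨δ, q, hq, hne⟩ := exists_ne_zero h0
    refine Q.eq_zero_of_smul_eq_zero hℛ hA (hx _ _ hq) hne ?_
    rw [← smul_apply, h, zero_apply]
  mem_of_smul_mem {γ ε c x} hx h0 h := by
    obtain ⟨δ, q, hq, hne⟩ := exists_ne_zero h0
    refine Q.mem_of_smul_mem hℛ hA (γ := γ) (hx _ _ hq) hne ?_
    have := h _ _ hq
    rw [smul_apply] at this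
    convert this using 2
    abel

end EndRing

end GrMod

/-! ### Isomorphism classes as labels of idempotent endomorphisms -/

theorem Vgr.mk_surjective (v : Vgr ℛ) : ∃ P, Vgr.mk P = v := Quotient.exists_rep v

theorem Vgr.exact {P Q : Pgr ℛ} (h : Vgr.mk P = Vgr.mk Q) : Nonempty (P.1 ≅ Q.1) :=
  Quotient.exact h

namespace GrMod

theorem iso_hom_inv {M N : GrMod ℛ} (e : M ≅ N) (x : M) :
    e.inv.toLinearMap (e.hom.toLinearMap x) = x :=
  LinearMap.congr_fun (congrArg Hom.toLinearMap e.hom_inv_id) x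

theorem iso_inv_hom {M N : GrMod ℛ} (e : M ≅ N) (x : N) :
    e.hom.toLinearMap (e.inv.toLinearMap x) = x :=
  LinearMap.congr_fun (congrArg Hom.toLinearMap e.inv_hom_id) x

/-- The isomorphism given by mutually inverse graded homomorphisms. -/
def isoOfHoms {M N : GrMod ℛ} (f : Hom M N) (g : Hom N M)
    (h : ∀ x, g.toLinearMap (f.toLinearMap x) = x) (h' : ∀ x, f.toLinearMap (g.toLinearMap x) = x) :
    M ≅ N where
  hom := f
  inv := g
  hom_inv_id := Hom.ext (LinearMap.ext h)
  inv_hom_id := Hom.ext (LinearMap.ext h')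

/-- The composition of graded homomorphisms. -/
def Hom.comp {M N P : GrMod ℛ} (g : Hom N P) (f : Hom M N) : Hom M P :=
  ⟨g.toLinearMap ∘ₗ f.toLinearMap, fun h => g.map_mem (f.map_mem h)⟩

namespace EndRing

variable {Q : GrMod ℛ}

/-- The endomorphism `f` is the projection onto a summand of `Q` in the class `v`. -/
def Lab (Q : GrMod ℛ) (f : EndRing Q) (v : Vgr ℛ) : Prop :=
  ∃ P : Pgr ℛ, Vgr.mk P = v ∧ ∃ (i : Hom P.1 Q) (j : Hom Q P.1),
    (∀ x, j.toLinearMap (i.toLinearMap x) = x) ∧ ∀ q, i.toLinearMap (j.toLinearMap q) = f q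

/-- An endomorphism from a linear map. -/
def ofLin (f : Q →ₗ[Rᵐᵒᵖ] Q) : EndRing Q := f

theorem ofLin_apply (f : Q →ₗ[Rᵐᵒᵖ] Q) (q : Q) : ofLin f q = f q := rfl

theorem lab_mem {f : EndRing Q} {v : Vgr ℛ} (h : Lab Q f v) : f ∈ deg Q 0 := by
  obtain ⟨P, -, i, j, -, h⟩ := h
  intro δ q hq
  rw [zero_add, ← h]
  exact i.map_mem (j.map_mem hq)

theorem lab_idem {f : EndRing Q} {v : Vgr ℛ} (h : Lab Q f v) : f * f = f := by
  obtain ⟨P, -, i, j, h', h⟩ := h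
  refine ext fun q => ?_
  rw [mul_apply, ← h, ← h, h']

theorem lab_one (P : Pgr ℛ) : Lab P.1 1 (Vgr.mk P) :=
  ⟨P, rfl, ⟨LinearMap.id, fun h => h⟩, ⟨LinearMap.id, fun h => h⟩, fun _ => rfl, fun _ => rfl⟩

theorem exists_lab (P : Pgr ℛ) {f : EndRing P.1} (hf : f ∈ deg P.1 0) (hff : f * f = f) :
    ∃ v, Lab P.1 f v := by
  let N : Submodule Rᵐᵒᵖ P.1 := LinearMap.range (f : P.1 →ₗ[Rᵐᵒᵖ] P.1)
  let f' : Hom P.1 P.1 := ⟨f, fun {γ q} hq => by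
    have := hf _ q hq
    rwa [zero_add] at this⟩
  have hN : ∀ γ, ∀ m ∈ N, P.1.proj γ m ∈ N := by
    rintro γ _ ⟨q, rfl⟩
    exact ⟨P.1.proj γ q, (f'.map_proj γ q).symm⟩
  let i := P.1.subHom N hN
  let j : Hom P.1 (P.1.sub N hN) := ⟨LinearMap.rangeRestrict (f : P.1 →ₗ[Rᵐᵒᵖ] P.1),
    fun hm => f'.map_mem hm⟩
  have hji : ∀ x, j.toLinearMap (i.toLinearMap x) = x := by
    rintro ⟨_, q, rfl⟩
    exact Subtype.ext (DFunLike.congr_fun hff q)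
  exact ⟨_, ⟨P.1.sub N hN, finite_of_retract P.2.1 j fun x => ⟨_, hji x⟩,
    P.2.2.of_retract i j hji⟩, rfl, i, j, hji, fun _ => rfl⟩

theorem lab_unique {f : EndRing Q} {v w : Vgr ℛ} (h : Lab Q f v) (h' : Lab Q f w) : v = w := by
  obtain ⟨P, rfl, i, j, h1, h2⟩ := h
  obtain ⟨P', rfl, i', j', h1', h2'⟩ := h'
  refine Vgr.sound (isoOfHoms (j'.comp i) (j.comp i') (fun x => ?_) fun x => ?_)
  · change j.toLinearMap (i'.toLinearMap (j'.toLinearMap (i.toLinearMap x))) = x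
    rw [h2', ← h2, h1, h1]
  · change j'.toLinearMap (i.toLinearMap (j.toLinearMap (i'.toLinearMap x))) = x
    rw [h2, ← h2', h1', h1']

/-- `x` carries the image of `p` onto the image of `p'` and raises degrees by `γ`, so the latter is
the former shifted by `-γ`. This is the source of the sign in `Vgr.shift (-γ)`. -/
theorem lab_of_equiv {p p' x y : EndRing Q} {v : Vgr ℛ} {γ : Γ} (h : Lab Q p v) (hx : x ∈ deg Q γ)
    (hy : y ∈ deg Q (-γ)) (hxy : x * y = p') (hyx : y * x = p) (hxp : x * p = x) :
    Lab Q p' (Vgr.shift (-γ) v) := by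
  obtain ⟨P, rfl, i, j, h1, h2⟩ := h
  have key : ∀ m, j.toLinearMap (y (x (i.toLinearMap m))) = m := fun m => by
    rw [← mul_apply, hyx, ← h2, h1, h1]
  refine ⟨P.shift (-γ), rfl, ⟨(x : Q →ₗ[Rᵐᵒᵖ] Q) ∘ₗ i.toLinearMap, fun {δ m} hm => ?_⟩,
    ⟨j.toLinearMap ∘ₗ (y : Q →ₗ[Rᵐᵒᵖ] Q), fun {δ m} hm => j.map_mem (hy _ _ hm)⟩, key, fun q => ?_⟩
  · have := hx _ _ (i.map_mem (γ := -γ + δ) (m := m) hm)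
    rwa [add_neg_cancel_left] at this
  · change x (i.toLinearMap (j.toLinearMap (y q))) = p' q
    rw [h2, ← mul_apply, hxp, ← hxy, mul_apply]

/-- An isomorphism between the images, one of them shifted, extends to `Q` by inclusion and
projection; the shift turns it into a map of degree `γ` with inverse of degree `-γ`. -/
theorem lab_lift {p p' : EndRing Q} {v : Vgr ℛ} {γ : Γ} (h : Lab Q p v)
    (h' : Lab Q p' (Vgr.shift (-γ) v)) : ∃ x ∈ deg Q γ, ∃ y ∈ deg Q (-γ), x * y = p' ∧
      y * x = p ∧ x * p = x ∧ p * y = y := by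
  obtain ⟨P, rfl, i, j, h1, h2⟩ := h
  obtain ⟨P', hP', i', j', h1', h2'⟩ := h'
  obtain ⟨e⟩ := Vgr.exact (Q := P.shift (-γ)) hP'
  let s : P'.1 →ₗ[Rᵐᵒᵖ] P.1 := e.hom.toLinearMap
  let t : P.1 →ₗ[Rᵐᵒᵖ] P'.1 := e.inv.toLinearMap
  have hst : ∀ m, s (t m) = m := fun m => iso_inv_hom e m
  have hts : ∀ m, t (s m) = m := fun m => iso_hom_inv e m
  have hs : ∀ δ, ∀ m ∈ P'.1.deg δ, s m ∈ P.1.deg (-γ + δ) := fun δ m hm => e.hom.map_mem hm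
  have ht : ∀ δ, ∀ m ∈ P.1.deg (-γ + δ), t m ∈ P'.1.deg δ := fun δ m hm =>
    e.inv.map_mem (γ := δ) (m := m) hm
  refine ⟨ofLin (i'.toLinearMap ∘ₗ t ∘ₗ j.toLinearMap), fun δ q hq => ?_,
    ofLin (i.toLinearMap ∘ₗ s ∘ₗ j'.toLinearMap), fun δ q hq => ?_, ?_, ?_, ?_, ?_⟩
  · refine i'.map_mem (ht _ _ ?_)
    rw [neg_add_cancel_left]
    exact j.map_mem hq
  · exact i.map_mem (hs _ _ (j'.map_mem hq))
  · refine ext fun q => ?_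
    simp only [mul_apply, ofLin_apply, LinearMap.comp_apply, h1, hts, h2']
  · refine ext fun q => ?_
    simp only [mul_apply, ofLin_apply, LinearMap.comp_apply, h1', hst, h2]
  · refine ext fun q => ?_
    simp only [mul_apply, ofLin_apply, LinearMap.comp_apply, ← h2, h1]
  · refine ext fun q => ?_
    simp only [mul_apply, ofLin_apply, LinearMap.comp_apply, ← h2, h1]

theorem lab_zero : Lab Q 0 0 :=
  ⟨Pgr.zero ℛ, rfl, ⟨0, fun _ => zero_mem _⟩, ⟨0, fun _ => zero_mem _⟩, fun _ => rfl, fun _ => rfl⟩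

theorem lab_add {p q : EndRing Q} {v w : Vgr ℛ} (hp : Lab Q p v) (hq : Lab Q q w)
    (hpq : p * q = 0) (hqp : q * p = 0) : Lab Q (p + q) (v + w) := by
  obtain ⟨P, rfl, i, j, h1, h2⟩ := hp
  obtain ⟨P', rfl, i', j', h1', h2'⟩ := hq
  have h3 : ∀ x, j.toLinearMap (i'.toLinearMap x) = 0 := fun x => by
    rw [← h1 (j.toLinearMap _), h2, ← h1' x, h2', ← mul_apply, hpq, zero_apply, map_zero]
  have h4 : ∀ x, j'.toLinearMap (i.toLinearMap x) = 0 := fun x => by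
    rw [← h1' (j'.toLinearMap _), h2', ← h1 x, h2, ← mul_apply, hqp, zero_apply, map_zero]
  refine ⟨P.prod P', rfl, ⟨LinearMap.coprod i.toLinearMap i'.toLinearMap, fun {δ m} hm =>
    add_mem (i.map_mem hm.1) (i'.map_mem hm.2)⟩, ⟨LinearMap.prod j.toLinearMap j'.toLinearMap,
    fun {δ m} hm => ⟨j.map_mem hm, j'.map_mem hm⟩⟩, ?_, ?_⟩
  · rintro ⟨x, y⟩
    refine Prod.ext ?_ ?_
    · change j.toLinearMap (i.toLinearMap x + i'.toLinearMap y) = x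
      rw [map_add, h1, h3, add_zero]
    · change j'.toLinearMap (i.toLinearMap x + i'.toLinearMap y) = y
      rw [map_add, h1', h4, zero_add]
  · intro x
    change i.toLinearMap (j.toLinearMap x) + i'.toLinearMap (j'.toLinearMap x) = _
    rw [h2, h2', add_apply]

theorem lab_split {p : EndRing Q} {v w : Vgr ℛ} (h : Lab Q p (v + w)) :
    ∃ q r, Lab Q q v ∧ Lab Q r w ∧ q * r = 0 ∧ r * q = 0 ∧ q + r = p := by
  obtain ⟨P, hP, i, j, h1, h2⟩ := h
  obtain ⟨P₁, rfl⟩ := v.mk_surjective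
  obtain ⟨P₂, rfl⟩ := w.mk_surjective
  obtain ⟨e⟩ := Vgr.exact (Q := P₁.prod P₂) hP
  let s : P.1 →ₗ[Rᵐᵒᵖ] P₁.1 × P₂.1 := e.hom.toLinearMap
  let t : P₁.1 × P₂.1 →ₗ[Rᵐᵒᵖ] P.1 := e.inv.toLinearMap
  have hst : ∀ m, s (t m) = m := fun m => iso_inv_hom e m
  have hts : ∀ m, t (s m) = m := fun m => iso_hom_inv e m
  have hs : ∀ δ, ∀ m ∈ P.1.deg δ, (s m).1 ∈ P₁.1.deg δ ∧ (s m).2 ∈ P₂.1.deg δ :=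
    fun δ m hm => e.hom.map_mem hm
  have ht : ∀ δ, ∀ m ∈ P₁.1.deg δ, ∀ m' ∈ P₂.1.deg δ, t (m, m') ∈ P.1.deg δ :=
    fun δ m hm m' hm' => e.inv.map_mem (m := (m, m')) ⟨hm, hm'⟩
  let i₁ : Hom P₁.1 Q := ⟨i.toLinearMap ∘ₗ t ∘ₗ LinearMap.inl _ _ _, fun hm =>
    i.map_mem (ht _ _ hm _ (zero_mem _))⟩
  let i₂ : Hom P₂.1 Q := ⟨i.toLinearMap ∘ₗ t ∘ₗ LinearMap.inr _ _ _, fun hm =>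
    i.map_mem (ht _ _ (zero_mem _) _ hm)⟩
  let j₁ : Hom Q P₁.1 := ⟨LinearMap.fst _ _ _ ∘ₗ s ∘ₗ j.toLinearMap, fun hm =>
    (hs _ _ (j.map_mem hm)).1⟩
  let j₂ : Hom Q P₂.1 := ⟨LinearMap.snd _ _ _ ∘ₗ s ∘ₗ j.toLinearMap, fun hm =>
    (hs _ _ (j.map_mem hm)).2⟩
  have e11 : ∀ x, j₁.toLinearMap (i₁.toLinearMap x) = x := fun x => by
    simp [i₁, j₁, h1, hst]
  have e22 : ∀ x, j₂.toLinearMap (i₂.toLinearMap x) = x := fun x => by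
    simp [i₂, j₂, h1, hst]
  have e12 : ∀ x, j₁.toLinearMap (i₂.toLinearMap x) = 0 := fun x => by
    simp [i₂, j₁, h1, hst]
  have e21 : ∀ x, j₂.toLinearMap (i₁.toLinearMap x) = 0 := fun x => by
    simp [i₁, j₂, h1, hst]
  refine ⟨ofLin (i₁.toLinearMap ∘ₗ j₁.toLinearMap), ofLin (i₂.toLinearMap ∘ₗ j₂.toLinearMap),
    ⟨P₁, rfl, i₁, j₁, e11, fun _ => rfl⟩, ⟨P₂, rfl, i₂, j₂, e22, fun _ => rfl⟩, ?_, ?_, ?_⟩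
  · refine ext fun q => ?_
    simp only [mul_apply, ofLin_apply, LinearMap.comp_apply, e12, map_zero, zero_apply]
  · refine ext fun q => ?_
    simp only [mul_apply, ofLin_apply, LinearMap.comp_apply, e21, map_zero, zero_apply]
  · refine ext fun q => ?_
    rw [add_apply, ← h2, ← hts (j.toLinearMap q)]
    change i.toLinearMap (t ((s (j.toLinearMap q)).1, 0)) +
      i.toLinearMap (t (0, (s (j.toLinearMap q)).2)) = _
    rw [← map_add, ← map_add, Prod.mk_add_mk, add_zero, zero_add]

theorem isLabelled (P : Pgr ℛ) (h : IsLocMat 𝒜 (deg P.1)) :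
    IsLabelled 𝒜 (deg P.1) (fun γ => Vgr.shift (-γ)) (Lab P.1) :=
  { h with
    shift_zero := fun v => by rw [neg_zero, Vgr.shift_zero]
    lab_mem := lab_mem
    lab_idem := lab_idem
    exists_lab := exists_lab P
    lab_unique := lab_unique
    lab_of_equiv := lab_of_equiv
    lab_lift := lab_lift
    lab_zero := lab_zero
    lab_add := lab_add
    lab_split := lab_split }

end EndRing

end GrMod

end EndRing

/-! ### Local matriciality of ultramatricial algebras, matrix rings and endomorphism rings -/

section LocallyMatricial

variable {Γ : Type w} [AddCommGroup Γ] [DecidableEq Γ] {A : Type v} [CommRing A]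
  {𝒜 : Γ → AddSubgroup A}

/-- The matrix unit with indices `a` and `b` in a product of matrix rings. -/
def blockUnit (A : Type v) [CommRing A] {l : ℕ} {n : Fin l → ℕ} (a b : Σ k, Fin (n k)) :
    ∀ k, Matrix (Fin (n k)) (Fin (n k)) A :=
  fun k => Matrix.of fun i j => if a = ⟨k, i⟩ ∧ b = ⟨k, j⟩ then 1 else 0

theorem blockUnit_same {l : ℕ} {n : Fin l → ℕ} {k : Fin l} (i j : Fin (n k)) :
    blockUnit A (⟨k, i⟩ : Σ k, Fin (n k)) ⟨k, j⟩ = Pi.single k (Matrix.single i j 1) := by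
  funext k'
  by_cases h : k' = k
  · subst h
    rw [Pi.single_eq_same]
    ext i' j'
    simp [blockUnit, Matrix.single_apply]
  · rw [Pi.single_eq_of_ne h]
    ext i' j'
    have : ¬ k = k' := fun h' => h h'.symm
    simp [blockUnit, this]

theorem blockUnit_mul_of_ne {l : ℕ} {n : Fin l → ℕ} {a b c c' : Σ k, Fin (n k)} (h : b ≠ c) :
    blockUnit A a b * blockUnit A c c' = 0 := by
  funext k
  ext i j
  rw [Pi.mul_apply, Matrix.mul_apply]
  refine Finset.sum_eq_zero fun m _ => ?_
  by_cases hb : b = ⟨k, m⟩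
  · have hc : c ≠ ⟨k, m⟩ := fun hc => h (hb.trans hc.symm)
    simp [blockUnit, hc]
  · simp [blockUnit, hb]

/-- Indices are pairs of a factor and a position in it, and the block is the number of the factor.
The convention of `matrixGrading` puts the unit at `(i, j)` in degree `δ i - δ j`, as `MatUnits`
requires. -/
theorem IsGradedMatricial.exists_matUnits [GradedRing 𝒜] (hA : IsGradedField 𝒜) {R : Type u}
    [Ring R] [Algebra A R] {ℛ : Γ → AddSubgroup R} {C : Subalgebra A R}
    (h : IsGradedMatricial 𝒜 (B := C) fun γ => (ℛ γ).comap (C.val : C →+* R).toAddMonoidHom) :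
    ∃ (κ : Type) (_ : Fintype κ) (_ : DecidableEq κ) (β : κ → ℕ) (d : κ → Γ)
      (g : MatUnits ℛ β d), ∀ r ∈ C, ∃ c ∈ blockAlg A β, g.lin c = r := by
  classical
  obtain ⟨l, n, δ, e, he⟩ := h
  have := hA.1
  have hinj : ∀ x, ((e x : C) : R) = 0 → x = 0 := fun x hx =>
    e.injective (by rw [map_zero]; exact Subtype.ext hx)
  let g : MatUnits ℛ (fun a : Σ k, Fin (n k) => (a.1 : ℕ)) (fun a => δ a.1 a.2) :=
    { e := fun a b => (e (blockUnit A a b) : C)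
      mem := fun {a b} hab => by
        refine (he (δ a.1 a.2 - δ b.1 b.2) (blockUnit A a b)).2 fun k i j => ?_
        by_cases h : a = ⟨k, i⟩ ∧ b = ⟨k, j⟩
        · obtain ⟨rfl, rfl⟩ := h
          have h0 : δ k i - δ k j + δ k j - δ k i = 0 := by abel
          simp only [blockUnit, Matrix.of_apply, and_self, if_true]
          rw [h0]
          exact SetLike.GradedOne.one_mem
        · simp only [blockUnit, Matrix.of_apply, if_neg h]
          exact zero_mem _
      mul := by
        rintro ⟨k, i⟩ ⟨k', j⟩ ⟨k'', j'⟩ h h'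
        obtain rfl : k = k' := Fin.ext h
        obtain rfl : k = k'' := Fin.ext h'
        rw [← MulMemClass.coe_mul, ← map_mul, blockUnit_same, blockUnit_same, blockUnit_same,
          ← Pi.single_mul, Matrix.single_mul_single_same, mul_one]
      mul_of_ne := fun h => by
        rw [← MulMemClass.coe_mul, ← map_mul, blockUnit_mul_of_ne h, map_zero]
        rfl
      eq_zero := fun {a b} h => by
        have : blockUnit A a b = 0 := by
          funext k
          ext i j
          refine if_neg ?_
          rintro ⟨rfl, rfl⟩
          exact h rfl
        rw [this, map_zero]
        rfl
      sum := by
        have : ∑ a : Σ k, Fin (n k), blockUnit A a a = 1 := by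
          rw [Fintype.sum_sigma]
          simp only [blockUnit_same]
          conv_rhs => rw [← Finset.univ_sum_single (1 : ∀ k, Matrix (Fin (n k)) (Fin (n k)) A)]
          refine Finset.sum_congr rfl fun k _ => ?_
          have h1 : ∑ i, Matrix.single i i (1 : A) = (1 : Matrix (Fin (n k)) (Fin (n k)) A) := by
            ext i j
            simp [Matrix.sum_apply, Matrix.single_apply, Matrix.one_apply, ite_and, eq_comm]
          rw [Pi.one_apply, ← h1]
          exact (map_sum (AddMonoidHom.single (fun k => Matrix (Fin (n k)) (Fin (n k)) A) k) _ _).symm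
        rw [← AddSubmonoidClass.coe_finsetSum, ← map_sum, this, map_one]
        rfl
      ne_zero := by
        rintro ⟨k, i⟩ h
        have h1 := hinj _ h
        rw [blockUnit_same] at h1
        have h2 := congrFun (congrFun (congrFun h1 k) i) i
        rw [Pi.single_eq_same, Matrix.single_apply_same] at h2
        exact one_ne_zero h2 }
  refine ⟨_, inferInstance, inferInstance, _, _, g, fun r hr => ?_⟩
  suffices r ∈ (g.hom (A := A)).range by
    obtain ⟨c, hc⟩ := this
    exact ⟨c.1, c.2, hc⟩
  obtain ⟨x, hx⟩ := e.surjective ⟨r, hr⟩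
  have hr' : r = (e x : C) := by rw [hx]
  rw [hr', ← Finset.univ_sum_single x, map_sum, AddSubmonoidClass.coe_finsetSum]
  refine sum_mem fun k _ => ?_
  have hk : Pi.single k (x k) = ∑ i, ∑ j, x k i j • blockUnit A (⟨k, i⟩ : Σ k, Fin (n k)) ⟨k, j⟩ := by
    conv_lhs => rw [Matrix.matrix_eq_sum_single (x k)]
    refine (map_sum (AddMonoidHom.single (fun k => Matrix (Fin (n k)) (Fin (n k)) A) k) _ _).trans
      (Finset.sum_congr rfl fun i _ => ?_)
    refine (map_sum (AddMonoidHom.single (fun k => Matrix (Fin (n k)) (Fin (n k)) A) k) _ _).trans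
      (Finset.sum_congr rfl fun j _ => ?_)
    rw [blockUnit_same, ← Pi.single_smul, Matrix.smul_single, smul_eq_mul, mul_one]
    rfl
  rw [hk]
  simp only [map_sum, map_smul, AddSubmonoidClass.coe_finsetSum]
  refine sum_mem fun i _ => sum_mem fun j _ => ?_
  rw [Subalgebra.coe_smul]
  refine Subalgebra.smul_mem _ ?_ _
  have hmem : Matrix.single (⟨k, i⟩ : Σ k, Fin (n k)) ⟨k, j⟩ (1 : A) ∈
      blockAlg A (fun a : Σ k, Fin (n k) => (a.1 : ℕ)) := by
    intro a b hab
    refine Matrix.single_apply_of_ne _ _ _ _ _ ?_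
    rintro ⟨rfl, rfl⟩
    exact hab rfl
  refine ⟨⟨_, hmem⟩, ?_⟩
  exact (g.lin_single _ _ _).trans (one_smul _ _)

/-- A finite set lies in one stage of the increasing union, and the matrix units of all stages
together form a countable spanning set over `A`. -/
theorem IsGradedUltramatricial.isLocMat [GradedRing 𝒜] (hA : IsGradedField 𝒜) {R : Type u}
    [Ring R] [Algebra A R] {ℛ : Γ → AddSubgroup R} [GradedRing ℛ]
    (h : IsGradedUltramatricial 𝒜 ℛ) : IsLocMat 𝒜 ℛ := by
  classical
  obtain ⟨hℛ, C, hC, hC', hmat⟩ := h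
  refine { GrMod.isGrAlg_self hℛ hA with exists_matUnits := fun t => ?_, countable := ?_ }
  · choose i hi using hC'
    obtain ⟨κ, h1, h2, β, d, g, hg⟩ := (hmat (t.sup i)).exists_matUnits hA
    exact ⟨κ, h1, h2, β, d, g, fun x hx => hg x (hC (Finset.le_sup hx) (hi x))⟩
  · choose κ h1 h2 β d g hg using fun i => (hmat i).exists_matUnits hA
    refine ⟨⋃ i, Set.range fun ab : κ i × κ i => (g i).e ab.1 ab.2,
      Set.countable_iUnion fun i => Set.countable_range _, ?_⟩
    rw [eq_top_iff]
    rintro r -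
    obtain ⟨i, hi⟩ := hC' r
    obtain ⟨c, -, rfl⟩ := hg i r hi
    refine sum_mem fun a _ => sum_mem fun b _ => Submodule.smul_mem _ _ (Submodule.subset_span ?_)
    exact Set.mem_iUnion.2 ⟨i, (a, b), rfl⟩

section Corner

variable {E T : Type u} [Ring E] [Algebra A E] [Ring T] [Algebra A T] {ℰ : Γ → AddSubgroup E}
  {𝒯 : Γ → AddSubgroup T}

/-- Corners of locally matricial algebras are locally matricial. -/
theorem IsLocMat.corner [GradedRing 𝒜] (hA : IsGradedField 𝒜) (hT : IsLocMat 𝒜 𝒯)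
    (hE : IsGrAlg 𝒜 ℰ) (ν : E →ₗ[A] T) (θ : T →ₗ[A] E) (hmul : ∀ x y, ν (x * y) = ν x * ν y)
    (hθν : ∀ x, θ (ν x) = x) (hνθ : ∀ t, ν (θ t) = ν 1 * t * ν 1)
    (hν : ∀ γ, ∀ x ∈ ℰ γ, ν x ∈ 𝒯 γ) (hθ : ∀ γ, ∀ t ∈ 𝒯 γ, θ t ∈ ℰ γ) : IsLocMat 𝒜 ℰ := by
  classical
  have hinj : Function.Injective ν := Function.LeftInverse.injective hθν
  refine { hE with exists_matUnits := fun t => ?_, countable := ?_ }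
  · obtain ⟨κ, _, _, β, d, h, hh⟩ := hT.exists_matUnits (insert (ν 1) (t.image ν))
    obtain ⟨e, he, hLe⟩ := hh (ν 1) (Finset.mem_insert_self _ _)
    have he0 := h.isGrBlock_of_lin_mem hT.toIsGrAlg he (γ := 0) (by
      rw [hLe]
      exact hν _ _ hE.one_mem)
    have hee : e * e = e := h.lin_injOn hT.toIsGrAlg (mul_mem he he) he (by
      rw [h.lin_mul he, hLe, ← hmul, one_mul])
    -- The corner is cut out by `e = ν 1 = U * V`, so the matrices `U * c * V` multiply like the
    -- `c`. The elements `U e_ij V` become the matrix units of the corner, with block and degree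
    -- inherited along `s`.
    obtain ⟨J, _, _, s, U, V, hU, hV, hVU, rfl⟩ := he0.exists_split hA hee
    have hbl : ∀ {i j}, β (s i) = β (s j) → IsGrBlock 𝒜 β d β d (d (s i) - d (s j))
        (U * Matrix.single i j (1 : A) * V) := fun {i j} hij => by
      have := (hU.mul (IsGrBlock.single (𝒜 := 𝒜) (β := β ∘ s) (d := d ∘ s) (β' := β ∘ s)
        (d' := d ∘ s) (a := i) (b := j) hij)).mul hV
      simpa using this
    have hmulm : ∀ (c c' : Matrix J J A), U * c * V * (U * c' * V) = U * (c * c') * V := by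
      intro c c'
      calc _ = U * (c * (V * U) * c') * V := by simp only [Matrix.mul_assoc]
        _ = _ := by rw [hVU, Matrix.mul_one]
    have hone : U * (1 : Matrix J J A) * V = U * V := by rw [Matrix.mul_one]
    have hνθ' : ∀ {i j}, β (s i) = β (s j) → ν (θ (h.lin (U * Matrix.single i j (1 : A) * V))) =
        h.lin (U * Matrix.single i j (1 : A) * V) := fun {i j} hij => by
      have h2 := hmulm 1 (Matrix.single i j (1 : A))
      have h3 := hmulm (Matrix.single i j (1 : A)) 1
      rw [hone, Matrix.one_mul] at h2
      rw [hone, Matrix.mul_one] at h3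
      rw [hνθ, ← hLe, ← h.lin_mul he, h2, ← h.lin_mul (hbl hij).mem_blockAlg, h3]
    let g : MatUnits ℰ (β ∘ s) (d ∘ s) :=
      { e := fun i j => if β (s i) = β (s j) then θ (h.lin (U * Matrix.single i j (1 : A) * V))
          else 0
        mem := fun {i j} hij => by
          have hij' : β (s i) = β (s j) := hij
          rw [if_pos hij']
          exact hθ _ _ (h.lin_mem hT.toIsGrAlg (hbl hij))
        mul := fun {i j k} hij hjk => by
          have hij' : β (s i) = β (s j) := hij
          have hjk' : β (s j) = β (s k) := hjk
          rw [if_pos hij', if_pos hjk', if_pos (hij'.trans hjk')]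
          apply hinj
          rw [hmul, hνθ' hij', hνθ' hjk', hνθ' (hij'.trans hjk'),
            ← h.lin_mul (hbl hij').mem_blockAlg, hmulm, Matrix.single_mul_single_same, mul_one]
        mul_of_ne := fun {i j k l} hjk => by
          split_ifs with h1 h2
          · apply hinj
            rw [hmul, hνθ' h1, hνθ' h2, ← h.lin_mul (hbl h1).mem_blockAlg, hmulm,
              Matrix.single_mul_single_of_ne _ _ _ _ hjk, Matrix.mul_zero, Matrix.zero_mul,
              map_zero, map_zero]
          all_goals simp
        eq_zero := fun hij => if_neg hij
        sum := by
          have h1 : ∑ i, Matrix.single i i (1 : A) = (1 : Matrix J J A) := by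
            ext i j
            simp [Matrix.sum_apply, Matrix.single_apply, Matrix.one_apply, ite_and, eq_comm]
          simp only [if_true]
          rw [← map_sum, ← map_sum, ← Matrix.sum_mul, ← Matrix.mul_sum, h1, hone, hLe, hθν]
        ne_zero := fun i h0 => by
          rw [if_pos rfl] at h0
          have h1 := hνθ' (i := i) rfl
          rw [h0, map_zero] at h1
          have h2 := h.eq_zero_of_lin hT.toIsGrAlg (hbl (i := i) rfl).mem_blockAlg h1.symm
          have h3 : V * (U * Matrix.single i i (1 : A) * V) * U = Matrix.single i i 1 := by
            calc _ = (V * U) * Matrix.single i i (1 : A) * (V * U) := by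
                  simp only [Matrix.mul_assoc]
              _ = _ := by rw [hVU, Matrix.mul_one, Matrix.one_mul]
          rw [h2, Matrix.mul_zero, Matrix.zero_mul] at h3
          have h4 := congrFun (congrFun h3 i) i
          rw [Matrix.single_apply_same] at h4
          have := hA.1
          exact zero_ne_one h4 }
    refine ⟨J, inferInstance, inferInstance, _, _, g, fun x hx => ?_⟩
    obtain ⟨c, hc, hcx⟩ := hh (ν x) (Finset.mem_insert_of_mem (Finset.mem_image_of_mem _ hx))
    -- An element with coefficients `c` in the large algebra has coefficients `V * c * U` in the
    -- corner.
    have hc' : V * c * U ∈ blockAlg A (β ∘ s) := by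
      have key : ∀ i j, β (s i) ≠ β (s j) → (V * c * U) i j = 0 := by
        intro i j hij
        rw [Matrix.mul_apply]
        refine Finset.sum_eq_zero fun b _ => ?_
        by_cases hb : β b = β (s j)
        · rw [Matrix.mul_apply, Finset.sum_eq_zero, zero_mul]
          intro a _
          by_cases ha : β (s i) = β a
          · rw [hc a b (by rw [← ha, hb]; exact hij), mul_zero]
          · rw [(hV i a).1 ha, zero_mul]
        · rw [(hU b j).1 hb, mul_zero]
      exact key
    refine ⟨_, hc', ?_⟩
    have h1 : g.lin (V * c * U) = θ (h.lin (U * (V * c * U) * V)) := by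
      conv_rhs => rw [Matrix.matrix_eq_sum_single (V * c * U)]
      simp only [Matrix.mul_sum, Matrix.sum_mul, map_sum]
      rw [MatUnits.lin_apply]
      refine Finset.sum_congr rfl fun i _ => Finset.sum_congr rfl fun j _ => ?_
      by_cases hij : β (s i) = β (s j)
      · have : Matrix.single i j ((V * c * U) i j) = (V * c * U) i j • Matrix.single i j (1 : A) := by
          rw [Matrix.smul_single, smul_eq_mul, mul_one]
        rw [this, Matrix.mul_smul, Matrix.smul_mul, map_smul, map_smul]
        simp only [g, if_pos hij]
      · rw [hc' i j hij, zero_smul, Matrix.single_zero, Matrix.mul_zero, Matrix.zero_mul, map_zero,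
          map_zero]
    have h2 : U * (V * c * U) * V = U * V * c * (U * V) := by simp only [Matrix.mul_assoc]
    rw [h1, h2, h.lin_mul (mul_mem he hc), h.lin_mul he, hcx, hLe, ← hmul, ← hmul, one_mul,
      mul_one, hθν]
  · obtain ⟨S, hS, hS'⟩ := hT.countable
    refine ⟨θ '' S, hS.image _, ?_⟩
    rw [← Submodule.map_span, hS', Submodule.map_top, LinearMap.range_eq_top]
    exact Function.RightInverse.surjective hθν

end Corner

/-- The grading of the matrix ring over a graded ring shifted by `δ`. -/
def shiftedMatrixGrading {R : Type u} [Ring R] (ℛ : Γ → AddSubgroup R) {n : ℕ} (δ : Fin n → Γ)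
    (γ : Γ) : AddSubgroup (Matrix (Fin n) (Fin n) R) where
  carrier := {x | ∀ i j, x i j ∈ ℛ (γ + δ j - δ i)}
  add_mem' hx hy i j := add_mem (hx i j) (hy i j)
  zero_mem' _ _ := zero_mem _
  neg_mem' hx i j := neg_mem (hx i j)

variable {R : Type u} [Ring R] [Algebra A R] {ℛ : Γ → AddSubgroup R} {n : ℕ}

omit [DecidableEq Γ] in
theorem IsGrAlg.matrix (h : IsGrAlg 𝒜 ℛ) (δ : Fin n → Γ) :
    IsGrAlg 𝒜 (shiftedMatrixGrading ℛ δ) where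
  one_mem i j := by
    by_cases hij : i = j
    · subst hij
      rw [Matrix.one_apply_eq, zero_add, sub_self]
      exact h.one_mem
    · rw [Matrix.one_apply_ne hij]
      exact zero_mem _
  mul_mem {γ γ' x y} hx hy i j := by
    rw [Matrix.mul_apply]
    refine sum_mem fun k _ => ?_
    have := h.mul_mem (hx i k) (hy k j)
    convert this using 2
    abel
  smul_mem {γ γ' c x} hc hx i j := by
    have := h.smul_mem hc (hx i j)
    rw [← add_sub_assoc, ← add_assoc] at this
    exact this
  eq_zero_of_smul {ε c x} hx h0 hc := by
    obtain ⟨i, j, hij⟩ : ∃ i j, x i j ≠ 0 := by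
      by_contra! h'
      exact h0 (Matrix.ext h')
    exact h.eq_zero_of_smul (hx i j) hij (congrFun (congrFun hc i) j)
  mem_of_smul_mem {γ ε c x} hx h0 hc := by
    obtain ⟨i, j, hij⟩ : ∃ i j, x i j ≠ 0 := by
      by_contra! h'
      exact h0 (Matrix.ext h')
    refine h.mem_of_smul_mem (γ := γ) (hx i j) hij ?_
    have := hc i j
    rw [add_assoc, add_sub_assoc] at this
    exact this

/-- The entries of finitely many matrices lie in the span of one system `g` in `R`. The matrices
having a single entry `g.e a b` are units of degree type `δ i + d a`; the blocks are those of `g`,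
since all positions `i` are already connected. -/
theorem IsLocMat.matrix (h : IsLocMat 𝒜 ℛ) (δ : Fin n → Γ) :
    IsLocMat 𝒜 (shiftedMatrixGrading ℛ δ) := by
  classical
  refine { h.toIsGrAlg.matrix δ with exists_matUnits := fun t => ?_, countable := ?_ }
  · obtain ⟨κ, _, _, β, d, g, hg⟩ := h.exists_matUnits
      (t.biUnion fun x => Finset.univ.image fun ij : Fin n × Fin n => x ij.1 ij.2)
    let g' : MatUnits (shiftedMatrixGrading ℛ δ) (fun a : Fin n × κ => β a.2)
        (fun a => δ a.1 + d a.2) :=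
      { e := fun a b => Matrix.single a.1 b.1 (g.e a.2 b.2)
        mem := fun {a b} hab i j => by
          by_cases hij : a.1 = i ∧ b.1 = j
          · obtain ⟨rfl, rfl⟩ := hij
            rw [Matrix.single_apply_same]
            convert g.mem hab using 2
            abel
          · rw [Matrix.single_apply_of_ne _ _ _ _ _ hij]
            exact zero_mem _
        mul := fun {a b c} hab hbc => by
          rw [Matrix.single_mul_single_same, g.mul hab hbc]
        mul_of_ne := fun {a b c c'} hbc => by
          by_cases h1 : b.1 = c.1
          · rw [h1, Matrix.single_mul_single_same, g.mul_of_ne fun h2 => hbc (Prod.ext h1 h2),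
              Matrix.single_zero]
          · rw [Matrix.single_mul_single_of_ne _ _ _ _ h1]
        eq_zero := fun {a b} hab => by rw [g.eq_zero hab, Matrix.single_zero]
        sum := by
          rw [Fintype.sum_prod_type]
          ext i j
          have : ∀ k, ∑ a, Matrix.single k k (g.e a a) = Matrix.single k k 1 := fun k => by
            rw [← g.sum]
            exact (map_sum (Matrix.singleAddMonoidHom k k : R →+ Matrix (Fin n) (Fin n) R) _ _).symm
          simp only [this]
          simp [Matrix.sum_apply, Matrix.single_apply, Matrix.one_apply, ite_and, eq_comm]
        ne_zero := fun a h0 => by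
          have := congrFun (congrFun h0 a.1) a.1
          rw [Matrix.single_apply_same] at this
          exact g.ne_zero a.2 this }
    refine ⟨_, inferInstance, inferInstance, _, _, g', fun x hx => ?_⟩
    have : ∀ i j, ∃ c ∈ blockAlg A β, g.lin c = x i j := fun i j =>
      hg _ (Finset.mem_biUnion.2 ⟨x, hx, Finset.mem_image.2 ⟨(i, j), Finset.mem_univ _, rfl⟩⟩)
    choose c hc hcx using this
    refine ⟨Matrix.of fun a b => c a.1 b.1 a.2 b.2, fun a b hab => hc a.1 b.1 a.2 b.2 hab, ?_⟩
    rw [MatUnits.lin_apply, Fintype.sum_prod_type, Matrix.matrix_eq_sum_single x]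
    refine Finset.sum_congr rfl fun i _ => ?_
    simp only [Fintype.sum_prod_type]
    rw [Finset.sum_comm]
    refine Finset.sum_congr rfl fun j _ => ?_
    rw [← hcx, MatUnits.lin_apply]
    refine Eq.trans ?_ (map_sum
      (Matrix.singleAddMonoidHom i j : R →+ Matrix (Fin n) (Fin n) R) _ _).symm
    refine Finset.sum_congr rfl fun a _ => ?_
    refine Eq.trans ?_ (map_sum
      (Matrix.singleAddMonoidHom i j : R →+ Matrix (Fin n) (Fin n) R) _ _).symm
    refine Finset.sum_congr rfl fun b _ => ?_
    exact Matrix.smul_single _ _ _ _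
  · obtain ⟨S, hS, hS'⟩ := h.countable
    refine ⟨⋃ ij : Fin n × Fin n, (Matrix.singleLinearMap A ij.1 ij.2 : R →ₗ[A] _) '' S,
      Set.countable_iUnion fun _ => hS.image _, ?_⟩
    rw [eq_top_iff]
    rintro x -
    rw [Matrix.matrix_eq_sum_single x]
    refine sum_mem fun i _ => sum_mem fun j _ => ?_
    have h1 : x i j ∈ Submodule.span A S := hS' ▸ Submodule.mem_top
    have h2 := Submodule.mem_map_of_mem (f := (Matrix.singleLinearMap A i j : R →ₗ[A] _)) h1
    rw [Submodule.map_span] at h2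
    exact Submodule.span_mono (Set.subset_iUnion
      (fun ij : Fin n × Fin n => (Matrix.singleLinearMap A ij.1 ij.2 : R →ₗ[A] _) '' S) (i, j)) h2

namespace GrMod

/-- The matrix of an endomorphism with respect to a dual basis. -/
noncomputable def DualBasis.toMatrix [GradedRing ℛ] {Q : GrMod ℛ} (D : DualBasis Q) :
    EndRing Q →ₗ[A] Matrix (Fin D.n) (Fin D.n) R where
  toFun f := Matrix.of fun k l => D.σ k (f (D.q l))
  map_add' f g := by
    ext k l
    simp [EndRing.add_apply]
  map_smul' c f := by
    ext k l
    simp only [Matrix.of_apply, EndRing.smul_apply, map_smul, RingHom.id_apply, Matrix.smul_apply]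
    rw [Algebra.smul_def, Algebra.commutes]
    rfl

/-- The endomorphism given by a matrix with respect to a dual basis. -/
noncomputable def DualBasis.ofMatrix [GradedRing ℛ] {Q : GrMod ℛ} (D : DualBasis Q) :
    Matrix (Fin D.n) (Fin D.n) R →ₗ[A] EndRing Q where
  toFun m := EndRing.ofLin (∑ k, ∑ l,
    mulRight (MulOpposite.op (m k l) • D.q k) ∘ₗ D.σ l)
  map_add' m m' := by
    refine EndRing.ext fun q => ?_
    simp only [EndRing.ofLin_apply, EndRing.add_apply, LinearMap.sum_apply, LinearMap.comp_apply,
      mulRight_apply, ← Finset.sum_add_distrib, Matrix.add_apply, MulOpposite.op_add, add_smul,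
      smul_add]
  map_smul' c m := by
    refine EndRing.ext fun q => ?_
    simp only [EndRing.ofLin_apply, RingHom.id_apply, EndRing.smul_apply, LinearMap.sum_apply,
      LinearMap.comp_apply, mulRight_apply, Finset.smul_sum, Matrix.smul_apply, ← mul_smul,
      ← MulOpposite.op_mul]
    refine Finset.sum_congr rfl fun k _ => Finset.sum_congr rfl fun l _ => ?_
    congr 2
    rw [smul_mul_assoc, Algebra.smul_def, Algebra.commutes]

variable [GradedRing ℛ] {Q : GrMod ℛ} (D : DualBasis Q)

theorem DualBasis.ofMatrix_apply (m : Matrix (Fin D.n) (Fin D.n) R) (q : Q) :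
    D.ofMatrix (A := A) m q = ∑ k, ∑ l, MulOpposite.op (m k l * D.σ l q) • D.q k := by
  change (∑ k, ∑ l, mulRight (MulOpposite.op (m k l) • D.q k) ∘ₗ D.σ l) q = _
  simp only [LinearMap.sum_apply, LinearMap.comp_apply, mulRight_apply, MulOpposite.op_mul,
    mul_smul]

omit [GradedRing ℛ] in
theorem DualBasis.map_apply {M : Type*} [AddCommGroup M] [Module Rᵐᵒᵖ M] (f : Q →ₗ[Rᵐᵒᵖ] M)
    (q : Q) : ∑ l, MulOpposite.op (D.σ l q) • f (D.q l) = f q := by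
  conv_rhs => rw [← D.sum q]
  rw [map_sum]
  simp only [map_smul]

theorem DualBasis.map_apply' (D : DualBasis Q) (f : Q →ₗ[Rᵐᵒᵖ] R) (q : Q) :
    ∑ l, f (D.q l) * D.σ l q = f q := D.map_apply f q

/-- A dual basis identifies the endomorphisms of `P` with the corner of a matrix ring over `R` cut
out by the idempotent matrix `σ k (q l)`; matrix rings and corners inherit local matriciality. -/
theorem EndRing.isLocMat [GradedRing 𝒜] (hA : IsGradedField 𝒜)
    (hℛ : ∀ γ, ∀ a ∈ 𝒜 γ, algebraMap A R a ∈ ℛ γ) (h : IsLocMat 𝒜 ℛ) (P : Pgr ℛ) :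
    IsLocMat 𝒜 (EndRing.deg P.1) := by
  obtain ⟨D⟩ := exists_dualBasis P.2.1 P.2.2
  have hone : ∀ k l, D.toMatrix (A := A) 1 k l = D.σ k (D.q l) := fun k l => rfl
  refine (h.matrix D.δ).corner hA (EndRing.isGrAlg hℛ hA P.1) D.toMatrix D.ofMatrix ?_ ?_ ?_ ?_ ?_
  · intro f g
    ext k l
    rw [Matrix.mul_apply]
    exact (D.map_apply' (D.σ k ∘ₗ (f : P.1 →ₗ[Rᵐᵒᵖ] P.1)) (g (D.q l))).symm
  · intro f
    refine EndRing.ext fun q => ?_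
    rw [D.ofMatrix_apply]
    have : ∀ k, ∑ l, D.toMatrix (A := A) f k l * D.σ l q = D.σ k (f q) := fun k =>
      D.map_apply' (D.σ k ∘ₗ (f : P.1 →ₗ[Rᵐᵒᵖ] P.1)) q
    simp only [← Finset.sum_smul, ← Finset.op_sum, this]
    exact D.sum _
  · intro m
    ext i j
    change D.σ i (D.ofMatrix (A := A) m (D.q j)) = _
    rw [D.ofMatrix_apply]
    simp only [map_sum, map_smul, Matrix.mul_apply, hone, Finset.sum_mul]
    rw [Finset.sum_comm]
    refine Finset.sum_congr rfl fun k _ => Finset.sum_congr rfl fun l _ => ?_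
    rw [mul_assoc]
    rfl
  · intro γ f hf k l
    exact D.σ_mem k (hf _ _ (D.q_mem l))
  · intro γ m hm δ q hq
    rw [D.ofMatrix_apply]
    refine sum_mem fun k _ => sum_mem fun l _ => ?_
    have := P.1.smul_mem (D.q_mem k) (SetLike.mul_mem_graded (hm k l) (D.σ_mem l hq))
    convert this using 2
    abel

end GrMod

end LocallyMatricial

/-! ### Cancellation and the comparison of classes -/

section Classes

variable {Γ : Type w} [AddCommGroup Γ] [DecidableEq Γ] {A : Type v} [CommRing A]
  {𝒜 : Γ → AddSubgroup A} {R S : Type u} [Ring R] [Ring S] [Algebra A R] [Algebra A S]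
  {ℛ : Γ → AddSubgroup R} {𝒮 : Γ → AddSubgroup S}

theorem GrMod.EndRing.sum_apply {ι : Type*} (s : Finset ι) {Q : GrMod ℛ} (f : ι → EndRing Q)
    (q : Q) : (∑ i ∈ s, f i) q = ∑ i ∈ s, f i q :=
  LinearMap.sum_apply s (fun i => (f i : Q →ₗ[Rᵐᵒᵖ] Q)) q

theorem IsGradedUltramatricial.isLabelled [GradedRing 𝒜] [GradedRing ℛ] (hA : IsGradedField 𝒜)
    (h : IsGradedUltramatricial 𝒜 ℛ) (P : Pgr ℛ) :
    IsLabelled 𝒜 (GrMod.EndRing.deg P.1) (fun γ => Vgr.shift (-γ)) (GrMod.EndRing.Lab P.1) :=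
  GrMod.EndRing.isLabelled P (GrMod.EndRing.isLocMat hA h.1 (h.isLocMat hA) P)

/-- In the endomorphism ring of a module of class `x + z = y + z`, the unit splits in two ways with
a common label `z`; the complementary labels then agree. -/
theorem Vgr.add_right_cancel_of_isGradedUltramatricial [GradedRing 𝒜] [GradedRing ℛ]
    (hA : IsGradedField 𝒜) (h : IsGradedUltramatricial 𝒜 ℛ) {x y z : Vgr ℛ} (hxy : x + z = y + z) :
    x = y := by
  obtain ⟨U, hU⟩ := (x + z).mk_surjective
  have h1 := GrMod.EndRing.lab_one U
  have h2 := h1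
  rw [hU] at h1
  rw [hU, hxy] at h2
  obtain ⟨p, q, hp, hq, -, -, hpq⟩ := GrMod.EndRing.lab_split h1
  obtain ⟨p', q', hp', hq', -, -, hpq'⟩ := GrMod.EndRing.lab_split h2
  exact IsLabelled.label_cancel hA (h.isLabelled hA U) hp hq hp' hq' hpq hpq'

theorem K0gr.of_injective [GradedRing 𝒜] [GradedRing ℛ]
    (hA : IsGradedField 𝒜) (h : IsGradedUltramatricial 𝒜 ℛ) : Function.Injective (K0gr.of ℛ) := by
  have : IsRightCancelAdd (Vgr ℛ) :=
    ⟨fun z x y hxy => Vgr.add_right_cancel_of_isGradedUltramatricial hA h hxy⟩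
  have : IsCancelAdd (Vgr ℛ) := AddCommMagma.IsRightCancelAdd.toIsCancelAdd _
  exact Algebra.GrothendieckAddGroup.of_injective

theorem K0gr.single_smul_of (α : Γ) (x : Vgr ℛ) :
    (AddMonoidAlgebra.single α (1 : ℤ)) • K0gr.of ℛ x = K0gr.of ℛ (Vgr.shift α x) := by
  obtain ⟨P, rfl⟩ := x.mk_surjective
  exact K0gr.single_smul_mk α P

/-- An isomorphism of Grothendieck groups preserving the positive cones restricts to the monoids of
isomorphism classes. -/
theorem K0gr.exists_vgr_equiv (hR : Function.Injective (K0gr.of ℛ))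
    (hS : Function.Injective (K0gr.of 𝒮)) (f : K0gr ℛ ≃ₗ[AddMonoidAlgebra ℤ Γ] K0gr 𝒮)
    (hf : f '' (K0gr.positiveCone ℛ : Set (K0gr ℛ)) = (K0gr.positiveCone 𝒮 : Set (K0gr 𝒮))) :
    ∃ F : Vgr ℛ ≃+ Vgr 𝒮, ∀ α x, F (Vgr.shift α x) = Vgr.shift α (F x) := by
  have h1 : ∀ x, ∃ y, K0gr.of 𝒮 y = f (K0gr.of ℛ x) := fun x => by
    have : f (K0gr.of ℛ x) ∈ (K0gr.positiveCone 𝒮 : Set (K0gr 𝒮)) :=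
      hf ▸ Set.mem_image_of_mem f ⟨x, rfl⟩
    exact this
  choose F hF using h1
  let F' : Vgr ℛ →+ Vgr 𝒮 :=
    { toFun := F
      map_zero' := hS (by simp only [map_zero, hF])
      map_add' := fun x y => hS (by simp only [map_add, hF]) }
  have hbij : Function.Bijective F' := by
    refine ⟨fun x y hxy => hR (f.injective ?_), fun y => ?_⟩
    · rw [← hF, ← hF]
      exact congrArg _ hxy
    · have : K0gr.of 𝒮 y ∈ f '' (K0gr.positiveCone ℛ : Set (K0gr ℛ)) := hf ▸ ⟨y, rfl⟩
      obtain ⟨_, ⟨x, rfl⟩, hx⟩ := this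
      exact ⟨x, hS ((hF x).trans hx)⟩
  refine ⟨AddEquiv.ofBijective F' hbij, fun α x => hS ?_⟩
  change K0gr.of 𝒮 (F _) = K0gr.of 𝒮 (Vgr.shift α (F x))
  rw [hF, ← K0gr.single_smul_of, map_smul, ← K0gr.single_smul_of, hF]

namespace Pgr

variable [GradedRing ℛ]

/-- The ring as a graded projective module. -/
def regular (ℛ : Γ → AddSubgroup R) [GradedRing ℛ] : Pgr ℛ :=
  ⟨GrMod.regular ℛ, GrMod.finite_regular, .regular⟩

/-- Finitely generated free graded modules. -/
def free (ℛ : Γ → AddSubgroup R) [GradedRing ℛ] {n : ℕ} (δ : Fin n → Γ) : Pgr ℛ :=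
  ⟨GrMod.free ℛ δ,
    have : ∀ i, Module.Finite Rᵐᵒᵖ (GrMod.shiftObj (-δ i) (GrMod.regular ℛ)) := fun _ =>
      GrMod.finite_regular (ℛ := ℛ)
    Module.Finite.pi, .pi fun _ => GrMod.IsGradedProjective.regular.shift _⟩

end Pgr

variable [GradedRing 𝒜] [GradedRing ℛ]

/-- The coordinate projections are orthogonal idempotents with sum `1`, so the label of the unit is
the sum of their labels. -/
theorem Vgr.mk_free (hA : IsGradedField 𝒜) (h : IsGradedUltramatricial 𝒜 ℛ) {n : ℕ}
    (δ : Fin n → Γ) :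
    Vgr.mk (Pgr.free ℛ δ) = ∑ i, Vgr.shift (-δ i) (Vgr.mk (Pgr.regular ℛ)) := by
  have hL := h.isLabelled hA (Pgr.free ℛ δ)
  let M : Fin n → GrMod ℛ := fun i => GrMod.shiftObj (-δ i) (GrMod.regular ℛ)
  let p : Fin n → GrMod.EndRing (Pgr.free ℛ δ).1 := fun i =>
    GrMod.EndRing.ofLin ((GrMod.piSingle M i).toLinearMap ∘ₗ (GrMod.piProj M i).toLinearMap)
  have hp : ∑ i, p i = 1 := by
    refine GrMod.EndRing.ext fun q => ?_
    rw [GrMod.EndRing.sum_apply]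
    exact GrMod.sum_piSingle_piProj M q
  refine hL.lab_unique (GrMod.EndRing.lab_one _) ?_
  rw [← hp]
  refine hL.lab_sum _ (fun i _ => ⟨(Pgr.regular ℛ).shift (-δ i), rfl, GrMod.piSingle M i,
    GrMod.piProj M i, GrMod.piProj_piSingle_same M i, fun _ => rfl⟩) fun i _ j _ hij => ?_
  refine GrMod.EndRing.ext fun q => ?_
  exact (congrArg (GrMod.piSingle M i).toLinearMap
    (GrMod.piProj_piSingle_ne M hij ((GrMod.piProj M j).toLinearMap q))).trans (map_zero _)

/-- A dual basis makes a module a retract of a graded free one, and `y` is the label of the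
complementary idempotent `1 - p`. In order terms, finite sums of shifts of `[R]` dominate every
class. -/
theorem Vgr.exists_add_eq_sum (hA : IsGradedField 𝒜) (h : IsGradedUltramatricial 𝒜 ℛ)
    (x : Vgr ℛ) : ∃ (n : ℕ) (δ : Fin n → Γ) (y : Vgr ℛ),
      x + y = ∑ i, Vgr.shift (-δ i) (Vgr.mk (Pgr.regular ℛ)) := by
  obtain ⟨P, rfl⟩ := x.mk_surjective
  obtain ⟨D⟩ := GrMod.exists_dualBasis P.2.1 P.2.2
  have hL := h.isLabelled hA (Pgr.free ℛ D.δ)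
  let σ : GrMod.Hom P.1 (Pgr.free ℛ D.δ).1 := ⟨LinearMap.pi D.σ, fun {γ x} hx =>
    GrMod.mem_pi_deg.2 fun i => by
      have := D.σ_mem i hx
      rwa [sub_eq_neg_add] at this⟩
  let π : GrMod.Hom (Pgr.free ℛ D.δ).1 P.1 := GrMod.freeHom D.q_mem
  have hπ : ∀ x, π.toLinearMap (σ.toLinearMap x) = x := fun x =>
    (GrMod.freeHom_apply D.q_mem _).trans (D.sum x)
  let p : GrMod.EndRing (Pgr.free ℛ D.δ).1 := .ofLin (σ.toLinearMap ∘ₗ π.toLinearMap)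
  have hp : GrMod.EndRing.Lab _ p (Vgr.mk P) := ⟨P, rfl, σ, π, hπ, fun _ => rfl⟩
  have hpp := hL.lab_idem hp
  obtain ⟨y, hy⟩ := hL.exists_lab (p := 1 - p) (sub_mem hL.one_mem (hL.lab_mem hp)) (by
    rw [mul_sub, sub_mul, sub_mul, hpp]
    simp)
  refine ⟨D.n, D.δ, y, ?_⟩
  rw [← Vgr.mk_free hA h]
  refine hL.lab_unique ?_ (GrMod.EndRing.lab_one _)
  have := hL.lab_add hp hy (by rw [mul_sub, hpp, mul_one, sub_self])
    (by rw [sub_mul, hpp, one_mul, sub_self])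
  rwa [add_sub_cancel] at this

/-- If the shifts of `Q` generate the class of the ring, then `Q` is a generator. -/
theorem Pgr.exists_generator (hA : IsGradedField 𝒜) (h : IsGradedUltramatricial 𝒜 ℛ)
    (Q : Pgr ℛ) {n : ℕ} {δ : Fin n → Γ} {y : Vgr ℛ}
    (hy : Vgr.mk (Pgr.regular ℛ) + y = ∑ i, Vgr.shift (-δ i) (Vgr.mk Q)) :
    ∃ (q : Fin n → Q.1) (g : Fin n → Q.1 →ₗ[Rᵐᵒᵖ] R), (∀ k, q k ∈ Q.1.deg (-δ k)) ∧
      (∀ k γ, ∀ x ∈ Q.1.deg γ, g k x ∈ ℛ (δ k + γ)) ∧ ∑ k, g k (q k) = 1 := by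
  -- `U` contains the ring as a summand and is also a sum of shifts of `Q`; both are read off by
  -- splitting the label of its unit.
  obtain ⟨U, hU⟩ := (∑ i, Vgr.shift (-δ i) (Vgr.mk Q)).mk_surjective
  have hL := h.isLabelled hA U
  have h1 := GrMod.EndRing.lab_one U
  have h2 := h1
  rw [hU, ← hy] at h1
  rw [hU] at h2
  obtain ⟨p, -, ⟨P, hP, i, j, hji, -⟩, -⟩ := GrMod.EndRing.lab_split h1
  obtain ⟨e⟩ := Vgr.exact hP
  obtain ⟨p', hp', -, hsum⟩ := hL.lab_split_sum _ h2
  have h3 : ∀ k, ∃ (s : GrMod.Hom (Q.shift (-δ k)).1 U.1) (t : GrMod.Hom U.1 (Q.shift (-δ k)).1),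
      ∀ x, s.toLinearMap (t.toLinearMap x) = p' k x := fun k => by
    obtain ⟨P', hP', i', j', h1', h2'⟩ := hp' k (Finset.mem_univ k)
    obtain ⟨e'⟩ := Vgr.exact (Q := Q.shift (-δ k)) hP'
    refine ⟨i'.comp e'.inv, GrMod.Hom.comp e'.hom j', fun x => ?_⟩
    rw [← h2']
    exact congrArg i'.toLinearMap (GrMod.iso_hom_inv e' _)
  choose s t hst using h3
  -- `a` is the image of `1` under the inclusion of the ring in `U`, and `b` is the projection back.
  -- Decomposing `a` along the summands `Q(-δ k)` turns `b a = 1` into the partition of unity.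
  let a : U.1 := i.toLinearMap (e.inv.toLinearMap (1 : R))
  let b : U.1 →ₗ[Rᵐᵒᵖ] R := e.hom.toLinearMap ∘ₗ j.toLinearMap
  have hba : b a = 1 := (congrArg e.hom.toLinearMap (hji _)).trans (GrMod.iso_inv_hom e _)
  have h0 : (1 : R) ∈ ℛ 0 := SetLike.GradedOne.one_mem
  have ha : a ∈ U.1.deg 0 := i.map_mem (e.inv.map_mem h0)
  refine ⟨fun k => (t k).toLinearMap a, fun k => b ∘ₗ (s k).toLinearMap, fun k => ?_,
    fun k γ x hx => ?_, ?_⟩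
  · have := (t k).map_mem ha
    change _ ∈ Q.1.deg (-δ k + 0) at this
    rwa [add_zero] at this
  · refine e.hom.map_mem (j.map_mem ((s k).map_mem ?_))
    change x ∈ Q.1.deg (-δ k + (δ k + γ))
    rwa [neg_add_cancel_left]
  · have h4 : ∑ k, p' k a = a := by
      rw [← GrMod.EndRing.sum_apply, hsum, GrMod.EndRing.one_apply]
    refine Eq.trans ?_ hba
    conv_rhs => rw [← h4, map_sum]
    exact Finset.sum_congr rfl fun k _ => congrArg b (hst k a)

end Classes

/-! ### Functors of homomorphisms -/

section Progenerator

variable {Γ : Type w} [AddCommGroup Γ] [DecidableEq Γ] {A : Type v} [CommRing A]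
  {𝒜 : Γ → AddSubgroup A} {R S : Type u} [Ring R] [Ring S] [Algebra A R] [Algebra A S]
  {ℛ : Γ → AddSubgroup R} {𝒮 : Γ → AddSubgroup S}

namespace GrMod

/-- Left multiplication, as a map of right modules. -/
def mulLeft (r : R) : R →ₗ[Rᵐᵒᵖ] R where
  toFun x := r * x
  map_add' := mul_add r
  map_smul' s x := (mul_assoc r x s.unop).symm

/-- Left multiplication identifies a ring with the endomorphisms of its regular module. -/
noncomputable def EndRing.regularEquiv (ℛ : Γ → AddSubgroup R) [GradedRing ℛ] :
    EndRing (regular ℛ) ≃+* R where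
  toFun f := f (1 : R)
  invFun r := .ofLin ((mulLeft r : R →ₗ[Rᵐᵒᵖ] R))
  left_inv f := ext fun x => (map_regular (f : R →ₗ[Rᵐᵒᵖ] R) x).symm
  right_inv r := mul_one r
  map_mul' f g := map_regular (f : R →ₗ[Rᵐᵒᵖ] R) (g (1 : R))
  map_add' _ _ := rfl

theorem EndRing.regularEquiv_mem [GradedRing ℛ] (γ : Γ) (f : EndRing (regular ℛ)) :
    regularEquiv ℛ f ∈ ℛ γ ↔ f ∈ deg (regular ℛ) γ := by
  refine ⟨fun h δ x hx => ?_, fun h => ?_⟩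
  · let f' : R →ₗ[Rᵐᵒᵖ] R := f
    have key : ∀ x : R, x ∈ ℛ δ → f' x ∈ ℛ (γ + δ) := fun x hx => by
      rw [map_regular]
      exact SetLike.mul_mem_graded h hx
    exact key x hx
  · have h1 : (1 : R) ∈ ℛ 0 := SetLike.GradedOne.one_mem
    have := h 0 (1 : R) h1
    rw [add_zero] at this
    exact this

end GrMod

/-- With `[Q] = F [R]`, the units of `End_R(R) ≅ R` and of `End_S(Q)` carry the same label once
labels are moved along `F`, so the rings are isomorphic. Applying `F` to the domination of `F⁻¹ [S]`
by shifts of `[R]` gives domination of `[S]` by shifts of `[Q]`, which makes `Q` a generator. -/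
theorem IsGradedUltramatricial.exists_progenerator [GradedRing 𝒜] [GradedRing ℛ] [GradedRing 𝒮]
    (hA : IsGradedField 𝒜) (hR : IsGradedUltramatricial 𝒜 ℛ) (hS : IsGradedUltramatricial 𝒜 𝒮)
    (F : Vgr ℛ ≃+ Vgr 𝒮) (hF : ∀ α x, F (Vgr.shift α x) = Vgr.shift α (F x)) :
    ∃ (Q : Pgr 𝒮) (ρ : R ≃+* GrMod.EndRing Q.1),
      (∀ γ r, r ∈ ℛ γ ↔ ρ r ∈ GrMod.EndRing.deg Q.1 γ) ∧
      ∃ (n : ℕ) (δ : Fin n → Γ) (q : Fin n → Q.1) (g : Fin n → Q.1 →ₗ[Sᵐᵒᵖ] S),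
        (∀ k, q k ∈ Q.1.deg (-δ k)) ∧ (∀ k γ, ∀ x ∈ Q.1.deg γ, g k x ∈ 𝒮 (δ k + γ)) ∧
        ∑ k, g k (q k) = 1 := by
  obtain ⟨Q, hQ⟩ := (F (Vgr.mk (Pgr.regular ℛ))).mk_surjective
  obtain ⟨Θ, hΘ⟩ := IsLabelled.exists_ringEquiv hA
    ((hR.isLabelled hA (Pgr.regular ℛ)).map F fun γ v => hF (-γ) v) (hS.isLabelled hA Q)
    (v := Vgr.mk Q) (by
      rw [hQ, F.symm_apply_apply]
      exact GrMod.EndRing.lab_one _) (GrMod.EndRing.lab_one Q)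
  obtain ⟨n, δ, y, hy⟩ := Vgr.exists_add_eq_sum hA hR (F.symm (Vgr.mk (Pgr.regular 𝒮)))
  have hy' : Vgr.mk (Pgr.regular 𝒮) + F y = ∑ i, Vgr.shift (-δ i) (Vgr.mk Q) := by
    rw [← F.apply_symm_apply (Vgr.mk (Pgr.regular 𝒮)), ← map_add, hy, map_sum, hQ]
    exact Finset.sum_congr rfl fun i _ => hF _ _
  obtain ⟨q, g, hq, hg, hqg⟩ := Q.exists_generator hA hS hy'
  refine ⟨Q, (GrMod.EndRing.regularEquiv ℛ).symm.trans Θ, fun γ r => ?_, n, δ, q, g, hq, hg, hqg⟩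
  refine Iff.trans ?_ (hΘ _ _)
  refine Iff.trans ?_ (GrMod.EndRing.regularEquiv_mem _ _)
  exact iff_of_eq (congrArg (· ∈ ℛ γ)
    ((GrMod.EndRing.regularEquiv ℛ).apply_symm_apply r).symm)

namespace GrMod

variable {X : GrMod 𝒮} [GradedRing 𝒮]

/-- Homomorphisms of degree `γ`. -/
def homDeg (X M : GrMod 𝒮) (γ : Γ) : AddSubgroup (X →ₗ[Sᵐᵒᵖ] M) where
  carrier := {f | ∀ ε, ∀ x ∈ X.deg ε, f x ∈ M.deg (γ + ε)}
  add_mem' hf hg ε x hx := add_mem (hf ε x hx) (hg ε x hx)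
  zero_mem' _ _ _ := zero_mem _
  neg_mem' hf ε x hx := neg_mem (hf ε x hx)

/-- A homomorphism is determined by its values on the finitely many `q k`, so only finitely many
degrees occur. The component of degree `γ` is `x ↦ ∑ (f (q k))_{γ + δ k} * σ k x`. -/
theorem isInternal_homDeg (D : DualBasis X) (M : GrMod 𝒮) : DirectSum.IsInternal (homDeg X M) := by
  classical
  let π : Γ → (X →ₗ[Sᵐᵒᵖ] M) →+ (X →ₗ[Sᵐᵒᵖ] M) := fun γ => AddMonoidHom.mk'
    (fun f => ∑ k, mulRight (M.proj (γ + D.δ k) (f (D.q k))) ∘ₗ D.σ k) fun f g => by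
      rw [← Finset.sum_add_distrib]
      refine Finset.sum_congr rfl fun k _ => LinearMap.ext fun x => ?_
      simp [mulRight_apply]
  have hπ : ∀ γ f x, π γ f x =
      ∑ k, MulOpposite.op (D.σ k x) • M.proj (γ + D.δ k) (f (D.q k)) := fun γ f x => by
    change (∑ k, mulRight (M.proj (γ + D.δ k) (f (D.q k))) ∘ₗ D.σ k) x = _
    rw [LinearMap.sum_apply]
    rfl
  refine isInternal_of_projections π (fun γ f ε x hx => ?_) (fun γ f hf => ?_)
    (fun γ γ' hne f hf => ?_) fun f => ?_
  · rw [hπ]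
    refine sum_mem fun k _ => ?_
    have := M.smul_mem (M.proj_mem (γ + D.δ k) (f (D.q k))) (D.σ_mem k hx)
    convert this using 2
    abel
  · refine LinearMap.ext fun x => ?_
    rw [hπ, ← D.map_apply f x]
    exact Finset.sum_congr rfl fun k _ => by rw [M.proj_of_mem (hf _ _ (D.q_mem k))]
  · refine LinearMap.ext fun x => ?_
    rw [hπ]
    refine Finset.sum_eq_zero fun k _ => ?_
    rw [M.proj_of_mem_ne (fun h => hne (add_right_cancel h)) (hf _ _ (D.q_mem k)), smul_zero]
  · choose s hs using fun k => M.exists_sum_proj (f (D.q k))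
    let t : Finset Γ := Finset.univ.biUnion fun k => (s k).image fun γ => γ - D.δ k
    refine ⟨t, LinearMap.ext fun x => ?_⟩
    rw [LinearMap.sum_apply]
    simp only [hπ]
    rw [Finset.sum_comm, ← D.map_apply f x]
    refine Finset.sum_congr rfl fun k _ => ?_
    have hk : s k ⊆ t.image fun γ => γ + D.δ k := fun γ hγ =>
      Finset.mem_image.2 ⟨γ - D.δ k, Finset.mem_biUnion.2 ⟨k, Finset.mem_univ k,
        Finset.mem_image_of_mem (fun γ => γ - D.δ k) hγ⟩, sub_add_cancel _ _⟩
    have := hs k _ hk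
    rw [Finset.sum_image fun _ _ _ _ h => add_right_cancel h] at this
    rw [← Finset.smul_sum, this]

/-- Homomorphisms out of a bimodule form a right module. -/
@[reducible]
noncomputable def homModule (ρ : R →+* EndRing X) (M : GrMod 𝒮) : Module Rᵐᵒᵖ (X →ₗ[Sᵐᵒᵖ] M) where
  smul r f := f ∘ₗ (ρ r.unop : X →ₗ[Sᵐᵒᵖ] X)
  one_smul f := LinearMap.ext fun x => congrArg f (by
    change ρ 1 x = x
    rw [map_one, EndRing.one_apply])
  mul_smul r s f := LinearMap.ext fun x => congrArg f (by
    change ρ (s.unop * r.unop) x = ρ s.unop (ρ r.unop x)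
    rw [map_mul, EndRing.mul_apply])
  smul_zero _ := LinearMap.zero_comp _
  smul_add _ _ _ := LinearMap.add_comp _ _ _
  add_smul r s f := LinearMap.ext fun x => by
    change f (ρ (r.unop + s.unop) x) = f (ρ r.unop x) + f (ρ s.unop x)
    rw [map_add, EndRing.add_apply, map_add]
  zero_smul f := LinearMap.ext fun x => by
    change f (ρ 0 x) = 0
    rw [map_zero, EndRing.zero_apply, map_zero]

variable (ρ : R →+* EndRing X) (hρ : ∀ γ, ∀ r ∈ ℛ γ, ρ r ∈ EndRing.deg X γ) (D : DualBasis X)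

/-- The graded module of homomorphisms out of a graded bimodule. -/
noncomputable def homObj (M : GrMod 𝒮) : GrMod ℛ where
  carrier := X →ₗ[Sᵐᵒᵖ] M
  module := homModule ρ M
  deg := homDeg X M
  isInternal := isInternal_homDeg D M
  smul_mem {γ δ f r} hf hr ε x hx := by
    rw [add_assoc]
    exact hf _ _ (hρ _ _ hr _ _ hx)

/-- A homomorphism as an element of the module of homomorphisms. -/
noncomputable def homObj.ofLin {M : GrMod 𝒮} (f : X →ₗ[Sᵐᵒᵖ] M) : homObj ρ hρ D M := f

/-- The functor of homomorphisms out of a graded bimodule. -/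
noncomputable def homFunctor : GrMod 𝒮 ⥤ GrMod ℛ where
  obj M := homObj ρ hρ D M
  map {M N} f :=
    { toLinearMap :=
        { toFun := fun g => homObj.ofLin ρ hρ D (f.toLinearMap ∘ₗ (g : X →ₗ[Sᵐᵒᵖ] M))
          map_add' := fun _ _ => LinearMap.comp_add _ _ _
          map_smul' := fun _ _ => rfl }
      map_mem := fun hg ε x hx => f.map_mem (hg ε x hx) }

/-- The functor of homomorphisms out of a bimodule, for a given choice of the gradings. -/
noncomputable def homFunctorOfDeg (d : ∀ M : GrMod 𝒮, Γ → AddSubgroup (X →ₗ[Sᵐᵒᵖ] M))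
    (h1 : ∀ M, DirectSum.IsInternal (d M))
    (h2 : ∀ M γ δ, ∀ f ∈ d M γ, ∀ r ∈ ℛ δ, f ∘ₗ (ρ r : X →ₗ[Sᵐᵒᵖ] X) ∈ d M (γ + δ))
    (h3 : ∀ (M N : GrMod 𝒮) (f : M ⟶ N), ∀ γ, ∀ g ∈ d M γ, f.toLinearMap ∘ₗ g ∈ d N γ) :
    GrMod 𝒮 ⥤ GrMod ℛ where
  obj M :=
    { carrier := X →ₗ[Sᵐᵒᵖ] M
      module := homModule ρ M
      deg := d M
      isInternal := h1 M
      smul_mem := fun hf hr => h2 _ _ _ _ hf _ hr }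
  map {M N} f :=
    ⟨letI := homModule ρ M
     letI := homModule ρ N
     { toFun := fun g => f.toLinearMap ∘ₗ (g : X →ₗ[Sᵐᵒᵖ] M)
       map_add' := fun _ _ => LinearMap.comp_add _ _ _
       map_smul' := fun _ _ => rfl }, fun hg => h3 _ _ _ _ _ hg⟩

omit [GradedRing 𝒮] in
-- The two composites of a Hom functor with a shift have the same carriers, actions and maps; only
-- their gradings differ, `α + (γ + ε)` against `α + γ + ε`. With the grading as a parameter,
-- equality of gradings yields equality of functors by substitution.
theorem homFunctorOfDeg_congr {d d' : ∀ M : GrMod 𝒮, Γ → AddSubgroup (X →ₗ[Sᵐᵒᵖ] M)} (h : d = d')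
    {h1 h2 h3 h1' h2' h3'} : homFunctorOfDeg (ℛ := ℛ) ρ d h1 h2 h3 =
      homFunctorOfDeg ρ d' h1' h2' h3' := by
  subst h
  rfl

theorem isGradedFunctor_homFunctor : IsGradedFunctor (homFunctor ρ hρ D) := by
  intro α
  have hd : (fun (M : GrMod 𝒮) γ => homDeg X (shiftObj α M) γ) =
      fun (M : GrMod 𝒮) γ => homDeg X M (α + γ) := by
    funext M γ
    refine AddSubgroup.ext fun f => forall_congr' fun ε => forall_congr' fun x => ?_
    change (_ → f x ∈ M.deg (α + (γ + ε))) ↔ (_ → f x ∈ M.deg (α + γ + ε))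
    rw [add_assoc]
  exact homFunctorOfDeg_congr (ℛ := ℛ) ρ hd
    (h1 := fun M => ((shift 𝒮 α ⋙ homFunctor ρ hρ D).obj M).isInternal)
    (h2 := fun M γ δ f hf r hr => ((shift 𝒮 α ⋙ homFunctor ρ hρ D).obj M).smul_mem hf hr)
    (h3 := fun M N f γ g hg => ((shift 𝒮 α ⋙ homFunctor ρ hρ D).map f).map_mem hg)
    (h1' := fun M => ((homFunctor ρ hρ D ⋙ shift ℛ α).obj M).isInternal)
    (h2' := fun M γ δ f hf r hr => ((homFunctor ρ hρ D ⋙ shift ℛ α).obj M).smul_mem hf hr)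
    (h3' := fun M N f γ g hg => ((homFunctor ρ hρ D ⋙ shift ℛ α).map f).map_mem hg)

end GrMod

end Progenerator

/-! ### The Morita equivalence given by a progenerator -/

section Morita

variable {Γ : Type w} [AddCommGroup Γ] [DecidableEq Γ] {R S : Type u} [Ring R] [Ring S]
  {ℛ : Γ → AddSubgroup R} {𝒮 : Γ → AddSubgroup S}

namespace GrMod

/-- A bijective graded homomorphism is an isomorphism. -/
noncomputable def isoOfBijective {M N : GrMod ℛ} (f : Hom M N)
    (hf : Function.Bijective f.toLinearMap) : M ≅ N :=
  isoMk (LinearEquiv.ofBijective f.toLinearMap hf) (fun _ _ h => f.map_mem h) fun γ n hn => by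
    obtain ⟨m, rfl⟩ := hf.2 n
    have h1 : m = M.proj γ m := hf.1 (by rw [← f.map_proj, N.proj_of_mem hn])
    have h2 : (LinearEquiv.ofBijective f.toLinearMap hf).symm (f.toLinearMap m) = m :=
      (LinearEquiv.ofBijective f.toLinearMap hf).symm_apply_apply m
    rw [h2, h1]
    exact M.proj_mem γ m

variable [GradedRing 𝒮] {Q : GrMod 𝒮} (ρ : R ≃+* EndRing Q)
  (hρ : ∀ γ r, r ∈ ℛ γ ↔ ρ r ∈ EndRing.deg Q γ) (D : DualBasis Q)

/-- The dual of a graded bimodule. -/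
noncomputable def dualMod : GrMod ℛ :=
  homObj (ρ : R →+* EndRing Q) (fun γ r => (hρ γ r).1) D (regular 𝒮)

namespace dualMod

/-- The elements of the dual are the linear functionals. -/
noncomputable def toLin : dualMod ρ hρ D ≃+ (Q →ₗ[Sᵐᵒᵖ] S) := AddEquiv.refl _

variable {ρ hρ D}

theorem ext {g h : dualMod ρ hρ D} (H : ∀ x, toLin ρ hρ D g x = toLin ρ hρ D h x) : g = h :=
  (toLin ρ hρ D).injective (LinearMap.ext H)

theorem toLin_smul (r : R) (g : dualMod ρ hρ D) (x : Q) :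
    toLin ρ hρ D (MulOpposite.op r • g) x = toLin ρ hρ D g (ρ r x) := rfl

theorem mem_deg {γ : Γ} {g : dualMod ρ hρ D} :
    g ∈ (dualMod ρ hρ D).deg γ ↔ ∀ ε, ∀ x ∈ Q.deg ε, toLin ρ hρ D g x ∈ 𝒮 (γ + ε) := Iff.rfl

variable (ρ hρ D) in
/-- The left action on the dual. -/
noncomputable def leftMul : S →+* EndRing (dualMod ρ hρ D) where
  toFun s := .ofLin
    { toFun := fun g => (toLin ρ hρ D).symm (mulLeft s ∘ₗ toLin ρ hρ D g)
      map_add' := fun _ _ => ext fun _ => mul_add s _ _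
      map_smul' := fun _ _ => rfl }
  map_one' := EndRing.ext fun _ => ext fun _ => one_mul _
  map_mul' s t := EndRing.ext fun _ => ext fun _ => mul_assoc s t _
  map_zero' := EndRing.ext fun _ => ext fun _ => zero_mul _
  map_add' s t := EndRing.ext fun _ => ext fun _ => add_mul s t _

theorem toLin_leftMul (s : S) (g : dualMod ρ hρ D) (x : Q) :
    toLin ρ hρ D (leftMul ρ hρ D s g) x = s * toLin ρ hρ D g x := rfl

variable (ρ hρ D) in
theorem leftMul_mem (γ : Γ) (s : S) (hs : s ∈ 𝒮 γ) :
    leftMul ρ hρ D s ∈ EndRing.deg (dualMod ρ hρ D) γ := by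
  intro δ g hg
  rw [mem_deg] at hg ⊢
  intro ε x hx
  rw [toLin_leftMul, add_assoc]
  exact SetLike.mul_mem_graded hs (hg ε x hx)

variable (ρ hρ D) in
/-- The pairing of the bimodule and its dual with values in the ring of endomorphisms. -/
noncomputable def pair (q : Q) (g : dualMod ρ hρ D) : R :=
  ρ.symm (EndRing.ofLin (mulRight q ∘ₗ toLin ρ hρ D g))

theorem apply_pair (q : Q) (g : dualMod ρ hρ D) (x : Q) :
    ρ (pair ρ hρ D q g) x = MulOpposite.op (toLin ρ hρ D g x) • q := by
  rw [pair, RingEquiv.apply_symm_apply]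
  rfl

theorem eq_pair {r : R} {q : Q} {g : dualMod ρ hρ D}
    (h : ∀ x, ρ r x = MulOpposite.op (toLin ρ hρ D g x) • q) : r = pair ρ hρ D q g :=
  ρ.injective (EndRing.ext fun x => by rw [h, apply_pair])

theorem pair_add_left (q q' : Q) (g : dualMod ρ hρ D) :
    pair ρ hρ D (q + q') g = pair ρ hρ D q g + pair ρ hρ D q' g :=
  (eq_pair fun x => by
    rw [map_add, EndRing.add_apply, apply_pair, apply_pair, smul_add]).symm

theorem pair_add_right (q : Q) (g g' : dualMod ρ hρ D) :
    pair ρ hρ D q (g + g') = pair ρ hρ D q g + pair ρ hρ D q g' :=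
  (eq_pair fun x => by
    rw [map_add, EndRing.add_apply, apply_pair, apply_pair, map_add, LinearMap.add_apply,
      MulOpposite.op_add, add_smul]).symm

theorem pair_smul_right (q : Q) (g : dualMod ρ hρ D) (r : R) :
    pair ρ hρ D q (MulOpposite.op r • g) = pair ρ hρ D q g * r :=
  (eq_pair fun x => by
    rw [map_mul, EndRing.mul_apply, apply_pair, toLin_smul]).symm

theorem pair_smul_left (q : Q) (g : dualMod ρ hρ D) (s : S) :
    pair ρ hρ D (MulOpposite.op s • q) g = pair ρ hρ D q (leftMul ρ hρ D s g) :=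
  eq_pair fun x => by
    rw [apply_pair, toLin_leftMul, MulOpposite.op_mul, mul_smul]

theorem pair_apply_left (r : R) (q : Q) (g : dualMod ρ hρ D) :
    pair ρ hρ D (ρ r q) g = r * pair ρ hρ D q g :=
  (eq_pair fun x => by
    rw [map_mul, EndRing.mul_apply, apply_pair, map_smul]).symm

/-- This is the associativity of the Morita context: `g' (q * g x) = g' q * g x`. -/
theorem smul_pair (q : Q) (g g' : dualMod ρ hρ D) :
    MulOpposite.op (pair ρ hρ D q g) • g' = leftMul ρ hρ D (toLin ρ hρ D g' q) g :=
  ext fun x => by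
    rw [toLin_smul, apply_pair, map_smul, toLin_leftMul]
    rfl

theorem pair_mem {γ δ : Γ} {q : Q} {g : dualMod ρ hρ D} (hq : q ∈ Q.deg γ)
    (hg : g ∈ (dualMod ρ hρ D).deg δ) : pair ρ hρ D q g ∈ ℛ (γ + δ) := by
  rw [hρ]
  intro ε x hx
  rw [apply_pair, add_assoc]
  exact Q.smul_mem hq (mem_deg.1 hg ε x hx)

/-- The dual basis of `Q` writes `1 ∈ R` as a sum of pairings, as the generator property writes `1 ∈
S` as a sum of values of functionals. Each of these two partitions of unity inverts one of the
natural maps below. -/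
theorem sum_pair : ∑ k, pair ρ hρ D (D.q k) ((toLin ρ hρ D).symm (D.σ k)) = 1 := by
  refine ρ.injective (EndRing.ext fun x => ?_)
  rw [map_sum, EndRing.sum_apply, map_one, EndRing.one_apply]
  conv_rhs => rw [← D.sum x]
  exact Finset.sum_congr rfl fun k _ => by rw [apply_pair, AddEquiv.apply_symm_apply]

/-- The dual basis of the dual bimodule given by a partition of unity. -/
noncomputable def dualBasis {n : ℕ} {δ : Fin n → Γ} {q : Fin n → Q} {g : Fin n → Q →ₗ[Sᵐᵒᵖ] S}
    (hq : ∀ k, q k ∈ Q.deg (-δ k)) (hg : ∀ k γ, ∀ x ∈ Q.deg γ, g k x ∈ 𝒮 (δ k + γ))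
    (hsum : ∑ k, g k (q k) = 1) : DualBasis (dualMod ρ hρ D) where
  n := n
  δ := δ
  q k := (toLin ρ hρ D).symm (g k)
  σ k :=
    { toFun := pair ρ hρ D (q k)
      map_add' := pair_add_right (q k)
      map_smul' := fun r f => pair_smul_right (q k) f r.unop }
  q_mem := hg
  σ_mem k {γ f} hf := by
    rw [sub_eq_neg_add]
    exact pair_mem (hq k) hf
  sum f := by
    refine Eq.trans (Finset.sum_congr rfl fun k _ => smul_pair (q k) f _) ?_
    simp only [AddEquiv.apply_symm_apply]
    rw [← EndRing.sum_apply, ← map_sum, hsum, map_one, EndRing.one_apply]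

variable (ρ hρ D) in
/-- The functor `Hom(Q, -)`. -/
noncomputable def homFrom : GrMod 𝒮 ⥤ GrMod ℛ :=
  homFunctor (ρ : R →+* EndRing Q) (fun γ r => (hρ γ r).1) D

variable (ρ hρ D) in
/-- The elements of `Hom(Q, M)`. -/
noncomputable def fromLin (M : GrMod 𝒮) : (homFrom ρ hρ D).obj M ≃+ (Q →ₗ[Sᵐᵒᵖ] M) :=
  AddEquiv.refl _

theorem fromLin_ext {M : GrMod 𝒮} {f g : (homFrom ρ hρ D).obj M}
    (h : ∀ x, fromLin ρ hρ D M f x = fromLin ρ hρ D M g x) : f = g :=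
  (fromLin ρ hρ D M).injective (LinearMap.ext h)

theorem fromLin_add {M : GrMod 𝒮} (f g : (homFrom ρ hρ D).obj M) (x : Q) :
    fromLin ρ hρ D M (f + g) x = fromLin ρ hρ D M f x + fromLin ρ hρ D M g x := rfl

theorem fromLin_sum {M : GrMod 𝒮} {ι : Type*} (s : Finset ι) (f : ι → (homFrom ρ hρ D).obj M)
    (x : Q) : fromLin ρ hρ D M (∑ i ∈ s, f i) x = ∑ i ∈ s, fromLin ρ hρ D M (f i) x := by
  rw [map_sum, LinearMap.sum_apply]

theorem fromLin_smul {M : GrMod 𝒮} (r : Rᵐᵒᵖ) (f : (homFrom ρ hρ D).obj M) (x : Q) :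
    fromLin ρ hρ D M (r • f) x = fromLin ρ hρ D M f (ρ r.unop x) := rfl

/-- The functional `g ↦ (x ↦ m * g x)` on the dual. -/
noncomputable def unitAt (M : GrMod 𝒮) (m : M) :
    dualMod ρ hρ D →ₗ[Rᵐᵒᵖ] (homFrom ρ hρ D).obj M where
  toFun g := (fromLin ρ hρ D M).symm (mulRight m ∘ₗ toLin ρ hρ D g)
  map_add' g h := fromLin_ext fun x => by
    rw [fromLin_add]
    change MulOpposite.op (toLin ρ hρ D (g + h) x) • m =
      MulOpposite.op (toLin ρ hρ D g x) • m + MulOpposite.op (toLin ρ hρ D h x) • m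
    rw [map_add, LinearMap.add_apply, MulOpposite.op_add, add_smul]
  map_smul' _ _ := fromLin_ext fun _ => rfl

theorem fromLin_unitAt (M : GrMod 𝒮) (m : M) (g : dualMod ρ hρ D) (x : Q) :
    fromLin ρ hρ D M (unitAt M m g) x = MulOpposite.op (toLin ρ hρ D g x) • m := rfl

/-- The homomorphism `g ↦ n * pair q g` on the dual. -/
noncomputable def counitAt (N : GrMod ℛ) (n : N) (q : Q) : dualMod ρ hρ D →ₗ[Rᵐᵒᵖ] N where
  toFun g := MulOpposite.op (pair ρ hρ D q g) • n
  map_add' g h := by rw [pair_add_right, MulOpposite.op_add, add_smul]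
  map_smul' r g := by
    rw [RingHom.id_apply, ← mul_smul]
    exact congrArg (· • n) (congrArg MulOpposite.op (pair_smul_right q g r.unop))

theorem counitAt_apply (N : GrMod ℛ) (n : N) (q : Q) (g : dualMod ρ hρ D) :
    counitAt N n q g = MulOpposite.op (pair ρ hρ D q g) • n := rfl

variable [GradedRing ℛ] (D' : DualBasis (dualMod ρ hρ D))

variable (ρ hρ D) in
/-- The functor of homomorphisms from the dual of `Q`. -/
noncomputable def homFromDual (D' : DualBasis (dualMod ρ hρ D)) : GrMod ℛ ⥤ GrMod 𝒮 :=
  homFunctor (leftMul ρ hρ D) (leftMul_mem ρ hρ D) D'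

/-- The elements of the module of homomorphisms from the dual. -/
noncomputable def fromDualLin (N : GrMod ℛ) :
    (homFromDual ρ hρ D D').obj N ≃+ (dualMod ρ hρ D →ₗ[Rᵐᵒᵖ] N) :=
  AddEquiv.refl _

theorem fromDualLin_ext {N : GrMod ℛ} {f g : (homFromDual ρ hρ D D').obj N}
    (h : ∀ x, fromDualLin D' N f x = fromDualLin D' N g x) : f = g :=
  (fromDualLin D' N).injective (LinearMap.ext h)

theorem fromDualLin_add {N : GrMod ℛ} (f g : (homFromDual ρ hρ D D').obj N) (x : dualMod ρ hρ D) :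
    fromDualLin D' N (f + g) x = fromDualLin D' N f x + fromDualLin D' N g x := rfl

theorem fromDualLin_sum {N : GrMod ℛ} {ι : Type*} (s : Finset ι)
    (f : ι → (homFromDual ρ hρ D D').obj N) (x : dualMod ρ hρ D) :
    fromDualLin D' N (∑ i ∈ s, f i) x = ∑ i ∈ s, fromDualLin D' N (f i) x := by
  rw [map_sum, LinearMap.sum_apply]

theorem fromDualLin_smul {N : GrMod ℛ} (s : Sᵐᵒᵖ) (f : (homFromDual ρ hρ D D').obj N)
    (x : dualMod ρ hρ D) :
    fromDualLin D' N (s • f) x = fromDualLin D' N f (leftMul ρ hρ D s.unop x) := rfl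

/-- The natural map from a module to its image under both functors. -/
noncomputable def unit (M : GrMod 𝒮) :
    Hom M ((homFromDual ρ hρ D D').obj ((homFrom ρ hρ D).obj M)) where
  toLinearMap :=
    { toFun := fun m => (fromDualLin D' _).symm (unitAt M m)
      map_add' := fun m m' => fromDualLin_ext D' fun g => fromLin_ext fun x =>
        smul_add (MulOpposite.op (toLin ρ hρ D g x)) m m'
      map_smul' := fun s m => fromDualLin_ext D' fun g => fromLin_ext fun x =>
        (mul_smul (MulOpposite.op (toLin ρ hρ D g x)) s m).symm }
  map_mem {γ m} hm ε g hg δ x hx := by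
    have := M.smul_mem hm (mem_deg.1 hg δ x hx)
    rwa [← add_assoc] at this

theorem unit_apply (M : GrMod 𝒮) (m : M) :
    fromDualLin D' _ ((unit D' M).toLinearMap m) = unitAt M m := rfl

/-- The homomorphism `q ↦ (g ↦ n * pair q g)`. -/
noncomputable def counitLin (N : GrMod ℛ) (n : N) :
    Q →ₗ[Sᵐᵒᵖ] (homFromDual ρ hρ D D').obj N where
  toFun q := (fromDualLin D' N).symm (counitAt N n q)
  map_add' q q' := fromDualLin_ext D' fun g => by
    rw [fromDualLin_add]
    change MulOpposite.op (pair ρ hρ D (q + q') g) • n =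
      MulOpposite.op (pair ρ hρ D q g) • n + MulOpposite.op (pair ρ hρ D q' g) • n
    rw [pair_add_left, MulOpposite.op_add, add_smul]
  map_smul' s q := fromDualLin_ext D' fun g =>
    congrArg (fun r => MulOpposite.op r • n) (pair_smul_left q g s.unop)

/-- The natural map from a module to its image under both functors, in the other order. -/
noncomputable def counit (N : GrMod ℛ) :
    Hom N ((homFrom ρ hρ D).obj ((homFromDual ρ hρ D D').obj N)) where
  toLinearMap :=
    { toFun := fun n => (fromLin ρ hρ D _).symm (counitLin D' N n)
      map_add' := fun n n' => fromLin_ext fun q => fromDualLin_ext D' fun g =>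
        smul_add (MulOpposite.op (pair ρ hρ D q g)) n n'
      map_smul' := fun r n => fromLin_ext fun q => fromDualLin_ext D' fun g => by
        change MulOpposite.op (pair ρ hρ D q g) • r • n =
          MulOpposite.op (pair ρ hρ D (ρ r.unop q) g) • n
        rw [pair_apply_left, ← mul_smul]
        rfl }
  map_mem {γ n} hn ε q hq δ g hg := by
    have := N.smul_mem hn (pair_mem hq hg)
    rwa [← add_assoc] at this

theorem counit_apply (N : GrMod ℛ) (n : N) (q : Q) :
    fromDualLin D' N (fromLin ρ hρ D _ ((counit D' N).toLinearMap n) q) = counitAt N n q := rfl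

/-- The partition `∑ g k (q k) = 1` recovers `m` by evaluation. For surjectivity it also expands any
functional as `f = ∑ g k * pair (q k) f`, so `H` is determined by its values on the `g k`. -/
theorem unit_bijective {n : ℕ} {q : Fin n → Q} {g : Fin n → Q →ₗ[Sᵐᵒᵖ] S}
    (hsum : ∑ k, g k (q k) = 1) (M : GrMod 𝒮) : Function.Bijective (unit D' M).toLinearMap := by
  have hs : ∀ m : M, ∑ k, fromLin ρ hρ D M (unitAt M m ((toLin ρ hρ D).symm (g k))) (q k) = m :=
    fun m => by
      simp only [fromLin_unitAt, AddEquiv.apply_symm_apply]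
      rw [← Finset.sum_smul, ← Finset.op_sum, hsum, MulOpposite.op_one, one_smul]
  refine ⟨fun m m' h => ?_, fun H => ?_⟩
  · rw [← hs m, ← hs m', ← unit_apply D', ← unit_apply D', h]
  · refine ⟨∑ k, fromLin ρ hρ D M (fromDualLin D' _ H ((toLin ρ hρ D).symm (g k))) (q k),
      fromDualLin_ext D' fun f => fromLin_ext fun x => ?_⟩
    have hf : ∑ k, MulOpposite.op (pair ρ hρ D (q k) f) • (toLin ρ hρ D).symm (g k) = f := by
      simp only [smul_pair, AddEquiv.apply_symm_apply]
      rw [← EndRing.sum_apply, ← map_sum, hsum, map_one, EndRing.one_apply]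
    conv_rhs => rw [← hf, map_sum, fromLin_sum]
    rw [unit_apply, fromLin_unitAt, Finset.smul_sum]
    refine Finset.sum_congr rfl fun k _ => ?_
    rw [map_smul, fromLin_smul, MulOpposite.unop_op, apply_pair, map_smul]

/-- The same argument with the partition `∑ pair (q k) (σ k) = 1` of the unit of `R`. -/
theorem counit_bijective (N : GrMod ℛ) : Function.Bijective (counit D' N).toLinearMap := by
  have hs : ∀ n : N, ∑ k, counitAt N n (D.q k) ((toLin ρ hρ D).symm (D.σ k)) = n :=
    fun n => by
      simp only [counitAt_apply]
      rw [← Finset.sum_smul, ← Finset.op_sum, sum_pair, MulOpposite.op_one, one_smul]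
  refine ⟨fun n n' h => ?_, fun H => ?_⟩
  · rw [← hs n, ← hs n']
    refine Finset.sum_congr rfl fun k _ => ?_
    rw [← counit_apply D', ← counit_apply D', h]
  · refine ⟨∑ k, fromDualLin D' N (fromLin ρ hρ D _ H (D.q k)) ((toLin ρ hρ D).symm (D.σ k)),
      fromLin_ext fun q => fromDualLin_ext D' fun g => ?_⟩
    conv_rhs => rw [← D.sum q, map_sum, fromDualLin_sum]
    rw [counit_apply, counitAt_apply, Finset.smul_sum]
    refine Finset.sum_congr rfl fun k _ => ?_
    rw [map_smul, fromDualLin_smul, MulOpposite.unop_op, ← map_smul, smul_pair,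
      AddEquiv.apply_symm_apply]

end dualMod

open dualMod in
-- Both functors are Hom functors, which makes them commute strictly with shifts. The partition of
-- unity is what provides the dual of `Q` with a dual basis, so that homomorphisms out of it are
-- graded as well.
theorem gradedMoritaEquivalent_of_progenerator {n : ℕ} {δ : Fin n → Γ} {q : Fin n → Q}
    {g : Fin n → Q →ₗ[Sᵐᵒᵖ] S} [GradedRing ℛ] (ρ : R ≃+* EndRing Q)
    (hρ : ∀ γ r, r ∈ ℛ γ ↔ ρ r ∈ EndRing.deg Q γ) (D : DualBasis Q)
    (hq : ∀ k, q k ∈ Q.deg (-δ k)) (hg : ∀ k γ, ∀ x ∈ Q.deg γ, g k x ∈ 𝒮 (δ k + γ))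
    (hsum : ∑ k, g k (q k) = 1) : GradedMoritaEquivalent ℛ 𝒮 := by
  let D' : DualBasis (dualMod ρ hρ D) := dualBasis hq hg hsum
  refine ⟨homFromDual ρ hρ D D', homFrom ρ hρ D, isGradedFunctor_homFunctor _ _ _,
    isGradedFunctor_homFunctor _ _ _, ⟨Iso.symm ?_⟩, ⟨Iso.symm ?_⟩⟩
  · exact NatIso.ofComponents (fun N => isoOfBijective (counit D' N) (counit_bijective D' N))
      fun {N N'} f => Hom.ext' fun n => fromLin_ext (hρ := hρ) (D := D) fun q => fromDualLin_ext D' fun g =>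
        (map_smul f.toLinearMap (MulOpposite.op (pair ρ hρ D q g)) n).symm
  · exact NatIso.ofComponents (fun M => isoOfBijective (unit D' M) (unit_bijective D' hsum M))
      fun {M M'} f => Hom.ext' fun m => fromDualLin_ext D' fun g =>
        fromLin_ext (hρ := hρ) (D := D) fun x => (map_smul f.toLinearMap (MulOpposite.op (toLin ρ hρ D g x)) m).symm

end GrMod

end Morita

/-! ### Equivalences of categories of graded modules -/

section Equivalence

variable {Γ : Type w} [AddCommGroup Γ] [DecidableEq Γ] {R S : Type u} [Ring R] [Ring S]
  {ℛ : Γ → AddSubgroup R} {𝒮 : Γ → AddSubgroup S}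

namespace GrMod

theorem range_proj_mem {M N : GrMod ℛ} (f : Hom M N) (γ : Γ) (n : N)
    (hn : n ∈ LinearMap.range f.toLinearMap) : N.proj γ n ∈ LinearMap.range f.toLinearMap := by
  obtain ⟨m, rfl⟩ := hn
  exact ⟨M.proj γ m, (f.map_proj γ m).symm⟩

/-- The zero homomorphism. -/
def zeroHom (M N : GrMod ℛ) : M ⟶ N := (⟨0, fun _ => zero_mem _⟩ : Hom M N)

theorem comp_zeroHom {M N P : GrMod ℛ} (f : M ⟶ N) : f ≫ zeroHom N P = zeroHom M P :=
  Hom.ext' fun _ => rfl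

theorem comp_quotHom {M N : GrMod ℛ} (f : M ⟶ N) (U : Submodule Rᵐᵒᵖ N)
    (hU : ∀ γ, ∀ m ∈ U, N.proj γ m ∈ U) (h : LinearMap.range f.toLinearMap ≤ U) :
    f ≫ N.quotHom U hU = zeroHom M (N.quot U hU) :=
  Hom.ext' fun x => (Submodule.Quotient.mk_eq_zero U).2 (h ⟨x, rfl⟩)

theorem eq_top_of_quotHom_eq_zero {N : GrMod ℛ} (U : Submodule Rᵐᵒᵖ N)
    (hU : ∀ γ, ∀ m ∈ U, N.proj γ m ∈ U) (h : N.quotHom U hU = zeroHom N (N.quot U hU)) :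
    U = ⊤ := by
  rw [eq_top_iff]
  intro x _
  exact (Submodule.Quotient.mk_eq_zero U).1
    (LinearMap.congr_fun (congrArg Hom.toLinearMap h) x)

/-- The range of a graded homomorphism is a graded submodule. The projection to its quotient and the
zero map agree after composition with `f`, so if `f` is epi the quotient vanishes. -/
theorem epi_iff_surjective {M N : GrMod ℛ} (f : M ⟶ N) :
    Epi f ↔ Function.Surjective f.toLinearMap := by
  refine ⟨fun hf => ?_, fun hf => ⟨fun g h hgh => Hom.ext' fun x => ?_⟩⟩
  · have hU := range_proj_mem f
    rw [← LinearMap.range_eq_top]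
    refine eq_top_of_quotHom_eq_zero _ hU ((cancel_epi f).1 ?_)
    rw [comp_quotHom f _ hU le_rfl, comp_zeroHom]
  · obtain ⟨y, rfl⟩ := hf x
    exact LinearMap.congr_fun (congrArg Hom.toLinearMap hgh) y

theorem projective_iff {P : GrMod ℛ} : Projective P ↔ IsGradedProjective P := by
  refine ⟨fun hP M N g j hg => ?_, fun hP => ⟨fun {E X} f e he => ?_⟩⟩
  · have : Epi (X := M) (Y := N) g := (epi_iff_surjective (M := M) (N := N) g).2 hg
    obtain ⟨h, hh⟩ := hP.factors (E := M) (X := N) j g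
    exact ⟨h, congrArg Hom.toLinearMap hh⟩
  · obtain ⟨h, hh⟩ := hP E X e f ((epi_iff_surjective e).1 he)
    exact ⟨h, Hom.ext hh⟩

/-! ### Finite generation as a categorical property -/

section Finite

variable [GradedRing ℛ]

theorem proj_smul_mem {M : GrMod ℛ} (N : Submodule Rᵐᵒᵖ M) {m : M} (hm : ∀ γ, M.proj γ m ∈ N)
    (r : R) (γ : Γ) : M.proj γ (MulOpposite.op r • m) ∈ N := by
  induction r using DirectSum.Decomposition.inductionOn ℛ with
  | zero => simp
  | homogeneous r =>
    rename_i δ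
    have := M.proj_smul r.2 (γ - δ) m
    rw [sub_add_cancel] at this
    rw [this]
    exact N.smul_mem _ (hm _)
  | add r s hr hs =>
    rw [MulOpposite.op_add, add_smul, map_add]
    exact add_mem hr hs

/-- Finitely generated graded submodules. -/
def FGSub (M : GrMod ℛ) : Type u :=
  {N : Submodule Rᵐᵒᵖ M // N.FG ∧ ∀ γ, ∀ m ∈ N, M.proj γ m ∈ N}

theorem exists_fgSub_mem (M : GrMod ℛ) (m : M) : ∃ N : FGSub M, m ∈ N.1 := by
  classical
  obtain ⟨s, hs⟩ := M.exists_sum_proj m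
  let T : Finset M := s.image fun γ => M.proj γ m
  refine ⟨⟨Submodule.span Rᵐᵒᵖ (T : Set M), ⟨T, rfl⟩, fun γ x hx => ?_⟩, ?_⟩
  · suffices ∀ γ, M.proj γ x ∈ Submodule.span Rᵐᵒᵖ (T : Set M) from this γ
    induction hx using Submodule.span_induction with
    | mem x hx =>
      intro γ
      obtain ⟨δ, -, rfl⟩ := Finset.mem_image.1 hx
      by_cases h : γ = δ
      · subst h
        rw [M.proj_of_mem (M.proj_mem _ _)]
        exact Submodule.subset_span hx
      · rw [M.proj_of_mem_ne h (M.proj_mem _ _)]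
        exact zero_mem _
    | zero => simp
    | add x y _ _ hx hy =>
      intro γ
      rw [map_add]
      exact add_mem (hx γ) (hy γ)
    | smul r x _ hx => exact proj_smul_mem _ hx r.unop
  · change m ∈ Submodule.span Rᵐᵒᵖ (T : Set M)
    rw [← hs s subset_rfl]
    exact sum_mem fun γ hγ => Submodule.subset_span (Finset.mem_image_of_mem _ hγ)

omit [GradedRing ℛ] in
theorem exists_fgSub_sup (M : GrMod ℛ) (N N' : FGSub M) : ∃ N'' : FGSub M, N.1 ≤ N''.1 ∧
    N'.1 ≤ N''.1 :=
  ⟨⟨N.1 ⊔ N'.1, N.2.1.sup N'.2.1, fun γ m hm => by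
    obtain ⟨x, hx, y, hy, rfl⟩ := Submodule.mem_sup.1 hm
    rw [map_add]
    exact Submodule.add_mem_sup (N.2.2 γ x hx) (N'.2.2 γ y hy)⟩, le_sup_left, le_sup_right⟩

end Finite

/-- The module `M = e.functor.obj P` is the directed union of its finitely generated graded
submodules `N`. The inclusions correspond by adjunction to maps into `P` whose ranges `U N` are
directed with supremum `P`. As `P` is finitely generated, some `U N` is all of `P`; then the
inclusion of `N` is epi, hence `N = M`. -/
theorem finite_functor_obj [GradedRing 𝒮] (e : GrMod ℛ ≌ GrMod 𝒮) {P : GrMod ℛ}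
    (hP : Module.Finite Rᵐᵒᵖ P) : Module.Finite Sᵐᵒᵖ (e.functor.obj P) := by
  let M := e.functor.obj P
  let adj := e.symm.toAdjunction
  let i : ∀ N : FGSub M, M.sub N.1 N.2.2 ⟶ M := fun N => M.subHom N.1 N.2.2
  let j : ∀ N : FGSub M, e.inverse.obj (M.sub N.1 N.2.2) ⟶ P := fun N =>
    (adj.homEquiv _ P).symm (i N)
  have hj : ∀ N, e.inverse.map (i N) ≫ adj.counit.app P = j N := fun N =>
    (adj.homEquiv_counit _ _ _).symm
  let U : FGSub M → Submodule Rᵐᵒᵖ P := fun N => LinearMap.range (j N).toLinearMap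
  have hmono : ∀ N N' : FGSub M, N.1 ≤ N'.1 → U N ≤ U N' := by
    rintro N N' h _ ⟨x, rfl⟩
    let k : M.sub N.1 N.2.2 ⟶ M.sub N'.1 N'.2.2 :=
      (⟨Submodule.inclusion h, fun hm => hm⟩ : Hom (M.sub N.1 N.2.2) (M.sub N'.1 N'.2.2))
    have hk : e.inverse.map k ≫ j N' = j N := by
      rw [← hj, ← hj, ← Category.assoc, ← Functor.map_comp]
      rfl
    exact ⟨(e.inverse.map k).toLinearMap x, LinearMap.congr_fun (congrArg Hom.toLinearMap hk) x⟩
  have hne : Nonempty (FGSub M) := ⟨(M.exists_fgSub_mem 0).choose⟩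
  have hdir : Directed (· ≤ ·) U := fun N N' => by
    obtain ⟨N'', h, h'⟩ := M.exists_fgSub_sup N N'
    exact ⟨N'', hmono _ _ h, hmono _ _ h'⟩
  have hgr : ∀ γ, ∀ m ∈ ⨆ N, U N, P.proj γ m ∈ ⨆ N, U N := fun γ m hm => by
    obtain ⟨N, hN⟩ := (Submodule.mem_iSup_of_directed U hdir).1 hm
    exact Submodule.mem_iSup_of_mem N (range_proj_mem (j N) γ m hN)
  -- The projection of `P` modulo the supremum corresponds to a map on `M` vanishing on every `N`,
  -- hence everywhere; faithfulness of the functor brings this back to `P`.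
  have htop : ⨆ N, U N = ⊤ := by
    refine eq_top_of_quotHom_eq_zero _ hgr (e.functor.map_injective (Hom.ext' fun x => ?_))
    obtain ⟨N, hN⟩ := M.exists_fgSub_mem x
    have h1 : j N ≫ P.quotHom _ hgr = j N ≫ zeroHom P (P.quot _ hgr) := by
      rw [comp_quotHom (j N) _ hgr (le_iSup U N), comp_zeroHom]
    have h2 := congrArg (adj.homEquiv _ _) h1
    rw [adj.homEquiv_naturality_right, adj.homEquiv_naturality_right, Equiv.apply_symm_apply] at h2
    exact LinearMap.congr_fun (congrArg Hom.toLinearMap h2) ⟨x, hN⟩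
  have hcomp := (Submodule.fg_iff_compact _).1 hP.fg_top
  rw [CompleteLattice.isCompactElement_iff_le_of_directed_sSup_le] at hcomp
  obtain ⟨_, ⟨N, rfl⟩, hN⟩ := hcomp (Set.range U) (Set.range_nonempty U)
    (directedOn_range.2 hdir) (by rw [sSup_range, htop])
  have h1 : Epi (j N) :=
    (epi_iff_surjective _).2 (LinearMap.range_eq_top.1 (top_le_iff.1 hN))
  have h2 : Epi (e.inverse.map (i N)) := by
    have : e.inverse.map (i N) = j N ≫ inv (adj.counit.app P) := by
      rw [← hj, Category.assoc, IsIso.hom_inv_id, Category.comp_id]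
    rw [this]
    infer_instance
  have h3 : Epi (i N) := e.inverse.epi_of_epi_map h2
  have : Module.Finite Sᵐᵒᵖ (M.sub N.1 N.2.2) := Module.Finite.iff_fg.2 N.2.1
  exact Module.Finite.of_surjective _ ((epi_iff_surjective (i N)).1 h3)

theorem isGradedProjective_functor_obj (e : GrMod ℛ ≌ GrMod 𝒮) {P : GrMod ℛ}
    (hP : IsGradedProjective P) : IsGradedProjective (e.functor.obj P) :=
  projective_iff.1 ((e.map_projective_iff P).2 (projective_iff.2 hP))

/-- The projections make `prod M N` a product. -/
def isLimitProd (M N : GrMod ℛ) :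
    Limits.IsLimit (Limits.BinaryFan.mk (P := prod M N)
      (⟨LinearMap.fst Rᵐᵒᵖ M N, fun h => h.1⟩ : Hom (prod M N) M)
      (⟨LinearMap.snd Rᵐᵒᵖ M N, fun h => h.2⟩ : Hom (prod M N) N)) :=
  Limits.BinaryFan.isLimitMk
    (fun s => (⟨LinearMap.prod s.fst.toLinearMap s.snd.toLinearMap,
      fun h => ⟨s.fst.map_mem h, s.snd.map_mem h⟩⟩ : Hom s.pt (prod M N)))
    (fun _ => rfl) (fun _ => rfl) fun s m h1 h2 => Hom.ext' fun x => by
      have e1 := LinearMap.congr_fun (congrArg Hom.toLinearMap h1) x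
      have e2 := LinearMap.congr_fun (congrArg Hom.toLinearMap h2) x
      exact Prod.ext e1 e2

/-- Direct sums are characterized as categorical products, which any equivalence preserves, so
additivity of the functor need not be known. -/
theorem functor_obj_prod (e : GrMod ℛ ≌ GrMod 𝒮) (M N : GrMod ℛ) :
    Nonempty (e.functor.obj (prod M N) ≅ prod (e.functor.obj M) (e.functor.obj N)) :=
  ⟨(Limits.mapIsLimitOfPreservesOfIsLimit e.functor _ _
    (isLimitProd M N)).conePointUniqueUpToIso (isLimitProd _ _)⟩

end GrMod

/-- The image of a finitely generated projective module under an equivalence. -/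
def Pgr.map [GradedRing 𝒮] (e : GrMod ℛ ≌ GrMod 𝒮) (P : Pgr ℛ) : Pgr 𝒮 :=
  ⟨e.functor.obj P.1, GrMod.finite_functor_obj e P.2.1,
    GrMod.isGradedProjective_functor_obj e P.2.2⟩

/-- The isomorphism of monoids induced by an equivalence. -/
def Vgr.mapEquiv [GradedRing ℛ] [GradedRing 𝒮] (e : GrMod ℛ ≌ GrMod 𝒮) : Vgr ℛ ≃+ Vgr 𝒮 where
  toFun := Quotient.map (Pgr.map e) fun _ _ ⟨i⟩ => ⟨e.functor.mapIso i⟩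
  invFun := Quotient.map (Pgr.map e.symm) fun _ _ ⟨i⟩ => ⟨e.inverse.mapIso i⟩
  left_inv x := by
    obtain ⟨P, rfl⟩ := x.mk_surjective
    exact Vgr.sound (e.unitIso.app P.1).symm
  right_inv x := by
    obtain ⟨P, rfl⟩ := x.mk_surjective
    exact Vgr.sound (e.counitIso.app P.1)
  map_add' x y := by
    obtain ⟨P, rfl⟩ := x.mk_surjective
    obtain ⟨P', rfl⟩ := y.mk_surjective
    obtain ⟨i⟩ := GrMod.functor_obj_prod e P.1 P'.1
    exact Vgr.sound (P := Pgr.map e (P.prod P')) (Q := (Pgr.map e P).prod (Pgr.map e P')) i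

theorem Vgr.mapEquiv_shift [GradedRing ℛ] [GradedRing 𝒮] (e : GrMod ℛ ≌ GrMod 𝒮)
    (he : IsGradedFunctor e.functor) (α : Γ) (x : Vgr ℛ) :
    Vgr.mapEquiv e (Vgr.shift α x) = Vgr.shift α (Vgr.mapEquiv e x) := by
  obtain ⟨P, rfl⟩ := x.mk_surjective
  exact Vgr.sound (P := Pgr.map e (P.shift α)) (Q := (Pgr.map e P).shift α)
    (eqToIso (Functor.congr_obj (he α) P.1))

/-! ### From isomorphism classes to Grothendieck groups -/

namespace K0gr

/-- The isomorphism of Grothendieck groups induced by an isomorphism of monoids. -/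
noncomputable def congr (F : Vgr ℛ ≃+ Vgr 𝒮) : K0gr ℛ ≃+ K0gr 𝒮 :=
  AddMonoidHom.toAddEquiv (lift ((of 𝒮).comp F.toAddMonoidHom))
    (lift ((of ℛ).comp F.symm.toAddMonoidHom))
    (hom_ext fun x => by
      rw [AddMonoidHom.comp_apply, lift_of]
      refine (lift_of _ _).trans ?_
      exact congrArg (of ℛ) (F.symm_apply_apply x))
    (hom_ext fun x => by
      rw [AddMonoidHom.comp_apply, lift_of]
      refine (lift_of _ _).trans ?_
      exact congrArg (of 𝒮) (F.apply_symm_apply x))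

theorem congr_of (F : Vgr ℛ ≃+ Vgr 𝒮) (x : Vgr ℛ) : congr F (of ℛ x) = of 𝒮 (F x) :=
  lift_of ((of 𝒮).comp F.toAddMonoidHom) x

/-- Compatibility with integers is automatic for an additive map, and compatibility with group
elements need only be tested on classes, where the action is the shift. -/
theorem map_smul_of_shift {f : K0gr ℛ →+ K0gr 𝒮} {F : Vgr ℛ → Vgr 𝒮}
    (hf : ∀ x, f (of ℛ x) = of 𝒮 (F x)) (hF : ∀ α x, F (Vgr.shift α x) = Vgr.shift α (F x))
    (c : AddMonoidAlgebra ℤ Γ) (x : K0gr ℛ) : f (c • x) = c • f x := by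
  induction c using AddMonoidAlgebra.induction_linear with
  | zero => rw [zero_smul, zero_smul, map_zero]
  | add c c' h h' => rw [add_smul, add_smul, map_add, h, h']
  | single α n =>
    have h1 : f ((AddMonoidAlgebra.single α (1 : ℤ)) • x) =
        (AddMonoidAlgebra.single α (1 : ℤ)) • f x := by
      refine DFunLike.congr_fun (f := f.comp (DistribSMul.toAddMonoidHom (K0gr ℛ)
        (AddMonoidAlgebra.single α (1 : ℤ)))) (g := (DistribSMul.toAddMonoidHom (K0gr 𝒮)
        (AddMonoidAlgebra.single α (1 : ℤ))).comp f) (hom_ext fun y => ?_) x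
      change f ((AddMonoidAlgebra.single α (1 : ℤ)) • of ℛ y) =
        (AddMonoidAlgebra.single α (1 : ℤ)) • f (of ℛ y)
      rw [single_smul_of, hf, hF, hf, single_smul_of]
    have h2 : (AddMonoidAlgebra.single α n : AddMonoidAlgebra ℤ Γ) =
        n • AddMonoidAlgebra.single α (1 : ℤ) := by
      rw [AddMonoidAlgebra.smul_single, smul_eq_mul, mul_one]
    rw [h2, smul_assoc, smul_assoc, map_zsmul, h1]

theorem exists_linearEquiv (F : Vgr ℛ ≃+ Vgr 𝒮)
    (hF : ∀ α x, F (Vgr.shift α x) = Vgr.shift α (F x)) :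
    ∃ f : K0gr ℛ ≃ₗ[AddMonoidAlgebra ℤ Γ] K0gr 𝒮,
      f '' (positiveCone ℛ : Set (K0gr ℛ)) = (positiveCone 𝒮 : Set (K0gr 𝒮)) := by
  have h := map_smul_of_shift (F := F) (f := (congr F).toAddMonoidHom) (congr_of F) hF
  refine ⟨{ congr F with map_smul' := h }, Set.ext fun y => ⟨?_, ?_⟩⟩
  · rintro ⟨_, ⟨x, rfl⟩, rfl⟩
    exact ⟨F x, (congr_of F x).symm⟩
  · rintro ⟨y, rfl⟩
    exact ⟨_, ⟨F.symm y, rfl⟩, (congr_of F _).trans (congrArg _ (F.apply_symm_apply y))⟩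

end K0gr

theorem GradedMoritaEquivalent.exists_vgr_equiv [GradedRing ℛ] [GradedRing 𝒮]
    (h : GradedMoritaEquivalent ℛ 𝒮) :
    ∃ F : Vgr ℛ ≃+ Vgr 𝒮, ∀ α x, F (Vgr.shift α x) = Vgr.shift α (F x) := by
  obtain ⟨φ, ψ, hφ, -, ⟨a⟩, ⟨b⟩⟩ := h
  exact ⟨Vgr.mapEquiv (CategoryTheory.Equivalence.mk φ ψ a.symm b), Vgr.mapEquiv_shift _ hφ⟩

end Equivalence

theorem mainTheorem5 {Γ : Type w} [AddCommGroup Γ] [DecidableEq Γ]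
    {A : Type v} [CommRing A] (𝒜 : Γ → AddSubgroup A) [GradedRing 𝒜] (hA : IsGradedField 𝒜)
    {R S : Type u} [Ring R] [Ring S] [Algebra A R] [Algebra A S]
    (ℛ : Γ → AddSubgroup R) [GradedRing ℛ] (𝒮 : Γ → AddSubgroup S) [GradedRing 𝒮]
    (hR : IsGradedUltramatricial 𝒜 ℛ) (hS : IsGradedUltramatricial 𝒜 𝒮) :
    GradedMoritaEquivalent ℛ 𝒮 ↔
      ∃ f : K0gr ℛ ≃ₗ[AddMonoidAlgebra ℤ Γ] K0gr 𝒮,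
        f '' (K0gr.positiveCone ℛ : Set (K0gr ℛ)) = (K0gr.positiveCone 𝒮 : Set (K0gr 𝒮)) := by
  refine ⟨fun h => ?_, fun ⟨f, hf⟩ => ?_⟩
  · obtain ⟨F, hF⟩ := h.exists_vgr_equiv
    exact K0gr.exists_linearEquiv F hF
  · obtain ⟨F, hF⟩ := K0gr.exists_vgr_equiv (K0gr.of_injective hA hR) (K0gr.of_injective hA hS) f hf
    obtain ⟨Q, ρ, hρ, n, δ, q, g, hq, hg, hsum⟩ := hR.exists_progenerator hA hS F hF
    obtain ⟨D⟩ := GrMod.exists_dualBasis Q.2.1 Q.2.2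
    exact GrMod.gradedMoritaEquivalent_of_progenerator ρ hρ D hq hg hsum
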